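/- All algebras are associative algebras over $\mathbb C$, not necessarily unital, with non-degenerate product; $M(A)$ is the multiplier algebra of $A$, and $\iota$ is the identity map. A *regular multiplier Hopf algebra* is such an algebra $A$ with a coassociative homomorphism $\Delta:A\to M(A\otimes A)$ such that $a\otimes b\mapsto\Delta(a)(1\otimes b)$, $(a\otimes 1)\Delta(b)$, $\Delta(a)(b\otimes 1)$, $(1\otimes a)\Delta(b)$ all define bijections of $A\otimes A$ onto itself. A *left (right) integral* is a non-zero functional $\varphi$ (resp. $\psi$) with $(\iota\otimes\varphi)\Delta(a)=\varphi(a)1$ (resp. $(\psi\otimes\iota)\Delta(a)=\psi(a)1$) in $M(A)$ for all $a$. A *pairing* of regular multiplier Hopf algebras $A,B$ is a non-degenerate bilinear form $\langle\cdot,\cdot\rangle$ on $A\times B$ such that: 1. there are a left and a right action of $A$ on $B$ and of $B$ on $A$ with $$\langle a',a\triangleright b\rangle=\langle a'a,b\rangle,\quad \langle a',b\triangleleft a\rangle=\langle aa',b\rangle,\quad \langle b\triangleright a,b'\rangle=\langle a,b'b\rangle,\quad \langle a\triangleleft b,b'\rangle=\langle a,bb'\rangle,$$ and all four are unital (the elements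 of the form $a\triangleright b$ span $B$, and similarly for the others); 2. products and coproducts are dual: $\langle\Delta(a),b\otimes b'\rangle=\langle a,bb'\rangle$ and $\langle a\otimes a',\Delta(b)\rangle=\langle aa',b\rangle$, which means $\langle\Delta(a)(1\otimes a'),b\otimes b'\rangle=\langle a,b(a'\triangleright b')\rangle$ and $\langle a\otimes a',(b\otimes 1)\Delta(b')\rangle=\langle (a\triangleleft b)a',b'\rangle$; 3. $R(a\otimes b)=\sum\langle a_{(2)},b_{(1)}\rangle\,a_{(1)}\otimes b_{(2)}$ is a well-defined bijection of $A\otimes B$ onto itself. **Proposition.** Let $A$ be a regular multiplier Hopf algebra with a left integral $\varphi$. Let $B=\widehat A=\{\varphi(\cdot\,c)\mid c\in A\}$, with the product for which $bb'$ is the functional $a\mapsto(\varphi\otimes\varphi)(\Delta(a)(c\otimes c'))$ when $b=\varphi(\cdot\,c)$ and $b'=\varphi(\cdot\,c')$. Then every $b\in B$ equals $\varphi(\cdot\,c)$ for a unique $c\in A$, so that $\langle a,\varphi(\cdot\,c)\rangle=\varphi(ac)$ is a well-defined bilinear form on $A\times B$. The algebra $A$ has a counit $\varepsilon$, a bijective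 antipode $S:A\to A$ and an automorphism $\sigma$ with $\varphi(ab)=\varphi(b\sigma(a))$ for all $a,b$, and $\varphi\circ S$ is a right integral. There is exactly one regular multiplier Hopf algebra structure on the algebra $B$ for which this form is a pairing of regular multiplier Hopf algebras and the following formulas hold: * $a\triangleright\varphi(\cdot\,c)=\varphi(\cdot\,ac)$ and $\varphi(\cdot\,c)\triangleleft a=\varphi(\cdot\,c\,\sigma(a))$; * $B=\{\varphi(c\,\cdot)\mid c\in A\}$, and if $b=\varphi(c\,\cdot)$ then $b\triangleright a=S\big((\iota\otimes\varphi)(\Delta(c)(1\otimes a))\big)$; * for every right integral $\psi$ (in particular $\psi=\varphi\circ S$), $B=\{\psi(\cdot\,c)\mid c\in A\}$, and if $b=\psi(\cdot\,c)$ then $a\triangleleft b=S\big((\psi\otimes\iota)((a\otimes 1)\Delta(c))\big)$. -/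

import Mathlib

open TensorProduct

namespace MultiplierHopf

section Multipliers

/-- The multiplier algebra `M(A)` of a complex algebra `A` (not assumed unital): pairs consisting of
a left multiplication `b ↦ m b` and a right multiplication `a ↦ a m` with `(a m) b = a (m b)`.
The last two conditions are automatic if the product of `A` is non-degenerate. -/
def MultiplierAlgebra (A : Type*) [NonUnitalRing A] [Module ℂ A] [SMulCommClass ℂ A A]
    [IsScalarTower ℂ A A] : Subalgebra ℂ (Module.End ℂ A × (Module.End ℂ A)ᵐᵒᵖ) where
  carrier := {m | (∀ a b : A, m.2.unop a * b = a * m.1 b) ∧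
    (∀ a b : A, m.1 (a * b) = m.1 a * b) ∧ (∀ a b : A, m.2.unop (a * b) = a * m.2.unop b)}
  mul_mem' := by
    rintro m n ⟨hm, hm₁, hm₂⟩ ⟨hn, hn₁, hn₂⟩
    refine ⟨fun a b => ?_, fun a b => ?_, fun a b => ?_⟩
    · simp [hm, hn]
    · simp [hm₁, hn₁]
    · simp [hm₂, hn₂]
  add_mem' := by
    rintro m n ⟨hm, hm₁, hm₂⟩ ⟨hn, hn₁, hn₂⟩
    refine ⟨fun a b => ?_, fun a b => ?_, fun a b => ?_⟩
    · simp [hm, hn, add_mul, mul_add]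
    · simp [hm₁, hn₁, add_mul]
    · simp [hm₂, hn₂, mul_add]
  algebraMap_mem' := by
    intro r
    refine ⟨fun a b => ?_, fun a b => ?_, fun a b => ?_⟩ <;>
      simp [Algebra.algebraMap_eq_smul_one, smul_mul_assoc, mul_smul_comm]

variable {A : Type*} [NonUnitalRing A] [Module ℂ A] [SMulCommClass ℂ A A] [IsScalarTower ℂ A A]
variable {B : Type*} [NonUnitalRing B] [Module ℂ B] [SMulCommClass ℂ B B] [IsScalarTower ℂ B B]

/-- The map `b ↦ m b`. -/
def mulL (m : MultiplierAlgebra A) : A →ₗ[ℂ] A := m.1.1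

/-- The map `a ↦ a m`. -/
def mulR (m : MultiplierAlgebra A) : A →ₗ[ℂ] A := m.1.2.unop

/-- `m ↦ (b ↦ m b)` as a linear map. -/
def mulLHom : MultiplierAlgebra A →ₗ[ℂ] A →ₗ[ℂ] A where
  toFun m := mulL m
  map_add' _ _ := rfl
  map_smul' _ _ := rfl

theorem mulR_mul_eq (m : MultiplierAlgebra A) (a b : A) :
    mulR m a * b = a * mulL m b := m.2.1 a b

theorem mulL_map_mul (m : MultiplierAlgebra A) (a b : A) :
    mulL m (a * b) = mulL m a * b := m.2.2.1 a b

theorem mulR_map_mul (m : MultiplierAlgebra A) (a b : A) :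
    mulR m (a * b) = a * mulR m b := m.2.2.2 a b

@[simp] theorem mulL_mul_apply (m n : MultiplierAlgebra A) (a : A) :
    mulL (m * n) a = mulL m (mulL n a) := rfl

@[simp] theorem mulR_mul_apply (m n : MultiplierAlgebra A) (a : A) :
    mulR (m * n) a = mulR n (mulR m a) := rfl

/-- The canonical map `A → M(A)`; injective if the product of `A` is non-degenerate. -/
def toMultiplier (A : Type*) [NonUnitalRing A] [Module ℂ A] [SMulCommClass ℂ A A]
    [IsScalarTower ℂ A A] : A →ₙₐ[ℂ] MultiplierAlgebra A where
  toFun a := ⟨(LinearMap.mulLeft ℂ a, MulOpposite.op (LinearMap.mulRight ℂ a)), by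
    refine ⟨fun x y => ?_, fun x y => ?_, fun x y => ?_⟩ <;> simp [mul_assoc]⟩
  map_smul' r a := by
    apply Subtype.ext
    refine Prod.ext ?_ (MulOpposite.unop_injective ?_) <;> ext x <;>
      simp [smul_mul_assoc, mul_smul_comm]
  map_zero' := by
    apply Subtype.ext
    refine Prod.ext ?_ (MulOpposite.unop_injective ?_) <;> ext x <;> simp
  map_add' a b := by
    apply Subtype.ext
    refine Prod.ext ?_ (MulOpposite.unop_injective ?_) <;> ext x <;> simp [add_mul, mul_add]
  map_mul' a b := by
    apply Subtype.ext
    refine Prod.ext ?_ (MulOpposite.unop_injective ?_) <;> ext x <;> simp [mul_assoc]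

@[simp] theorem toMultiplier_mulL (a x : A) : mulL (toMultiplier A a) x = a * x := rfl

@[simp] theorem toMultiplier_mulR (a x : A) : mulR (toMultiplier A a) x = x * a := rfl

/-- The multiplier `m ⊗ n` of `A ⊗ B`, for `m ∈ M(A)` and `n ∈ M(B)`. -/
def tensorMultiplier (m : MultiplierAlgebra A) (n : MultiplierAlgebra B) :
    MultiplierAlgebra (A ⊗[ℂ] B) :=
  ⟨(TensorProduct.map (mulL m) (mulL n), MulOpposite.op (TensorProduct.map (mulR m) (mulR n))), by
    refine ⟨fun x y => ?_, fun x y => ?_, fun x y => ?_⟩ <;>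
    · induction x with
      | zero => simp
      | add x₁ x₂ h₁ h₂ => simp only [add_mul, map_add, h₁, h₂]
      | tmul a b =>
        induction y with
        | zero => simp
        | add y₁ y₂ h₁ h₂ => simp only [mul_add, map_add, h₁, h₂]
        | tmul c d =>
          simp [mulR_mul_eq, mulL_map_mul,
            mulR_map_mul]⟩

/-- The multiplier `1 ⊗ a` of `A ⊗ A`. -/
def oneTmul (a : A) : MultiplierAlgebra (A ⊗[ℂ] A) := tensorMultiplier 1 (toMultiplier A a)

/-- The multiplier `a ⊗ 1` of `A ⊗ A`. -/
def tmulOne (a : A) : MultiplierAlgebra (A ⊗[ℂ] A) := tensorMultiplier (toMultiplier A a) 1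

@[simp] theorem mulL_oneTmul (a x y : A) : mulL (oneTmul a) (x ⊗ₜ y) = x ⊗ₜ (a * y) := rfl

@[simp] theorem mulR_oneTmul (a x y : A) : mulR (oneTmul a) (x ⊗ₜ y) = x ⊗ₜ (y * a) := rfl

@[simp] theorem mulL_tmulOne (a x y : A) : mulL (tmulOne a) (x ⊗ₜ y) = (a * x) ⊗ₜ y := rfl

@[simp] theorem mulR_tmulOne (a x y : A) : mulR (tmulOne a) (x ⊗ₜ y) = (x * a) ⊗ₜ y := rfl

end Multipliers

section Slices

variable {V W : Type*} [AddCommGroup V] [Module ℂ V] [AddCommGroup W] [Module ℂ W]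

/-- The slice map `ι ⊗ f`. -/
noncomputable def sliceRight (V : Type*) [AddCommGroup V] [Module ℂ V] (f : W →ₗ[ℂ] ℂ) :
    V ⊗[ℂ] W →ₗ[ℂ] V :=
  (TensorProduct.rid ℂ V).toLinearMap ∘ₗ f.lTensor V

/-- The slice map `f ⊗ ι`. -/
noncomputable def sliceLeft (f : V →ₗ[ℂ] ℂ) (W : Type*) [AddCommGroup W] [Module ℂ W] :
    V ⊗[ℂ] W →ₗ[ℂ] W :=
  (TensorProduct.lid ℂ W).toLinearMap ∘ₗ f.rTensor W

@[simp] theorem sliceRight_tmul (f : W →ₗ[ℂ] ℂ) (v : V) (w : W) :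
    sliceRight V f (v ⊗ₜ w) = f w • v := by simp [sliceRight]

@[simp] theorem sliceLeft_tmul (f : V →ₗ[ℂ] ℂ) (v : V) (w : W) :
    sliceLeft f W (v ⊗ₜ w) = f v • w := by simp [sliceLeft]

end Slices

/-- A regular multiplier Hopf algebra structure on a complex algebra `A` with non-degenerate
product: a homomorphism `Δ : A → M(A ⊗ A)` such that all the elements
`Δ(a)(1 ⊗ b)`, `(a ⊗ 1)Δ(b)`, `Δ(a)(b ⊗ 1)` and `(1 ⊗ a)Δ(b)` lie in `A ⊗ A`, the four canonical
maps `T₁, T₂, T₃, T₄ : A ⊗ A → A ⊗ A` they define are bijective, and `Δ` is coassociative.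
(The canonical maps are determined by `Δ`.) -/
structure RegularMultiplierHopfAlgebra (A : Type*) [NonUnitalRing A] [Module ℂ A]
    [SMulCommClass ℂ A A] [IsScalarTower ℂ A A] where
  nondegenerate_left : ∀ a : A, (∀ b : A, a * b = 0) → a = 0
  nondegenerate_right : ∀ a : A, (∀ b : A, b * a = 0) → a = 0
  comul : A →ₙₐ[ℂ] MultiplierAlgebra (A ⊗[ℂ] A)
  T₁ : A ⊗[ℂ] A ≃ₗ[ℂ] A ⊗[ℂ] A
  T₂ : A ⊗[ℂ] A ≃ₗ[ℂ] A ⊗[ℂ] A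
  T₃ : A ⊗[ℂ] A ≃ₗ[ℂ] A ⊗[ℂ] A
  T₄ : A ⊗[ℂ] A ≃ₗ[ℂ] A ⊗[ℂ] A
  T₁_spec : ∀ a b : A, toMultiplier (A ⊗[ℂ] A) (T₁ (a ⊗ₜ b)) = comul a * oneTmul b
  T₂_spec : ∀ a b : A, toMultiplier (A ⊗[ℂ] A) (T₂ (a ⊗ₜ b)) = tmulOne a * comul b
  T₃_spec : ∀ a b : A, toMultiplier (A ⊗[ℂ] A) (T₃ (a ⊗ₜ b)) = comul a * tmulOne b
  T₄_spec : ∀ a b : A, toMultiplier (A ⊗[ℂ] A) (T₄ (a ⊗ₜ b)) = oneTmul a * comul b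
  /-- `(a ⊗ 1 ⊗ 1)(Δ ⊗ ι)(Δ(b)(1 ⊗ c)) = (ι ⊗ Δ)((a ⊗ 1)Δ(b))(1 ⊗ 1 ⊗ c)` -/
  coassoc : ∀ a b c : A,
    T₂.toLinearMap.rTensor A ((TensorProduct.assoc ℂ A A A).symm (a ⊗ₜ T₁ (b ⊗ₜ c))) =
      (TensorProduct.assoc ℂ A A A).symm
        (T₁.toLinearMap.lTensor A (TensorProduct.assoc ℂ A A A (T₂ (a ⊗ₜ b) ⊗ₜ c)))

variable {A : Type*} [NonUnitalRing A] [Module ℂ A] [SMulCommClass ℂ A A] [IsScalarTower ℂ A A]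
variable {B : Type*} [NonUnitalRing B] [Module ℂ B] [SMulCommClass ℂ B B] [IsScalarTower ℂ B B]

/-- `ε` is the counit: a homomorphism with `(ε ⊗ ι)(Δ(a)(1 ⊗ b)) = ab` and
`(ι ⊗ ε)((a ⊗ 1)Δ(b)) = ab`. -/
structure RegularMultiplierHopfAlgebra.IsCounit (H : RegularMultiplierHopfAlgebra A)
    (ε : A →ₙₐ[ℂ] ℂ) : Prop where
  left : ∀ a b : A, sliceLeft (ε : A →ₗ[ℂ] ℂ) A (H.T₁ (a ⊗ₜ b)) = a * b
  right : ∀ a b : A, sliceRight A (ε : A →ₗ[ℂ] ℂ) (H.T₂ (a ⊗ₜ b)) = a * b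

/-- `S` is the antipode (`ε` being the counit): `m(S ⊗ ι)(Δ(a)(1 ⊗ b)) = ε(a)b` and
`m(ι ⊗ S)((a ⊗ 1)Δ(b)) = ε(b)a`, where `m` is the multiplication `A ⊗ A → A`. -/
structure RegularMultiplierHopfAlgebra.IsAntipode (H : RegularMultiplierHopfAlgebra A)
    (ε : A →ₙₐ[ℂ] ℂ) (S : A →ₗ[ℂ] A) : Prop where
  left : ∀ a b : A, LinearMap.mul' ℂ A (S.rTensor A (H.T₁ (a ⊗ₜ b))) = ε a • b
  right : ∀ a b : A, LinearMap.mul' ℂ A (S.lTensor A (H.T₂ (a ⊗ₜ b))) = ε b • a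

/-- A left integral: a non-zero linear functional `φ` with `(ι ⊗ φ)Δ(a) = φ(a)1` in `M(A)`, where
the multiplier `(ι ⊗ φ)Δ(a)` is given by `b ↦ (ι ⊗ φ)(Δ(a)(b ⊗ 1))` and
`b ↦ (ι ⊗ φ)((b ⊗ 1)Δ(a))`. -/
structure LeftIntegral (H : RegularMultiplierHopfAlgebra A) where
  toFun : A →ₗ[ℂ] ℂ
  ne_zero : toFun ≠ 0
  invariant_left : ∀ a b : A, sliceRight A toFun (H.T₃ (a ⊗ₜ b)) = toFun a • b
  invariant_right : ∀ a b : A, sliceRight A toFun (H.T₂ (b ⊗ₜ a)) = toFun a • b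

/-- A right integral: a non-zero linear functional `ψ` with `(ψ ⊗ ι)Δ(a) = ψ(a)1` in `M(A)`. -/
structure RightIntegral (H : RegularMultiplierHopfAlgebra A) where
  toFun : A →ₗ[ℂ] ℂ
  ne_zero : toFun ≠ 0
  invariant_left : ∀ a b : A, sliceLeft toFun A (H.T₁ (a ⊗ₜ b)) = toFun a • b
  invariant_right : ∀ a b : A, sliceLeft toFun A (H.T₄ (b ⊗ₜ a)) = toFun a • b

section Lemmas

theorem eq_zero_of_sliceLeft {V W : Type*} [AddCommGroup V] [Module ℂ V] [AddCommGroup W]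
    [Module ℂ W] (x : V ⊗[ℂ] W) (h : ∀ f : V →ₗ[ℂ] ℂ, sliceLeft f W x = 0) : x = 0 := by
  classical
  let b := Module.Basis.ofVectorSpace ℂ V
  apply (TensorProduct.equivFinsuppOfBasisLeft b (N := W)).injective
  rw [map_zero]
  ext i
  rw [Finsupp.zero_apply, ← h (b.coord i)]
  clear h
  induction x with
  | zero => simp
  | add x y hx hy => simp only [map_add, Finsupp.add_apply, hx, hy]
  | tmul v w => simp

theorem eq_zero_of_sliceRight {V W : Type*} [AddCommGroup V] [Module ℂ V] [AddCommGroup W]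
    [Module ℂ W] (x : V ⊗[ℂ] W) (h : ∀ f : W →ₗ[ℂ] ℂ, sliceRight V f x = 0) : x = 0 := by
  apply (TensorProduct.comm ℂ V W).injective
  rw [map_zero]
  refine eq_zero_of_sliceLeft _ fun f => ?_
  rw [← h f]
  have : sliceLeft f V ∘ₗ (TensorProduct.comm ℂ V W).toLinearMap = sliceRight V f := by
    ext v w
    simp
  exact LinearMap.congr_fun this x

namespace RegularMultiplierHopfAlgebra

theorem cancel_left (H : RegularMultiplierHopfAlgebra A) {x y : A}
    (h : ∀ p : A, p * x = p * y) : x = y := by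
  rw [← sub_eq_zero]
  exact H.nondegenerate_right _ fun p => by rw [mul_sub, h, sub_self]

theorem tensor_nondegenerate (H : RegularMultiplierHopfAlgebra A) (x : A ⊗[ℂ] A)
    (h : ∀ y : A ⊗[ℂ] A, x * y = 0) : x = 0 := by
  refine eq_zero_of_sliceLeft x fun g => H.nondegenerate_left _ fun b => ?_
  have hb : mulR (oneTmul b) x = 0 := by
    refine eq_zero_of_sliceRight _ fun f => H.nondegenerate_left _ fun a => ?_
    have key : ∀ z : A ⊗[ℂ] A,
        sliceRight A f (mulR (oneTmul b) z) * a = sliceRight A f (z * (a ⊗ₜ b)) := by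
      intro z
      induction z with
      | zero => simp
      | add z w hz hw => simp only [map_add, add_mul, hz, hw]
      | tmul u v => simp [smul_mul_assoc]
    rw [key, h, map_zero]
  have key : ∀ z : A ⊗[ℂ] A, sliceLeft g A z * b = sliceLeft g A (mulR (oneTmul b) z) := by
    intro z
    induction z with
    | zero => simp
    | add z w hz hw => simp only [map_add, add_mul, hz, hw]
    | tmul u v => simp [smul_mul_assoc]
  rw [key, hb, map_zero]

theorem toMultiplier_injective (H : RegularMultiplierHopfAlgebra A) :
    Function.Injective (toMultiplier (A ⊗[ℂ] A)) := by
  intro x y hxy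
  rw [← sub_eq_zero]
  refine H.tensor_nondegenerate _ fun z => ?_
  rw [sub_mul, sub_eq_zero]
  exact congrArg (fun m => mulL m z) hxy

/-- `(p ⊗ 1)(Δ(a)(1 ⊗ c)) = ((p ⊗ 1)Δ(a))(1 ⊗ c)` -/
theorem T₁_T₂ (H : RegularMultiplierHopfAlgebra A) (p a c : A) :
    mulL (tmulOne p) (H.T₁ (a ⊗ₜ c)) = mulR (oneTmul c) (H.T₂ (p ⊗ₜ a)) := by
  rw [← sub_eq_zero]
  refine H.tensor_nondegenerate _ fun z => ?_
  rw [sub_mul, sub_eq_zero, mulR_mul_eq, ← mulL_map_mul]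
  have h₁ := congrArg (fun m => mulL m z) (H.T₁_spec a c)
  have h₂ := congrArg (fun m => mulL m (mulL (oneTmul c) z)) (H.T₂_spec p a)
  simp only [toMultiplier_mulL, mulL_mul_apply] at h₁ h₂
  rw [h₁, h₂]

/-- `Δ(a)(Δ(p)(q ⊗ 1)) = Δ(ap)(q ⊗ 1)` -/
theorem comul_mulL_T₃ (H : RegularMultiplierHopfAlgebra A) (a p q : A) :
    mulL (H.comul a) (H.T₃ (p ⊗ₜ q)) = H.T₃ ((a * p) ⊗ₜ q) := by
  rw [← sub_eq_zero]
  refine H.tensor_nondegenerate _ fun z => ?_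
  rw [sub_mul, sub_eq_zero, ← mulL_map_mul]
  have h₁ := congrArg (fun m => mulL m z) (H.T₃_spec p q)
  have h₂ := congrArg (fun m => mulL m z) (H.T₃_spec (a * p) q)
  simp only [toMultiplier_mulL, mulL_mul_apply, map_mul] at h₁ h₂
  rw [h₁, h₂]

/-- `(Δ(a)(1 ⊗ c))(d ⊗ 1) = Δ(a)(d ⊗ c)` -/
theorem T₁_mulR (H : RegularMultiplierHopfAlgebra A) (a c d : A) :
    mulR (tmulOne d) (H.T₁ (a ⊗ₜ c)) = mulL (H.comul a) (d ⊗ₜ c) := by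
  rw [← sub_eq_zero]
  refine H.tensor_nondegenerate _ fun z => ?_
  rw [sub_mul, sub_eq_zero, mulR_mul_eq, ← mulL_map_mul]
  have h₁ := congrArg (fun m => mulL m (mulL (tmulOne d) z)) (H.T₁_spec a c)
  simp only [toMultiplier_mulL, mulL_mul_apply] at h₁
  rw [h₁]
  congr 1
  clear h₁
  induction z with
  | zero => simp
  | add z w hz hw => simp only [map_add, mul_add, hz, hw]
  | tmul u v => simp

end RegularMultiplierHopfAlgebra

end Lemmas

namespace LeftIntegral

variable {H : RegularMultiplierHopfAlgebra A} (φ : LeftIntegral H)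

/-- The map `c ↦ φ(· c)` from `A` to the linear dual of `A`. -/
noncomputable def functional : A →ₗ[ℂ] Module.Dual ℂ A :=
  (LinearMap.mul ℂ A).flip.compr₂ φ.toFun

@[simp] theorem functional_apply (c a : A) : φ.functional c a = φ.toFun (a * c) := rfl

/-- The underlying space of the dual `Â = {φ(· c) | c ∈ A}`. -/
noncomputable def dual : Submodule ℂ (Module.Dual ℂ A) := LinearMap.range φ.functional

/-- The element `φ(· c)` of `Â`. -/
noncomputable def elem (c : A) : φ.dual := ⟨φ.functional c, LinearMap.mem_range_self _ c⟩

@[simp] theorem coe_elem (c a : A) : (φ.elem c).1 a = φ.toFun (a * c) := rfl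

/-- The canonical pairing `⟨a, b⟩ = b(a)`, that is `⟨a, φ(· c)⟩ = φ(ac)`. -/
noncomputable def pairing : A →ₗ[ℂ] φ.dual →ₗ[ℂ] ℂ := φ.dual.subtype.flip

@[simp] theorem pairing_apply (a : A) (b : φ.dual) : φ.pairing a b = b.1 a := rfl

theorem mem_dual {f : Module.Dual ℂ A} : f ∈ φ.dual ↔ ∃ c, φ.functional c = f := Iff.rfl

/-- An element `c` with `b = φ(· c)`. -/
noncomputable def repr (b : φ.dual) : A := Classical.choose b.2

@[simp] theorem functional_repr (b : φ.dual) : φ.functional (φ.repr b) = b.1 :=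
  Classical.choose_spec b.2

/-- For `c, d ∈ A`, the functional `a ↦ (φ ⊗ φ)(Δ(a)(c ⊗ d))`. -/
noncomputable def mulFunctional (c d : A) : Module.Dual ℂ A :=
  φ.toFun ∘ₗ sliceRight A φ.toFun ∘ₗ
    LinearMap.applyₗ (c ⊗ₜ[ℂ] d) ∘ₗ mulLHom ∘ₗ (H.comul : A →ₗ[ℂ] MultiplierAlgebra (A ⊗[ℂ] A))

theorem mulFunctional_apply (c d a : A) :
    φ.mulFunctional c d a = φ.toFun (sliceRight A φ.toFun (mulL (H.comul a) (c ⊗ₜ d))) := rfl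

theorem mul_slice (p a c : A) :
    p * sliceRight A φ.toFun (H.T₁ (a ⊗ₜ c)) =
      sliceRight A (φ.functional c) (H.T₂ (p ⊗ₜ a)) := by
  have k₁ : ∀ z : A ⊗[ℂ] A,
      p * sliceRight A φ.toFun z = sliceRight A φ.toFun (mulL (tmulOne p) z) := by
    intro z
    induction z with
    | zero => simp
    | add z w hz hw => simp only [map_add, mul_add, hz, hw]
    | tmul u v => simp [mul_smul_comm]
  have k₂ : ∀ z : A ⊗[ℂ] A,
      sliceRight A φ.toFun (mulR (oneTmul c) z) = sliceRight A (φ.functional c) z := by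
    intro z
    induction z with
    | zero => simp
    | add z w hz hw => simp only [map_add, hz, hw]
    | tmul u v => simp
  rw [k₁, H.T₁_T₂, k₂]

/-- `(φ ⊗ φ)(Δ(a)(c ⊗ d))` depends on `c` only through `φ(· c)`. -/
theorem mulFunctional_eq (c d a : A) :
    φ.mulFunctional c d a = φ.functional c (sliceRight A φ.toFun (H.T₁ (a ⊗ₜ d))) := by
  have k : ∀ z : A ⊗[ℂ] A,
      sliceRight A φ.toFun (mulR (tmulOne c) z) = sliceRight A φ.toFun z * c := by
    intro z
    induction z with
    | zero => simp
    | add z w hz hw => simp only [map_add, add_mul, hz, hw]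
    | tmul u v => simp [smul_mul_assoc]
  rw [mulFunctional_apply, ← H.T₁_mulR, k, functional_apply]

theorem mulFunctional_congr {c c' d d' : A} (hc : φ.functional c = φ.functional c')
    (hd : φ.functional d = φ.functional d') : φ.mulFunctional c d = φ.mulFunctional c' d' := by
  ext a
  rw [mulFunctional_eq, mulFunctional_eq, hc]
  congr 1
  exact H.cancel_left fun p => by rw [mul_slice, mul_slice, hd]

theorem mulFunctional_mem (c d : A) : φ.mulFunctional c d ∈ φ.dual := by
  obtain ⟨x, hx⟩ := H.T₃.surjective (c ⊗ₜ d)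
  refine ⟨sliceRight A φ.toFun x, ?_⟩
  ext a
  rw [mulFunctional_apply, ← hx, functional_apply]
  clear hx
  induction x with
  | zero => simp
  | add z w hz hw => simp only [map_add, mul_add, hz, hw]
  | tmul p q =>
    rw [H.comul_mulL_T₃, φ.invariant_left]
    simp [mul_smul_comm, mul_comm]

/-- The product of `Â`: `(bb')(a) = (φ ⊗ φ)(Δ(a)(c ⊗ d))` for `b = φ(· c)` and `b' = φ(· d)`, that
is `⟨a, bb'⟩ = ⟨Δ(a), b ⊗ b'⟩`. -/
noncomputable instance : Mul φ.dual :=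
  ⟨fun b b' => ⟨φ.mulFunctional (φ.repr b) (φ.repr b'), φ.mulFunctional_mem _ _⟩⟩

theorem coe_mul (b b' : φ.dual) :
    ((b * b' : φ.dual) : Module.Dual ℂ A) = φ.mulFunctional (φ.repr b) (φ.repr b') := rfl

theorem elem_mul_elem_apply (c d a : A) :
    (φ.elem c * φ.elem d).1 a =
      φ.toFun (sliceRight A φ.toFun (mulL (H.comul a) (c ⊗ₜ d))) := by
  rw [coe_mul, ← mulFunctional_apply]
  exact LinearMap.congr_fun (φ.mulFunctional_congr (by simp [elem]) (by simp [elem])) a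

theorem mulFunctional_add_left (c c' d : A) :
    φ.mulFunctional (c + c') d = φ.mulFunctional c d + φ.mulFunctional c' d := by
  ext a
  simp [mulFunctional_apply, TensorProduct.add_tmul]

theorem mulFunctional_add_right (c d d' : A) :
    φ.mulFunctional c (d + d') = φ.mulFunctional c d + φ.mulFunctional c d' := by
  ext a
  simp [mulFunctional_apply, TensorProduct.tmul_add]

theorem mulFunctional_smul_left (r : ℂ) (c d : A) :
    φ.mulFunctional (r • c) d = r • φ.mulFunctional c d := by
  ext a
  simp only [mulFunctional_apply, LinearMap.smul_apply, ← TensorProduct.smul_tmul', map_smul]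

theorem mulFunctional_smul_right (r : ℂ) (c d : A) :
    φ.mulFunctional c (r • d) = r • φ.mulFunctional c d := by
  ext a
  simp [mulFunctional_apply]

theorem dual_add_mul (b b' b'' : φ.dual) : (b + b') * b'' = b * b'' + b' * b'' := by
  apply Subtype.ext
  rw [Submodule.coe_add, coe_mul, coe_mul, coe_mul, ← mulFunctional_add_left]
  exact φ.mulFunctional_congr (by simp) rfl

theorem dual_mul_add (b b' b'' : φ.dual) : b * (b' + b'') = b * b' + b * b'' := by
  apply Subtype.ext
  rw [Submodule.coe_add, coe_mul, coe_mul, coe_mul, ← mulFunctional_add_right]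
  exact φ.mulFunctional_congr rfl (by simp)

theorem dual_smul_mul (r : ℂ) (b b' : φ.dual) : (r • b) * b' = r • (b * b') := by
  apply Subtype.ext
  rw [Submodule.coe_smul, coe_mul, coe_mul, ← mulFunctional_smul_left]
  exact φ.mulFunctional_congr (by simp) rfl

theorem dual_mul_smul (r : ℂ) (b b' : φ.dual) : b * (r • b') = r • (b * b') := by
  apply Subtype.ext
  rw [Submodule.coe_smul, coe_mul, coe_mul, ← mulFunctional_smul_right]
  exact φ.mulFunctional_congr rfl (by simp)

theorem dual_mul_apply (b b' : φ.dual) (a : A) :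
    (b * b').1 a = b.1 (sliceRight A φ.toFun (H.T₁ (a ⊗ₜ φ.repr b'))) := by
  rw [coe_mul, mulFunctional_eq, functional_repr]

theorem dual_mul_assoc (b b' b'' : φ.dual) : b * b' * b'' = b * (b' * b'') := by
  apply Subtype.ext
  ext a
  rw [dual_mul_apply, dual_mul_apply, dual_mul_apply]
  congr 1
  refine H.cancel_left fun p => ?_
  rw [mul_slice, mul_slice, functional_repr, functional_repr]
  have k₁ : ∀ z : A ⊗[ℂ] A, H.T₂ (p ⊗ₜ sliceRight A φ.toFun z) =
      sliceRight (A ⊗[ℂ] A) φ.toFun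
        (H.T₂.toLinearMap.rTensor A ((TensorProduct.assoc ℂ A A A).symm (p ⊗ₜ z))) := by
    intro z
    induction z with
    | zero => simp
    | add z w hz hw => simp only [map_add, TensorProduct.tmul_add, hz, hw]
    | tmul u v => simp
  have k₂ : ∀ (u : A) (z : A ⊗[ℂ] A),
      sliceRight (A ⊗[ℂ] A) φ.toFun ((TensorProduct.assoc ℂ A A A).symm (u ⊗ₜ z)) =
        u ⊗ₜ sliceRight A φ.toFun z := by
    intro u z
    induction z with
    | zero => simp
    | add z w hz hw => simp only [map_add, TensorProduct.tmul_add, hz, hw]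
    | tmul u v => simp
  rw [k₁, H.coassoc]
  generalize H.T₂ (p ⊗ₜ[ℂ] a) = w
  induction w with
  | zero => simp
  | add z w hz hw => simp only [map_add, TensorProduct.add_tmul, hz, hw]
  | tmul u v =>
    rw [sliceRight_tmul, dual_mul_apply, TensorProduct.assoc_tmul, LinearMap.lTensor_tmul, k₂,
      sliceRight_tmul]
    rfl

noncomputable instance : NonUnitalRing φ.dual where
  left_distrib := φ.dual_mul_add
  right_distrib := φ.dual_add_mul
  zero_mul b := by simpa using φ.dual_smul_mul 0 0 b
  mul_zero b := by simpa using φ.dual_mul_smul 0 b 0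
  mul_assoc := φ.dual_mul_assoc

instance : IsScalarTower ℂ φ.dual φ.dual := ⟨φ.dual_smul_mul⟩

instance : SMulCommClass ℂ φ.dual φ.dual := ⟨fun r b b' => (φ.dual_mul_smul r b b').symm⟩

end LeftIntegral

section Pairings

/-- The pairing `⟨a ⊗ a', b ⊗ b'⟩ = P(a, b) Q(a', b')` of tensor products. -/
noncomputable def tensorPairing {V V' W W' : Type*} [AddCommGroup V] [Module ℂ V]
    [AddCommGroup V'] [Module ℂ V'] [AddCommGroup W] [Module ℂ W] [AddCommGroup W'] [Module ℂ W']
    (P : V →ₗ[ℂ] W →ₗ[ℂ] ℂ) (Q : V' →ₗ[ℂ] W' →ₗ[ℂ] ℂ) :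
    V ⊗[ℂ] V' →ₗ[ℂ] W ⊗[ℂ] W' →ₗ[ℂ] ℂ :=
  TensorProduct.dualDistrib ℂ W W' ∘ₗ TensorProduct.map P Q

@[simp] theorem tensorPairing_tmul {V V' W W' : Type*} [AddCommGroup V] [Module ℂ V]
    [AddCommGroup V'] [Module ℂ V'] [AddCommGroup W] [Module ℂ W] [AddCommGroup W'] [Module ℂ W']
    (P : V →ₗ[ℂ] W →ₗ[ℂ] ℂ) (Q : V' →ₗ[ℂ] W' →ₗ[ℂ] ℂ) (v : V) (v' : V') (w : W) (w' : W') :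
    tensorPairing P Q (v ⊗ₜ v') (w ⊗ₜ w') = P v w * Q v' w' := by
  simp [tensorPairing]

/-- A pairing of regular multiplier Hopf algebras `A` and `B`: a non-degenerate bilinear form
`⟨·, ·⟩` on `A × B` for which the four actions (of `A` on `B` and of `B` on `A`, from the left and
from the right) exist and are unital, the product of each algebra is dual to the coproduct of the
other, and the twist `R(a ⊗ b) = ∑ ⟨a₍₂₎, b₍₁₎⟩ a₍₁₎ ⊗ b₍₂₎` is a bijection of `A ⊗ B`. The four
actions and `R` are determined by the form, because it is non-degenerate. -/
structure Pairing (HA : RegularMultiplierHopfAlgebra A) (HB : RegularMultiplierHopfAlgebra B) where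
  form : A →ₗ[ℂ] B →ₗ[ℂ] ℂ
  nondegenerate_left : ∀ a : A, (∀ b : B, form a b = 0) → a = 0
  nondegenerate_right : ∀ b : B, (∀ a : A, form a b = 0) → b = 0
  /-- The left action `(a, b) ↦ a ▹ b` of `A` on `B`. -/
  leftAB : A →ₗ[ℂ] B →ₗ[ℂ] B
  /-- The right action `(b, a) ↦ b ◃ a` of `A` on `B`. -/
  rightAB : B →ₗ[ℂ] A →ₗ[ℂ] B
  /-- The left action `(b, a) ↦ b ▹ a` of `B` on `A`. -/
  leftBA : B →ₗ[ℂ] A →ₗ[ℂ] A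
  /-- The right action `(a, b) ↦ a ◃ b` of `B` on `A`. -/
  rightBA : A →ₗ[ℂ] B →ₗ[ℂ] A
  leftAB_mul : ∀ (a a' : A) (b : B), leftAB (a * a') b = leftAB a (leftAB a' b)
  rightAB_mul : ∀ (a a' : A) (b : B), rightAB b (a * a') = rightAB (rightAB b a) a'
  leftBA_mul : ∀ (b b' : B) (a : A), leftBA (b * b') a = leftBA b (leftBA b' a)
  rightBA_mul : ∀ (b b' : B) (a : A), rightBA a (b * b') = rightBA (rightBA a b) b'
  form_leftAB : ∀ (a a' : A) (b : B), form a' (leftAB a b) = form (a' * a) b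
  form_rightAB : ∀ (a a' : A) (b : B), form a' (rightAB b a) = form (a * a') b
  form_leftBA : ∀ (a : A) (b b' : B), form (leftBA b a) b' = form a (b' * b)
  form_rightBA : ∀ (a : A) (b b' : B), form (rightBA a b) b' = form a (b * b')
  leftAB_unital : Submodule.span ℂ {y : B | ∃ (a : A) (b : B), leftAB a b = y} = ⊤
  rightAB_unital : Submodule.span ℂ {y : B | ∃ (a : A) (b : B), rightAB b a = y} = ⊤
  leftBA_unital : Submodule.span ℂ {x : A | ∃ (b : B) (a : A), leftBA b a = x} = ⊤
  rightBA_unital : Submodule.span ℂ {x : A | ∃ (b : B) (a : A), rightBA a b = x} = ⊤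
  /-- `⟨Δ(a), b ⊗ b''⟩ = ⟨a, bb''⟩` for `b'' = a' ▹ b'`, with
  `⟨Δ(a), b ⊗ (a' ▹ b')⟩ = ⟨Δ(a)(1 ⊗ a'), b ⊗ b'⟩`. -/
  form_mul_right : ∀ (a a' : A) (b b' : B),
    tensorPairing form form (HA.T₁ (a ⊗ₜ a')) (b ⊗ₜ b') = form a (b * leftAB a' b')
  /-- `⟨a'' ⊗ a', Δ(b')⟩ = ⟨a''a', b'⟩` for `a'' = a ◃ b`, with
  `⟨(a ◃ b) ⊗ a', Δ(b')⟩ = ⟨a ⊗ a', (b ⊗ 1)Δ(b')⟩`. -/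
  form_mul_left : ∀ (a a' : A) (b b' : B),
    tensorPairing form form (a ⊗ₜ a') (HB.T₂ (b ⊗ₜ b')) = form (rightBA a b * a') b'
  /-- The twist `R`, characterized by
  `⟨R(a ⊗ b), b' ⊗ a'⟩ = ∑ ⟨a, b'b₍₁₎⟩ ⟨a', b₍₂₎⟩ = ⟨a ⊗ a', (b' ⊗ 1)Δ(b)⟩`. -/
  R : A ⊗[ℂ] B ≃ₗ[ℂ] A ⊗[ℂ] B
  form_R : ∀ (a a' : A) (b b' : B),
    tensorPairing form form.flip (R (a ⊗ₜ b)) (b' ⊗ₜ a') =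
      tensorPairing form form (a ⊗ₜ a') (HB.T₂ (b' ⊗ₜ b))

end Pairings

end MultiplierHopf

/-! The argument has three layers. The first is the theory of integrals on `A`. The counit exists
because `c ↦ m(T₁⁻¹(v ⊗ c))` turns out to be multiplication by a scalar `ε(v)`. The antipode would a
priori send `p` to a left multiplier, `b ↦ (ε ⊗ ι)T₁⁻¹(p ⊗ b)`. With a left integral every element
of `A` is a slice `(ι ⊗ φ)(Δ(c)(1 ⊗ a))`, up to sums, and left invariance gives `S((ι ⊗ φ)(Δ(c)(1 ⊗
a))) = (ι ⊗ φ)((1 ⊗ c)Δ(a))`. This formula shows that `S` takes values in `A`. Comparing it with the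
one for the opposite product inverts `S`. It also shows that `φ` is faithful
(`IsLeftInvariant.eq_zero_of_apply_mul_right`) and that `φ ∘ S` is a right integral.

The second layer compares functionals. Evaluating `(ψ ⊗ φ)(Δ(a)x)` by right or by left invariance
gives `φ(· A) = ψ(· A)`, and evaluating `(ψ ⊗ φ)((1 ⊗ S(q))Δ(x)(S(p) ⊗ 1))` in two ways gives `φ(A
·) = ψ(· A)`. So the dual has the three descriptions `φ(· c)`, `φ(c ·)` and `ψ(· c)`, and `σ` is the
passage from the second to the first.

The third layer is the dual. Its canonical maps are defined as canonical maps of `A`, conjugated by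
suitable identifications of `A` with the dual; this makes them bijective for free. They are then
characterized by pairing formulas such as `⟨a ⊗ a', Δ(b)(1 ⊗ b')⟩ = ⟨a(b' ▹ a'), b⟩`. As the pairing
is non-degenerate, every axiom becomes an identity in `A`: `Δ(b)` is a multiplier because the two
actions of the dual on `A` commute, the coproduct is coassociative because the product of `A` is
associative, and it is multiplicative because `b ▹ (aa')` is given by `Δ(b)` (`leftAction_mul'_eq`),
which rests on the multiplicativity of the coproduct of `A`. Uniqueness holds because the form
determines the right action of the dual on `A`, hence the map `T₂` of the dual, hence its whole
structure. -/

namespace MultiplierHopf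

/-! ### Slices of tensors. -/

section TensorLemmas

variable {V V' W W' : Type*} [AddCommGroup V] [Module ℂ V] [AddCommGroup V'] [Module ℂ V']
  [AddCommGroup W] [Module ℂ W] [AddCommGroup W'] [Module ℂ W']

theorem sliceLeft_rTensor (g : V' →ₗ[ℂ] ℂ) (f : V →ₗ[ℂ] V') (x : V ⊗[ℂ] W) :
    sliceLeft g W (f.rTensor W x) = sliceLeft (g ∘ₗ f) W x := by
  induction x with
  | zero => simp
  | add x y hx hy => simp only [map_add, hx, hy]
  | tmul v w => simp

theorem sliceLeft_lTensor (g : V →ₗ[ℂ] ℂ) (f : W →ₗ[ℂ] W') (x : V ⊗[ℂ] W) :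
    sliceLeft g W' (f.lTensor V x) = f (sliceLeft g W x) := by
  induction x with
  | zero => simp
  | add x y hx hy => simp only [map_add, hx, hy]
  | tmul v w => simp

theorem sliceRight_lTensor (g : W' →ₗ[ℂ] ℂ) (f : W →ₗ[ℂ] W') (x : V ⊗[ℂ] W) :
    sliceRight V g (f.lTensor V x) = sliceRight V (g ∘ₗ f) x := by
  induction x with
  | zero => simp
  | add x y hx hy => simp only [map_add, hx, hy]
  | tmul v w => simp

theorem sliceRight_rTensor (g : W →ₗ[ℂ] ℂ) (f : V →ₗ[ℂ] V') (x : V ⊗[ℂ] W) :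
    sliceRight V' g (f.rTensor W x) = f (sliceRight V g x) := by
  induction x with
  | zero => simp
  | add x y hx hy => simp only [map_add, hx, hy]
  | tmul v w => simp

theorem sliceLeft_comm (g : W →ₗ[ℂ] ℂ) (x : V ⊗[ℂ] W) :
    sliceLeft g V (TensorProduct.comm ℂ V W x) = sliceRight V g x := by
  induction x with
  | zero => simp
  | add x y hx hy => simp only [map_add, hx, hy]
  | tmul v w => simp

theorem sliceRight_comm (g : V →ₗ[ℂ] ℂ) (x : V ⊗[ℂ] W) :
    sliceRight W g (TensorProduct.comm ℂ V W x) = sliceLeft g W x := by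
  induction x with
  | zero => simp
  | add x y hx hy => simp only [map_add, hx, hy]
  | tmul v w => simp

theorem apply_sliceRight (f : V →ₗ[ℂ] ℂ) (g : W →ₗ[ℂ] ℂ) (x : V ⊗[ℂ] W) :
    f (sliceRight V g x) = g (sliceLeft f W x) := by
  induction x with
  | zero => simp
  | add x y hx hy => simp only [map_add, hx, hy]
  | tmul v w => simp [mul_comm]

theorem comm_rTensor (f : V →ₗ[ℂ] V') (x : V ⊗[ℂ] W) :
    TensorProduct.comm ℂ V' W (f.rTensor W x) = f.lTensor W (TensorProduct.comm ℂ V W x) := by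
  induction x with
  | zero => simp
  | add x y hx hy => simp only [map_add, hx, hy]
  | tmul v w => simp

theorem comm_lTensor (f : W →ₗ[ℂ] W') (x : V ⊗[ℂ] W) :
    TensorProduct.comm ℂ V W' (f.lTensor V x) = f.rTensor V (TensorProduct.comm ℂ V W x) := by
  induction x with
  | zero => simp
  | add x y hx hy => simp only [map_add, hx, hy]
  | tmul v w => simp

theorem rTensor_lTensor_comm (f : V →ₗ[ℂ] V') (g : W →ₗ[ℂ] W') (x : V ⊗[ℂ] W) :
    f.rTensor W' (g.lTensor V x) = g.lTensor V' (f.rTensor W x) := by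
  induction x with
  | zero => simp
  | add x y hx hy => simp only [map_add, hx, hy]
  | tmul v w => simp

theorem sliceLeft_surjective {g : V →ₗ[ℂ] ℂ} (hg : g ≠ 0) :
    Function.Surjective (sliceLeft g W) := by
  intro w
  obtain ⟨v, hv⟩ := DFunLike.ne_iff.mp hg
  refine ⟨(g v)⁻¹ • v ⊗ₜ w, ?_⟩
  rw [map_smul, sliceLeft_tmul, smul_smul, inv_mul_cancel₀ hv, one_smul]

theorem sliceRight_surjective {g : W →ₗ[ℂ] ℂ} (hg : g ≠ 0) :
    Function.Surjective (sliceRight V g) := by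
  intro w
  obtain ⟨v, hv⟩ := DFunLike.ne_iff.mp hg
  refine ⟨(g v)⁻¹ • w ⊗ₜ v, ?_⟩
  rw [map_smul, sliceRight_tmul, smul_smul, inv_mul_cancel₀ hv, one_smul]

/-- With `F` the multiplications by elements of an algebra, this lets non-degeneracy of the product
cancel a factor in one leg only. -/
theorem eq_of_rTensor {ι : Type*} (F : ι → V →ₗ[ℂ] V') (hF : ∀ v, (∀ i, F i v = 0) → v = 0)
    {x y : V ⊗[ℂ] W} (h : ∀ i, (F i).rTensor W x = (F i).rTensor W y) : x = y := by
  rw [← sub_eq_zero]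
  refine eq_zero_of_sliceRight _ fun f => hF _ fun i => ?_
  rw [← sliceRight_rTensor, map_sub, h, sub_self, map_zero]

theorem eq_of_lTensor {ι : Type*} (F : ι → W →ₗ[ℂ] W') (hF : ∀ w, (∀ i, F i w = 0) → w = 0)
    {x y : V ⊗[ℂ] W} (h : ∀ i, (F i).lTensor V x = (F i).lTensor V y) : x = y := by
  rw [← sub_eq_zero]
  refine eq_zero_of_sliceLeft _ fun f => hF _ fun i => ?_
  rw [← sliceLeft_lTensor, map_sub, h, sub_self, map_zero]

end TensorLemmas

/-! ### Canonical maps and their symmetries. -/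

/-- The canonical maps of a regular multiplier Hopf algebra, together with the maps `L a` and `R a`
that multiply by `Δ(a)` from the left and from the right. The product is a bilinear map, so that it
is possible to pass to the opposite product and to the opposite coproduct. -/
structure CanonicalMaps (A : Type*) [AddCommGroup A] [Module ℂ A] where
  mul : A →ₗ[ℂ] A →ₗ[ℂ] A
  mul_assoc : ∀ a b c, mul (mul a b) c = mul a (mul b c)
  left_nondegenerate : ∀ a, (∀ b, mul.flip b a = 0) → a = 0
  right_nondegenerate : ∀ a, (∀ b, mul b a = 0) → a = 0
  T₁ : A ⊗[ℂ] A ≃ₗ[ℂ] A ⊗[ℂ] A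
  T₂ : A ⊗[ℂ] A ≃ₗ[ℂ] A ⊗[ℂ] A
  T₃ : A ⊗[ℂ] A ≃ₗ[ℂ] A ⊗[ℂ] A
  T₄ : A ⊗[ℂ] A ≃ₗ[ℂ] A ⊗[ℂ] A
  L : A →ₗ[ℂ] A ⊗[ℂ] A →ₗ[ℂ] A ⊗[ℂ] A
  R : A →ₗ[ℂ] A ⊗[ℂ] A →ₗ[ℂ] A ⊗[ℂ] A
  T₁_L : ∀ a c d, (mul.flip d).rTensor A (T₁ (a ⊗ₜ c)) = L a (d ⊗ₜ c)
  T₂_R : ∀ a p q, (mul q).lTensor A (T₂ (p ⊗ₜ a)) = R a (p ⊗ₜ q)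
  T₃_L : ∀ a c d, (mul.flip c).lTensor A (T₃ (a ⊗ₜ d)) = L a (d ⊗ₜ c)
  T₄_R : ∀ a p q, (mul p).rTensor A (T₄ (q ⊗ₜ a)) = R a (p ⊗ₜ q)
  T₁_T₂ : ∀ a c p, (mul p).rTensor A (T₁ (a ⊗ₜ c)) = (mul.flip c).lTensor A (T₂ (p ⊗ₜ a))
  T₁_T₄ : ∀ a c p, (mul p).lTensor A (T₁ (a ⊗ₜ c)) = (mul.flip c).lTensor A (T₄ (p ⊗ₜ a))
  T₃_T₂ : ∀ a c p, (mul p).rTensor A (T₃ (a ⊗ₜ c)) = (mul.flip c).rTensor A (T₂ (p ⊗ₜ a))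
  T₃_T₄ : ∀ a c p, (mul p).lTensor A (T₃ (a ⊗ₜ c)) = (mul.flip c).rTensor A (T₄ (p ⊗ₜ a))
  L_T₁ : ∀ a b c, L a (T₁ (b ⊗ₜ c)) = T₁ (mul a b ⊗ₜ c)
  R_T₂ : ∀ a b c, R a (T₂ (c ⊗ₜ b)) = T₂ (c ⊗ₜ mul b a)
  L_T₃ : ∀ a b c, L a (T₃ (b ⊗ₜ c)) = T₃ (mul a b ⊗ₜ c)
  R_T₄ : ∀ a b c, R a (T₄ (c ⊗ₜ b)) = T₄ (c ⊗ₜ mul b a)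
  -- Coassociativity with an outer leg of the threefold tensor sliced by `g`. In this form no
  -- associator is needed and all four versions are exchanged by passing to opposites.
  T₁_coassoc : ∀ (g : A →ₗ[ℂ] ℂ) (a b c : A), T₁ (sliceLeft g A (T₂ (a ⊗ₜ b)) ⊗ₜ c) =
    (sliceLeft g A ∘ₗ T₂.toLinearMap ∘ₗ TensorProduct.mk ℂ A A a).rTensor A (T₁ (b ⊗ₜ c))
  T₂_coassoc : ∀ (g : A →ₗ[ℂ] ℂ) (a b c : A), T₂ (c ⊗ₜ sliceRight A g (T₁ (b ⊗ₜ a))) =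
    (sliceRight A g ∘ₗ T₁.toLinearMap ∘ₗ (TensorProduct.mk ℂ A A).flip a).lTensor A (T₂ (c ⊗ₜ b))
  T₃_coassoc : ∀ (g : A →ₗ[ℂ] ℂ) (a b c : A), T₃ (sliceRight A g (T₄ (a ⊗ₜ b)) ⊗ₜ c) =
    (sliceRight A g ∘ₗ T₄.toLinearMap ∘ₗ TensorProduct.mk ℂ A A a).lTensor A (T₃ (b ⊗ₜ c))
  T₄_coassoc : ∀ (g : A →ₗ[ℂ] ℂ) (a b c : A), T₄ (c ⊗ₜ sliceLeft g A (T₃ (b ⊗ₜ a))) =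
    (sliceLeft g A ∘ₗ T₃.toLinearMap ∘ₗ (TensorProduct.mk ℂ A A).flip a).rTensor A (T₄ (c ⊗ₜ b))

namespace CanonicalMaps

variable {A : Type*} [AddCommGroup A] [Module ℂ A] (C : CanonicalMaps A)

/-- The opposite product. -/
def op : CanonicalMaps A where
  mul := C.mul.flip
  mul_assoc a b c := (C.mul_assoc c b a).symm
  left_nondegenerate := C.right_nondegenerate
  right_nondegenerate := C.left_nondegenerate
  -- Reversing the product alone turns `Δ(a)(1 ⊗ b)` into `(1 ⊗ b)Δ(a)`, so `T₁`, `T₄` are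
  -- exchanged, and so are `T₂`, `T₃`.
  T₁ := (TensorProduct.comm ℂ A A).trans C.T₄
  T₂ := (TensorProduct.comm ℂ A A).trans C.T₃
  T₃ := (TensorProduct.comm ℂ A A).trans C.T₂
  T₄ := (TensorProduct.comm ℂ A A).trans C.T₁
  L := C.R
  R := C.L
  T₁_L a c d := C.T₄_R a d c
  T₂_R a p q := C.T₃_L a q p
  T₃_L a c d := C.T₂_R a d c
  T₄_R a p q := C.T₁_L a q p
  T₁_T₂ a c p := (C.T₃_T₄ a p c).symm
  T₁_T₄ a c p := (C.T₁_T₄ a p c).symm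
  T₃_T₂ a c p := (C.T₃_T₂ a p c).symm
  T₃_T₄ a c p := (C.T₁_T₂ a p c).symm
  L_T₁ := C.R_T₄
  R_T₂ := C.L_T₃
  L_T₃ := C.R_T₂
  R_T₄ := C.L_T₁
  T₁_coassoc := C.T₄_coassoc
  T₂_coassoc := C.T₃_coassoc
  T₃_coassoc := C.T₂_coassoc
  T₄_coassoc := C.T₁_coassoc

/-- The opposite product and the opposite coproduct. -/
def opCop : CanonicalMaps A where
  mul := C.mul.flip
  mul_assoc a b c := (C.mul_assoc c b a).symm
  left_nondegenerate := C.right_nondegenerate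
  right_nondegenerate := C.left_nondegenerate
  -- Reversing both product and coproduct turns `Δ(a)(1 ⊗ b)` into the flip of `(b ⊗ 1)Δ(a)`, so
  -- `T₁`, `T₂` are exchanged, and so are `T₃`, `T₄`.
  T₁ := (TensorProduct.comm ℂ A A).trans (C.T₂.trans (TensorProduct.comm ℂ A A))
  T₂ := (TensorProduct.comm ℂ A A).trans (C.T₁.trans (TensorProduct.comm ℂ A A))
  T₃ := (TensorProduct.comm ℂ A A).trans (C.T₄.trans (TensorProduct.comm ℂ A A))
  T₄ := (TensorProduct.comm ℂ A A).trans (C.T₃.trans (TensorProduct.comm ℂ A A))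
  L := (TensorProduct.comm ℂ A A).conj.toLinearMap ∘ₗ C.R
  R := (TensorProduct.comm ℂ A A).conj.toLinearMap ∘ₗ C.L
  T₁_L a c d := by
    simpa [LinearEquiv.conj_apply, ← comm_lTensor] using congrArg (TensorProduct.comm ℂ A A) (C.T₂_R a c d)
  T₂_R a p q := by
    simpa [LinearEquiv.conj_apply, ← comm_rTensor] using congrArg (TensorProduct.comm ℂ A A) (C.T₁_L a p q)
  T₃_L a c d := by
    simpa [LinearEquiv.conj_apply, ← comm_rTensor] using congrArg (TensorProduct.comm ℂ A A) (C.T₄_R a c d)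
  T₄_R a p q := by
    simpa [LinearEquiv.conj_apply, ← comm_lTensor] using congrArg (TensorProduct.comm ℂ A A) (C.T₃_L a p q)
  T₁_T₂ a c p := by
    simpa [LinearEquiv.conj_apply, ← comm_lTensor, ← comm_rTensor] using congrArg (TensorProduct.comm ℂ A A) (C.T₁_T₂ a p c).symm
  T₁_T₄ a c p := by
    simpa [LinearEquiv.conj_apply, ← comm_lTensor, ← comm_rTensor] using congrArg (TensorProduct.comm ℂ A A) (C.T₃_T₂ a p c).symm
  T₃_T₂ a c p := by
    simpa [LinearEquiv.conj_apply, ← comm_lTensor, ← comm_rTensor] using congrArg (TensorProduct.comm ℂ A A) (C.T₁_T₄ a p c).symm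
  T₃_T₄ a c p := by
    simpa [LinearEquiv.conj_apply, ← comm_lTensor, ← comm_rTensor] using congrArg (TensorProduct.comm ℂ A A) (C.T₃_T₄ a p c).symm
  L_T₁ a b c := by simp [LinearEquiv.conj_apply, C.R_T₂]
  R_T₂ a b c := by simp [LinearEquiv.conj_apply, C.L_T₁]
  L_T₃ a b c := by simp [LinearEquiv.conj_apply, C.R_T₄]
  R_T₄ a b c := by simp [LinearEquiv.conj_apply, C.L_T₃]
  T₁_coassoc g a b c := by
    have h := congrArg (TensorProduct.comm ℂ A A) (C.T₂_coassoc g a b c)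
    rw [comm_lTensor] at h
    simp only [LinearEquiv.trans_apply, TensorProduct.comm_tmul, sliceLeft_comm, h]
    congr 2
    ext x
    simp [sliceLeft_comm]
  T₂_coassoc g a b c := by
    have h := congrArg (TensorProduct.comm ℂ A A) (C.T₁_coassoc g a b c)
    rw [comm_rTensor] at h
    simp only [LinearEquiv.trans_apply, TensorProduct.comm_tmul, sliceRight_comm, h]
    congr 2
    ext x
    simp [sliceRight_comm]
  T₃_coassoc g a b c := by
    have h := congrArg (TensorProduct.comm ℂ A A) (C.T₄_coassoc g a b c)
    rw [comm_rTensor] at h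
    simp only [LinearEquiv.trans_apply, TensorProduct.comm_tmul, sliceRight_comm, h]
    congr 2
    ext x
    simp [sliceRight_comm]
  T₄_coassoc g a b c := by
    have h := congrArg (TensorProduct.comm ℂ A A) (C.T₃_coassoc g a b c)
    rw [comm_lTensor] at h
    simp only [LinearEquiv.trans_apply, TensorProduct.comm_tmul, sliceLeft_comm, h]
    congr 2
    ext x
    simp [sliceLeft_comm]

/-! ### The counit. -/

/-- The multiplication `A ⊗ A → A`. -/
noncomputable def mulMap : A ⊗[ℂ] A →ₗ[ℂ] A := TensorProduct.lift C.mul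

@[simp] theorem mulMap_tmul (a b : A) : C.mulMap (a ⊗ₜ b) = C.mul a b := rfl

theorem left_cancel {x y : A} (h : ∀ b, C.mul b x = C.mul b y) : x = y := by
  rw [← sub_eq_zero]
  exact C.right_nondegenerate _ fun b => by rw [map_sub, h, sub_self]

theorem right_cancel {x y : A} (h : ∀ b, C.mul x b = C.mul y b) : x = y :=
  C.op.left_cancel h

/-- The maps `x ↦ (g ⊗ ι)((a ⊗ 1)Δ(x))` commute with the canonical map `T₁`. -/
theorem T₁_rTensor (g : A →ₗ[ℂ] ℂ) (a : A) (y : A ⊗[ℂ] A) :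
    C.T₁ ((sliceLeft g A ∘ₗ C.T₂.toLinearMap ∘ₗ TensorProduct.mk ℂ A A a).rTensor A y) =
      (sliceLeft g A ∘ₗ C.T₂.toLinearMap ∘ₗ TensorProduct.mk ℂ A A a).rTensor A (C.T₁ y) := by
  induction y with
  | zero => simp
  | add x y hx hy => simp only [map_add, hx, hy]
  | tmul b c => exact C.T₁_coassoc g a b c

theorem T₁_symm_rTensor (g : A →ₗ[ℂ] ℂ) (a : A) (y : A ⊗[ℂ] A) :
    C.T₁.symm ((sliceLeft g A ∘ₗ C.T₂.toLinearMap ∘ₗ TensorProduct.mk ℂ A A a).rTensor A y) =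
      (sliceLeft g A ∘ₗ C.T₂.toLinearMap ∘ₗ TensorProduct.mk ℂ A A a).rTensor A (C.T₁.symm y) := by
  rw [LinearEquiv.symm_apply_eq, C.T₁_rTensor, LinearEquiv.apply_symm_apply]

theorem mulMap_T₁_symm_slice (g : A →ₗ[ℂ] ℂ) (c : A) (x : A ⊗[ℂ] A) :
    C.mulMap (C.T₁.symm (sliceLeft g A (C.T₂ x) ⊗ₜ c)) = g (C.mulMap x) • c := by
  induction x with
  | zero => simp
  | add x y hx hy => simp only [map_add, TensorProduct.add_tmul, hx, hy, add_smul]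
  | tmul a b =>
    have h := C.T₁_symm_rTensor g a (b ⊗ₜ c)
    simp only [LinearMap.rTensor_tmul, LinearMap.comp_apply, TensorProduct.mk_apply,
      LinearEquiv.coe_coe] at h
    rw [h]
    have key : ∀ y : A ⊗[ℂ] A,
        C.mulMap ((sliceLeft g A ∘ₗ C.T₂.toLinearMap ∘ₗ TensorProduct.mk ℂ A A a).rTensor A y) =
          sliceLeft g A ((C.mul a).rTensor A (C.T₁ y)) := by
      intro y
      induction y with
      | zero => simp
      | add x y hx hy => simp only [map_add, hx, hy]
      | tmul p q => rw [C.T₁_T₂, sliceLeft_lTensor]; rfl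
    rw [key]
    simp

/-- A separation of variables: the right side is a multiple of `c`, so choosing `g u ≠ 0` shows that
`c ↦ m(T₁⁻¹(v ⊗ c))` is a scalar operator, and letting `g` vary shows the same for `u ↦ m(T₂⁻¹(u ⊗
v))`. -/
theorem smul_mulMap_T₁_symm (g : A →ₗ[ℂ] ℂ) (u v c : A) :
    g u • C.mulMap (C.T₁.symm (v ⊗ₜ c)) = g (C.mulMap (C.T₂.symm (u ⊗ₜ v))) • c := by
  rw [← mulMap_T₁_symm_slice, LinearEquiv.apply_symm_apply, sliceLeft_tmul,
    ← TensorProduct.smul_tmul', map_smul, map_smul]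

/-- `ε` is the counit, as a linear functional. -/
structure IsCounit (ε : A →ₗ[ℂ] ℂ) : Prop where
  T₁ : ∀ x, sliceLeft ε A (C.T₁ x) = C.mulMap x
  T₂ : ∀ x, sliceRight A ε (C.T₂ x) = C.mulMap x

theorem exists_isCounit [Nontrivial A] : ∃ ε, C.IsCounit ε := by
  obtain ⟨u, hu⟩ := exists_ne (0 : A)
  obtain ⟨g, hg⟩ : ∃ g : Module.Dual ℂ A, g u ≠ 0 := by
    by_contra! h
    exact hu ((Module.forall_dual_apply_eq_zero_iff ℂ u).mp h)
  -- The value is forced by the expected identity `m(T₂⁻¹(u ⊗ v)) = ε(v)u`, evaluated at `g`.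
  let ε : A →ₗ[ℂ] ℂ :=
    (g u)⁻¹ • (g ∘ₗ C.mulMap ∘ₗ C.T₂.symm.toLinearMap ∘ₗ TensorProduct.mk ℂ A A u)
  have hε : ∀ v, ε v = (g u)⁻¹ * g (C.mulMap (C.T₂.symm (u ⊗ₜ v))) := fun v => rfl
  have h₁ : ∀ v c, C.mulMap (C.T₁.symm (v ⊗ₜ c)) = ε v • c := by
    intro v c
    rw [hε, mul_smul, ← smul_mulMap_T₁_symm, smul_smul, inv_mul_cancel₀ hg, one_smul]
  have h₂ : ∀ w v, C.mulMap (C.T₂.symm (w ⊗ₜ v)) = ε v • w := by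
    intro w v
    rw [← sub_eq_zero, ← Module.forall_dual_apply_eq_zero_iff ℂ]
    intro f
    have h := C.smul_mulMap_T₁_symm f w v u
    rw [h₁, smul_smul, ← sub_eq_zero, ← sub_smul, smul_eq_zero, or_iff_left hu] at h
    rw [map_sub, map_smul, smul_eq_mul, mul_comm, ← neg_sub, h, neg_zero]
  refine ⟨ε, ⟨fun x => ?_, fun x => ?_⟩⟩
  · obtain ⟨y, rfl⟩ := C.T₁.symm.surjective x
    rw [LinearEquiv.apply_symm_apply]
    induction y with
    | zero => simp
    | add x y hx hy => simp only [map_add, hx, hy]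
    | tmul p q => rw [h₁, sliceLeft_tmul]
  · obtain ⟨y, rfl⟩ := C.T₂.symm.surjective x
    rw [LinearEquiv.apply_symm_apply]
    induction y with
    | zero => simp
    | add x y hx hy => simp only [map_add, hx, hy]
    | tmul p q => rw [h₂, sliceRight_tmul]

namespace IsCounit

variable {C} {ε : A →ₗ[ℂ] ℂ}

theorem sliceLeft_L (hε : C.IsCounit ε) (a : A) (x : A ⊗[ℂ] A) :
    sliceLeft ε A (C.L a x) = C.mul a (sliceLeft ε A x) := by
  obtain ⟨y, rfl⟩ := C.T₁.surjective x
  induction y with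
  | zero => simp
  | add x y hx hy => simp only [map_add, hx, hy]
  | tmul b c => rw [C.L_T₁, hε.T₁, hε.T₁, mulMap_tmul, mulMap_tmul, C.mul_assoc]

/-- On `y = Δ(a)(1 ⊗ q)` the element `y(p ⊗ 1)` is `Δ(a)(p ⊗ q)`, with slice `a ε(p) q`. Such `y`
span, and a pure tensor `y` then gives the multiplicativity of `ε`. -/
theorem sliceLeft_rTensor_mul (hε : C.IsCounit ε) (p : A) (y : A ⊗[ℂ] A) :
    sliceLeft ε A ((C.mul.flip p).rTensor A y) = ε p • sliceLeft ε A y := by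
  obtain ⟨z, rfl⟩ := C.T₁.surjective y
  induction z with
  | zero => simp
  | add x y hx hy => simp only [map_add, hx, hy, smul_add]
  | tmul a q =>
    rw [C.T₁_L, hε.sliceLeft_L, sliceLeft_tmul, hε.T₁, map_smul, mulMap_tmul]

theorem map_mul (hε : C.IsCounit ε) (a b : A) : ε (C.mul a b) = ε a * ε b := by
  rcases eq_or_ne a 0 with rfl | ha
  · simp
  · have h := hε.sliceLeft_rTensor_mul b (a ⊗ₜ a)
    simp only [LinearMap.rTensor_tmul, LinearMap.flip_apply, sliceLeft_tmul, smul_smul] at h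
    rw [← sub_eq_zero, ← sub_smul, smul_eq_zero, or_iff_left ha, sub_eq_zero] at h
    rw [h, mul_comm]

theorem T₃ (hε : C.IsCounit ε) (x : A ⊗[ℂ] A) : sliceRight A ε (C.T₃ x) = C.mulMap x := by
  induction x with
  | zero => simp
  | add x y hx hy => simp only [map_add, hx, hy]
  | tmul a b =>
    refine C.left_cancel fun c => ?_
    rw [← sliceRight_rTensor, C.T₃_T₂, sliceRight_rTensor, hε.T₂, mulMap_tmul, mulMap_tmul,
      LinearMap.flip_apply, C.mul_assoc]

theorem opCop (hε : C.IsCounit ε) : C.opCop.IsCounit ε where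
  T₁ x := by
    induction x with
    | zero => simp
    | add x y hx hy => simp only [map_add, hx, hy]
    | tmul a b => simpa [CanonicalMaps.opCop, sliceLeft_comm] using hε.T₂ (b ⊗ₜ a)
  T₂ x := by
    induction x with
    | zero => simp
    | add x y hx hy => simp only [map_add, hx, hy]
    | tmul a b => simpa [CanonicalMaps.opCop, sliceRight_comm] using hε.T₁ (b ⊗ₜ a)

end IsCounit

/-! ### Formal properties of the antipode. -/

/-- `S` is the antipode, `ε` being the counit. -/
structure IsAntipode (ε : A →ₗ[ℂ] ℂ) (S : A →ₗ[ℂ] A) : Prop where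
  T₁ : ∀ x, C.mulMap (S.rTensor A (C.T₁ x)) = sliceLeft ε A x
  T₂ : ∀ x, C.mulMap (S.lTensor A (C.T₂ x)) = sliceRight A ε x

namespace IsAntipode

variable {C} {ε : A →ₗ[ℂ] ℂ} {S : A →ₗ[ℂ] A}

/-- The right side does not involve `S`, so non-degeneracy of the product makes the antipode unique.
-/
theorem mul_eq (hS : C.IsAntipode ε S) (a b : A) :
    C.mul (S a) b = sliceLeft ε A (C.T₁.symm (a ⊗ₜ b)) := by
  rw [← hS.T₁, LinearEquiv.apply_symm_apply]
  rfl

theorem opCop (hS : C.IsAntipode ε S) : C.opCop.IsAntipode ε S where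
  T₁ x := by
    induction x with
    | zero => simp
    | add x y hx hy => simp only [map_add, hx, hy]
    | tmul a b =>
      have key : ∀ z : A ⊗[ℂ] A, C.opCop.mulMap (S.rTensor A (TensorProduct.comm ℂ A A z)) =
          C.mulMap (S.lTensor A z) := by
        intro z
        induction z with
        | zero => simp
        | add x y hx hy => simp only [map_add, hx, hy]
        | tmul a b => rfl
      exact (key _).trans (hS.T₂ (b ⊗ₜ a))
  T₂ x := by
    induction x with
    | zero => simp
    | add x y hx hy => simp only [map_add, hx, hy]
    | tmul a b =>
      have key : ∀ z : A ⊗[ℂ] A, C.opCop.mulMap (S.lTensor A (TensorProduct.comm ℂ A A z)) =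
          C.mulMap (S.rTensor A z) := by
        intro z
        induction z with
        | zero => simp
        | add x y hx hy => simp only [map_add, hx, hy]
        | tmul a b => rfl
      exact (key _).trans (hS.T₁ (b ⊗ₜ a))

theorem unique (hS : C.IsAntipode ε S) {S' : A →ₗ[ℂ] A} (hS' : C.IsAntipode ε S') : S = S' := by
  ext a
  exact C.right_cancel fun b => by rw [hS.mul_eq, hS'.mul_eq]

theorem mulMap_rTensor_L (hε : C.IsCounit ε) (hS : C.IsAntipode ε S) (a : A) (x : A ⊗[ℂ] A) :
    C.mulMap (S.rTensor A (C.L a x)) = ε a • C.mulMap (S.rTensor A x) := by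
  obtain ⟨y, rfl⟩ := C.T₁.surjective x
  induction y with
  | zero => simp
  | add x y hx hy => simp only [map_add, hx, hy, smul_add]
  | tmul b c => simp only [C.L_T₁, hS.T₁, sliceLeft_tmul, hε.map_mul, smul_smul]

/-- The map `m(S ⊗ ι)` sends `y(b ⊗ 1)` to `S(b) m(S ⊗ ι)(y)`: for `y = T₁(p ⊗ q)` both are
`ε(p)S(b)q`. As `T₁` is surjective, `y = a ⊗ c` is allowed. -/
theorem map_mul (hε : C.IsCounit ε) (hS : C.IsAntipode ε S) (a b : A) :
    S (C.mul a b) = C.mul (S b) (S a) := by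
  have key : ∀ y : A ⊗[ℂ] A, C.mulMap (S.rTensor A ((C.mul.flip b).rTensor A y)) =
      C.mul (S b) (C.mulMap (S.rTensor A y)) := by
    intro y
    obtain ⟨z, rfl⟩ := C.T₁.surjective y
    induction z with
    | zero => simp
    | add x y hx hy => simp only [map_add, hx, hy]
    | tmul p q =>
      rw [C.T₁_L, hS.mulMap_rTensor_L hε, hS.T₁]
      simp
  refine C.right_cancel fun c => ?_
  rw [C.mul_assoc]
  exact key (a ⊗ₜ c)

/-- `m(S ⊗ ι)(Δ(a)(b ⊗ 1)) = ε(a)S(b)` -/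
theorem T₃ (hε : C.IsCounit ε) (hS : C.IsAntipode ε S) (a b : A) :
    C.mulMap (S.rTensor A (C.T₃ (a ⊗ₜ b))) = ε a • S b := by
  refine C.right_cancel fun c => ?_
  have key : ∀ z : A ⊗[ℂ] A, C.mul (C.mulMap (S.rTensor A z)) c =
      C.mulMap (S.rTensor A ((C.mul.flip c).lTensor A z)) := by
    intro z
    induction z with
    | zero => simp
    | add x y hx hy => simp only [map_add, LinearMap.add_apply, hx, hy]
    | tmul a b => simp [C.mul_assoc]
  rw [key, C.T₃_L, hS.mulMap_rTensor_L hε]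
  simp

end IsAntipode

/-! ### The antipode obtained from a left invariant functional. -/

/-- The functional `φ` is left invariant: `(ι ⊗ φ)Δ(a) = φ(a)1`. -/
structure IsLeftInvariant (φ : A →ₗ[ℂ] ℂ) : Prop where
  T₂ : ∀ a b, sliceRight A φ (C.T₂ (b ⊗ₜ a)) = φ a • b
  T₃ : ∀ a b, sliceRight A φ (C.T₃ (a ⊗ₜ b)) = φ a • b

theorem IsLeftInvariant.op {C : CanonicalMaps A} {φ : A →ₗ[ℂ] ℂ} (hφ : C.IsLeftInvariant φ) :
    C.op.IsLeftInvariant φ :=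
  ⟨hφ.T₃, hφ.T₂⟩

/-- The map `a ↦ (ι ⊗ φ)(Δ(c)(1 ⊗ a))`. -/
noncomputable def slice₁ (φ : A →ₗ[ℂ] ℂ) (c : A) : A →ₗ[ℂ] A :=
  sliceRight A φ ∘ₗ C.T₁.toLinearMap ∘ₗ TensorProduct.mk ℂ A A c

theorem slice₁_apply (φ : A →ₗ[ℂ] ℂ) (c a : A) :
    C.slice₁ φ c a = sliceRight A φ (C.T₁ (c ⊗ₜ a)) := rfl

/-- By coassociativity both sides are `∑ dc₍₁₎ ⊗ c₍₂₎p φ(c₍₃₎q)` for `x = p ⊗ q`. The factor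
`Δ(c₍₂₎)x` becomes accessible to left invariance when `x` is in the form `T₃ z`. -/
theorem rTensor_T₁_slice₁ (φ : A →ₗ[ℂ] ℂ) (c d : A) (x : A ⊗[ℂ] A) :
    (C.mul d).rTensor A (C.T₁ ((C.slice₁ φ c).rTensor A (TensorProduct.comm ℂ A A x))) =
      (sliceRight A φ ∘ₗ C.L.flip x).lTensor A (C.T₂ (d ⊗ₜ c)) := by
  induction x with
  | zero => simp
  | add x y hx hy => simp only [map_add, hx, hy, LinearMap.comp_add, LinearMap.lTensor_add,
      LinearMap.add_apply]
  | tmul p q =>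
    rw [TensorProduct.comm_tmul, LinearMap.rTensor_tmul, C.T₁_T₂, slice₁_apply, C.T₂_coassoc,
      ← LinearMap.lTensor_comp_apply]
    congr 2
    ext s
    simp only [LinearMap.comp_apply, LinearMap.flip_apply, ← C.T₁_L, sliceRight_rTensor]
    rfl

/-- If `∑ aᵢ ⊗ bᵢ` is the flip of `Δ(a)(b ⊗ 1)`, then
`∑ T₁((ι ⊗ φ)(Δ(c)(1 ⊗ aᵢ)) ⊗ bᵢ) = (ι ⊗ φ)(Δ(c)(1 ⊗ a)) ⊗ b`. -/
theorem IsLeftInvariant.T₁_slice₁ {C : CanonicalMaps A} {φ : A →ₗ[ℂ] ℂ} (hφ : C.IsLeftInvariant φ)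
    (c : A) (z : A ⊗[ℂ] A) :
    C.T₁ ((C.slice₁ φ c).rTensor A (TensorProduct.comm ℂ A A (C.T₃ z))) =
      (C.slice₁ φ c).rTensor A z := by
  induction z with
  | zero => simp
  | add x y hx hy => simp only [map_add, hx, hy]
  | tmul a b =>
    refine eq_of_rTensor C.mul C.right_nondegenerate fun d => ?_
    rw [C.rTensor_T₁_slice₁, LinearMap.rTensor_tmul, LinearMap.rTensor_tmul, slice₁_apply,
      ← sliceRight_rTensor, C.T₁_T₂, sliceRight_lTensor]
    generalize C.T₂ (d ⊗ₜ c) = w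
    induction w with
    | zero => simp
    | add x y hx hy => simp only [map_add, hx, hy, TensorProduct.add_tmul]
    | tmul r s =>
      simp [C.L_T₃, hφ.T₃, TensorProduct.smul_tmul]

/-- For `p = (ι ⊗ φ)(Δ(c)(1 ⊗ a))` the tensor `T₁⁻¹(p ⊗ b)` is known from `T₁_slice₁`, and its slice
by `ε` is a product of an element of `A` with `b`. So the left multiplier that `S(p)` has to be lies
in `A`. -/
theorem IsLeftInvariant.exists_isAntipode {C : CanonicalMaps A} {φ : A →ₗ[ℂ] ℂ}
    (hφ : C.IsLeftInvariant φ) (h0 : φ ≠ 0) {ε : A →ₗ[ℂ] ℂ} (hε : C.IsCounit ε) :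
    ∃ S : A →ₗ[ℂ] A, C.IsAntipode ε S ∧
      ∀ x, S (sliceRight A φ (C.T₁ x)) = sliceRight A φ (C.T₄ x) := by
  -- `S((ι ⊗ φ)(Δ(c)(1 ⊗ a)))b = (ι ⊗ φ)((1 ⊗ c)Δ(a))b`
  have h₁ : ∀ (x : A ⊗[ℂ] A) (b : A), sliceLeft ε A (C.T₁.symm (sliceRight A φ (C.T₁ x) ⊗ₜ b)) =
      C.mul (sliceRight A φ (C.T₄ x)) b := by
    intro x b
    induction x with
    | zero => simp
    | add x y hx hy => simp only [map_add, hx, hy, TensorProduct.add_tmul, LinearMap.add_apply]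
    | tmul c a =>
      have h := hφ.T₁_slice₁ c (a ⊗ₜ b)
      rw [LinearMap.rTensor_tmul, slice₁_apply] at h
      rw [← h, LinearEquiv.symm_apply_apply, sliceLeft_rTensor, sliceLeft_comm]
      have h₂ : ε ∘ₗ C.slice₁ φ c = φ ∘ₗ C.mul c := by
        ext q
        rw [LinearMap.comp_apply, slice₁_apply, apply_sliceRight, hε.T₁]
        rfl
      rw [h₂, ← sliceRight_lTensor, C.T₃_T₄, sliceRight_rTensor]
      rfl
  obtain ⟨u, hu⟩ := DFunLike.ne_iff.mp h0
  -- Since `φ u ≠ 0`, each `p` is the slice `(φ u)⁻¹(ι ⊗ φ)(T₁(T₁⁻¹(p ⊗ u)))`, and the formula for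
  -- `S` on slices dictates this definition.
  let S : A →ₗ[ℂ] A := (φ u)⁻¹ •
    (sliceRight A φ ∘ₗ C.T₄.toLinearMap ∘ₗ C.T₁.symm.toLinearMap ∘ₗ (TensorProduct.mk ℂ A A).flip u)
  have h₃ : ∀ p b, C.mul (S p) b = sliceLeft ε A (C.T₁.symm (p ⊗ₜ b)) := by
    intro p b
    have h := h₁ (C.T₁.symm (p ⊗ₜ u)) b
    rw [LinearEquiv.apply_symm_apply, sliceRight_tmul, ← TensorProduct.smul_tmul', map_smul,
      map_smul] at h
    change C.mul ((φ u)⁻¹ • sliceRight A φ (C.T₄ (C.T₁.symm (p ⊗ₜ u)))) b = _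
    rw [map_smul, LinearMap.smul_apply, ← h, smul_smul, inv_mul_cancel₀ hu, one_smul]
  have hT₁ : ∀ y, C.mulMap (S.rTensor A y) = sliceLeft ε A (C.T₁.symm y) := by
    intro y
    induction y with
    | zero => simp
    | add x y hx hy => simp only [map_add, hx, hy]
    | tmul p b => exact h₃ p b
  have hS : ∀ x, S (sliceRight A φ (C.T₁ x)) = sliceRight A φ (C.T₄ x) :=
    fun x => C.right_cancel fun b => by rw [h₃, h₁]
  -- For `x = b ⊗ q`, coassociativity and `hS` turn the left side into `(ι ⊗ φ)((a ⊗ 1)Δ(b)Δ(q))`,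
  -- which is `φ(bq)a` by left invariance.
  have h₄ : ∀ (a : A) (x : A ⊗[ℂ] A), C.mulMap (S.lTensor A (C.T₂ (a ⊗ₜ sliceRight A φ (C.T₁ x)))) =
      ε (sliceRight A φ (C.T₁ x)) • a := by
    intro a x
    induction x with
    | zero => simp
    | add x y hx hy => simp only [map_add, TensorProduct.tmul_add, hx, hy, add_smul]
    | tmul b q =>
      have key : ∀ w : A ⊗[ℂ] A, C.mulMap (S.lTensor A
          ((sliceRight A φ ∘ₗ C.T₁.toLinearMap ∘ₗ (TensorProduct.mk ℂ A A).flip q).lTensor A w)) =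
          sliceRight A φ (C.R q w) := by
        intro w
        induction w with
        | zero => simp
        | add x y hx hy => simp only [map_add, hx, hy]
        | tmul r s =>
          rw [← C.T₄_R, sliceRight_rTensor, ← hS]
          rfl
      rw [C.T₂_coassoc, key, C.R_T₂, hφ.T₂, apply_sliceRight, hε.T₁]
      rfl
  refine ⟨S, ⟨fun x => by rw [hT₁, LinearEquiv.symm_apply_apply], fun x => ?_⟩, hS⟩
  induction x with
  | zero => simp
  | add x y hx hy => simp only [map_add, hx, hy]
  | tmul a b =>
    obtain ⟨x, rfl⟩ := ((sliceRight_surjective h0).comp C.T₁.surjective) b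
    rw [sliceRight_tmul]
    exact h₄ a x

theorem IsLeftInvariant.antipode_sliceRight_T₁ {C : CanonicalMaps A} {φ : A →ₗ[ℂ] ℂ}
    (hφ : C.IsLeftInvariant φ) (h0 : φ ≠ 0) {ε : A →ₗ[ℂ] ℂ} (hε : C.IsCounit ε)
    {S : A →ₗ[ℂ] A} (hS : C.IsAntipode ε S) (x : A ⊗[ℂ] A) :
    S (sliceRight A φ (C.T₁ x)) = sliceRight A φ (C.T₄ x) := by
  obtain ⟨S', hS', h⟩ := hφ.exists_isAntipode h0 hε
  rw [hS.unique hS', h]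

/-- `S` carries the slices of `T₁` to those of `T₄`. The same `φ` is left invariant for the opposite
product, which exchanges `T₁` and `T₄`, so the antipode obtained there goes back. -/
theorem IsLeftInvariant.antipode_bijective [Nontrivial A] {C : CanonicalMaps A} {φ : A →ₗ[ℂ] ℂ}
    (hφ : C.IsLeftInvariant φ) (h0 : φ ≠ 0) {ε : A →ₗ[ℂ] ℂ} (hε : C.IsCounit ε)
    {S : A →ₗ[ℂ] A} (hS : C.IsAntipode ε S) : Function.Bijective S := by
  obtain ⟨ε', hε'⟩ := C.op.exists_isCounit
  obtain ⟨S', -, h'⟩ := hφ.op.exists_isAntipode h0 hε'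
  have h := hφ.antipode_sliceRight_T₁ h0 hε hS
  have h'' : ∀ x, S' (sliceRight A φ (C.T₄ x)) = sliceRight A φ (C.T₁ x) := by
    intro x
    have h₁ : C.op.T₁ (TensorProduct.comm ℂ A A x) = C.T₄ x :=
      congrArg C.T₄ ((TensorProduct.comm ℂ A A).symm_apply_apply x)
    have h₂ : C.op.T₄ (TensorProduct.comm ℂ A A x) = C.T₁ x :=
      congrArg C.T₁ ((TensorProduct.comm ℂ A A).symm_apply_apply x)
    rw [← h₁, h', h₂]
  refine Function.bijective_iff_has_inverse.mpr ⟨S', fun a => ?_, fun a => ?_⟩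
  · obtain ⟨x, rfl⟩ := ((sliceRight_surjective h0).comp C.T₁.surjective) a
    rw [Function.comp_apply, h, h'']
  · obtain ⟨x, rfl⟩ := ((sliceRight_surjective h0).comp C.T₄.surjective) a
    rw [Function.comp_apply, h'', h]

/-- The multiplication is `(ε ⊗ ι)T₁`, a composition of surjections as soon as `ε ≠ 0`; if `ε` were
zero, all products would vanish. -/
theorem mulMap_surjective [Nontrivial A] : Function.Surjective C.mulMap := by
  obtain ⟨ε, hε⟩ := C.exists_isCounit
  have h0 : ε ≠ 0 := by
    rintro rfl
    obtain ⟨a, ha⟩ := exists_ne (0 : A)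
    refine ha (C.left_nondegenerate a fun b => ?_)
    rw [LinearMap.flip_apply, ← mulMap_tmul, ← hε.T₁]
    simp [sliceLeft]
  intro a
  obtain ⟨x, rfl⟩ := ((sliceLeft_surjective h0).comp C.T₁.surjective) a
  exact ⟨x, (hε.T₁ x).symm⟩

/-- Let `N` be the set of `a` with `φ(· a) = 0`, a left ideal. For `a ∈ N` the second leg of `Δ(a)`
stays in `N`, so applying `φ(b ·) ∘ m(S ⊗ ι)` to `Δ(a)(p ⊗ 1)` gives `ε(a)φ(bS(p)) = 0`. The
elements `bS(p)` span `A`, hence `ε` vanishes on `N`, and then `ap = (ι ⊗ ε)(Δ(a)(p ⊗ 1)) = 0`. -/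
theorem IsLeftInvariant.eq_zero_of_apply_mul_right [Nontrivial A] {C : CanonicalMaps A}
    {φ : A →ₗ[ℂ] ℂ} (hφ : C.IsLeftInvariant φ) (h0 : φ ≠ 0) {a : A}
    (ha : ∀ b, φ (C.mul b a) = 0) : a = 0 := by
  obtain ⟨ε, hε⟩ := C.exists_isCounit
  obtain ⟨S, hS, h⟩ := hφ.exists_isAntipode h0 hε
  have hbij := hφ.antipode_bijective h0 hε hS
  -- the second leg of `Δ(a)` lies in the kernel of `a ↦ φ(· a)`
  have h₁ : ∀ a, (∀ b, φ (C.mul b a) = 0) →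
      ∀ (f : A →ₗ[ℂ] ℂ) (p b : A), φ (C.mul b (sliceLeft f A (C.T₃ (a ⊗ₜ p)))) = 0 := by
    intro a ha f p b
    have h₀ : sliceRight A φ (C.T₁ (b ⊗ₜ a)) = 0 := by
      refine C.left_cancel fun c => ?_
      rw [← sliceRight_rTensor, C.T₁_T₂, sliceRight_lTensor]
      have : φ ∘ₗ C.mul.flip a = 0 := LinearMap.ext ha
      rw [this]
      simp [sliceRight]
    rw [← sliceLeft_lTensor, ← apply_sliceRight, C.T₃_T₄, sliceRight_rTensor, ← h, h₀, map_zero,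
      map_zero, map_zero]
  have h₂ : ∀ a, (∀ b, φ (C.mul b a) = 0) → ε a = 0 := by
    intro a ha
    let Ψ : A →ₗ[ℂ] Module.Dual ℂ A := C.mul.flip.compr₂ φ
    have h₃ : ∀ p, Ψ.lTensor A (C.T₃ (a ⊗ₜ p)) = 0 := by
      intro p
      refine eq_zero_of_sliceLeft _ fun f => ?_
      rw [sliceLeft_lTensor]
      exact LinearMap.ext fun b => h₁ a ha f p b
    have h₄ : ∀ (b : A) (z : A ⊗[ℂ] A), φ (C.mul b (C.mulMap (S.rTensor A z))) =
        TensorProduct.lift (LinearMap.flip LinearMap.id ∘ₗ C.mul b ∘ₗ S) (Ψ.lTensor A z) := by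
      intro b z
      induction z with
      | zero => simp
      | add x y hx hy => simp only [map_add, hx, hy]
      | tmul r s => simp [Ψ, C.mul_assoc]
    by_contra hne
    refine h0 (LinearMap.ext fun u => ?_)
    obtain ⟨w, rfl⟩ := C.mulMap_surjective u
    induction w with
    | zero => simp
    | add x y hx hy => simp only [map_add, hx, hy]
    | tmul b q =>
      obtain ⟨p, rfl⟩ := hbij.surjective q
      have h₅ := h₄ b (C.T₃ (a ⊗ₜ p))
      rw [h₃, map_zero, hS.T₃ hε, map_smul, map_smul, smul_eq_mul, mul_eq_zero,
        or_iff_right hne] at h₅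
      rw [mulMap_tmul, h₅, LinearMap.zero_apply]
  refine C.left_nondegenerate a fun p => ?_
  rw [LinearMap.flip_apply, ← mulMap_tmul, ← hε.T₃, ← Module.forall_dual_apply_eq_zero_iff ℂ]
  intro f
  rw [apply_sliceRight]
  exact h₂ _ (h₁ a ha f p)

theorem IsLeftInvariant.eq_zero_of_apply_mul_left [Nontrivial A] {C : CanonicalMaps A}
    {φ : A →ₗ[ℂ] ℂ} (hφ : C.IsLeftInvariant φ) (h0 : φ ≠ 0) {a : A}
    (ha : ∀ b, φ (C.mul a b) = 0) : a = 0 :=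
  hφ.op.eq_zero_of_apply_mul_right h0 ha

/-! ### Right invariant functionals and their comparison with left invariant ones. -/

/-- The functional `ψ` is right invariant: `(ψ ⊗ ι)Δ(a) = ψ(a)1`. -/
structure IsRightInvariant (ψ : A →ₗ[ℂ] ℂ) : Prop where
  T₁ : ∀ a b, sliceLeft ψ A (C.T₁ (a ⊗ₜ b)) = ψ a • b
  T₄ : ∀ a b, sliceLeft ψ A (C.T₄ (b ⊗ₜ a)) = ψ a • b

theorem IsRightInvariant.opCop {C : CanonicalMaps A} {ψ : A →ₗ[ℂ] ℂ} (hψ : C.IsRightInvariant ψ) :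
    C.opCop.IsLeftInvariant ψ where
  T₂ a b := by simpa [CanonicalMaps.opCop, sliceRight_comm] using hψ.T₁ a b
  T₃ a b := by simpa [CanonicalMaps.opCop, sliceRight_comm] using hψ.T₄ a b

/-- Reversing product and coproduct makes `ψ` left invariant and keeps `ε` and `S`, so this is the
mirror image of `antipode_sliceRight_T₁`. -/
theorem IsRightInvariant.antipode_sliceLeft_T₂ {C : CanonicalMaps A} {ψ : A →ₗ[ℂ] ℂ}
    (hψ : C.IsRightInvariant ψ) (h0 : ψ ≠ 0) {ε : A →ₗ[ℂ] ℂ} (hε : C.IsCounit ε)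
    {S : A →ₗ[ℂ] A} (hS : C.IsAntipode ε S) (x : A ⊗[ℂ] A) :
    S (sliceLeft ψ A (C.T₂ x)) = sliceLeft ψ A (C.T₃ x) := by
  have h := hψ.opCop.antipode_sliceRight_T₁ h0 hε.opCop hS.opCop (TensorProduct.comm ℂ A A x)
  have h₁ : C.opCop.T₁ (TensorProduct.comm ℂ A A x) = TensorProduct.comm ℂ A A (C.T₂ x) :=
    congrArg (fun y => TensorProduct.comm ℂ A A (C.T₂ y))
      ((TensorProduct.comm ℂ A A).symm_apply_apply x)
  have h₄ : C.opCop.T₄ (TensorProduct.comm ℂ A A x) = TensorProduct.comm ℂ A A (C.T₃ x) :=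
    congrArg (fun y => TensorProduct.comm ℂ A A (C.T₃ y))
      ((TensorProduct.comm ℂ A A).symm_apply_apply x)
  rwa [h₁, h₄, sliceRight_comm, sliceRight_comm] at h

/-- The composition of a left invariant functional with the antipode is right invariant. -/
theorem IsLeftInvariant.comp_antipode {C : CanonicalMaps A} {φ : A →ₗ[ℂ] ℂ}
    (hφ : C.IsLeftInvariant φ) (h0 : φ ≠ 0) {ε : A →ₗ[ℂ] ℂ} (hε : C.IsCounit ε)
    {S : A →ₗ[ℂ] A} (hS : C.IsAntipode ε S) : C.IsRightInvariant (φ ∘ₗ S) := by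
  have h := hφ.antipode_sliceRight_T₁ h0 hε hS
  -- `(φ ⊗ ι ⊗ φ)` of `(1 ⊗ 1 ⊗ c)Δ⁽²⁾(a)(b ⊗ 1 ⊗ 1)`
  have h₁ : ∀ (c : A) (z : A ⊗[ℂ] A), sliceLeft (φ ∘ₗ S ∘ₗ C.slice₁ φ c) A
      (TensorProduct.comm ℂ A A (C.T₃ z)) =
      sliceLeft (φ ∘ₗ S ∘ₗ C.slice₁ φ c) A z := by
    intro c z
    have hω : ∀ x, (φ ∘ₗ S ∘ₗ C.slice₁ φ c) x = φ (sliceRight A φ (C.T₄ (c ⊗ₜ x))) := by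
      intro x
      rw [← h]
      rfl
    rw [sliceLeft_comm, ← sub_eq_zero, ← Module.forall_dual_apply_eq_zero_iff ℂ]
    intro g
    rw [map_sub, sub_eq_zero, apply_sliceRight]
    induction z with
    | zero => simp
    | add x y hx hy => simp only [map_add, hx, hy]
    | tmul a b =>
      rw [hω, C.T₄_coassoc, sliceRight_rTensor, sliceLeft_tmul, hω, map_smul]
      simp only [LinearMap.comp_apply, LinearMap.flip_apply, TensorProduct.mk_apply,
        LinearEquiv.coe_coe]
      rw [← apply_sliceRight, hφ.T₃, map_smul]
  have hT₁ : ∀ a b, sliceLeft (φ ∘ₗ S) A (C.T₁ (a ⊗ₜ b)) = φ (S a) • b := by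
    have h₂ : ∀ (x : A ⊗[ℂ] A) (b : A),
        sliceLeft (φ ∘ₗ S) A (C.T₁ (sliceRight A φ (C.T₁ x) ⊗ₜ b)) =
          φ (S (sliceRight A φ (C.T₁ x))) • b := by
      intro x b
      induction x with
      | zero => simp
      | add x y hx hy => simp only [map_add, hx, hy, TensorProduct.add_tmul, add_smul]
      | tmul c a =>
        -- With this `z`, `T₁_slice₁` expresses `T₁` at the slice tensored with `b` through `z`, and
        -- `h₁` trades `z` back for `a ⊗ b`.
        obtain ⟨z, hz⟩ := C.T₃.surjective (b ⊗ₜ a)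
        have h₃ : a ⊗ₜ b = TensorProduct.comm ℂ A A (C.T₃ z) := by rw [hz, TensorProduct.comm_tmul]
        have h₄ := hφ.T₁_slice₁ c z
        rw [← h₃, LinearMap.rTensor_tmul, slice₁_apply] at h₄
        rw [h₄, sliceLeft_rTensor, LinearMap.comp_assoc, ← h₁, ← h₃]
        rfl
    intro a b
    obtain ⟨x, rfl⟩ := ((sliceRight_surjective h0).comp C.T₁.surjective) a
    exact h₂ x b
  refine ⟨hT₁, fun a b => C.right_cancel fun c => ?_⟩
  change C.mul.flip c _ = C.mul.flip c _
  rw [← sliceLeft_lTensor, ← C.T₁_T₄, sliceLeft_lTensor, hT₁]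
  simp

/-- Both sides are `(ψ ⊗ φ)(Δ(a)x)`: right invariance evaluates it after writing `x` as `T₁ y`, left
invariance after writing `x` as `T₃ y`. -/
theorem exists_apply_mul_eq {C : CanonicalMaps A} {φ ψ : A →ₗ[ℂ] ℂ} (hφ : C.IsLeftInvariant φ)
    (hψ : C.IsRightInvariant ψ) (x : A ⊗[ℂ] A) (a : A) :
    ψ (C.mul a (sliceRight A φ (C.T₁.symm x))) = φ (C.mul a (sliceRight A ψ (C.T₃.symm x))) := by
  have h₁ : ∀ y, φ (sliceLeft ψ A (C.L a (C.T₁ y))) = ψ (C.mul a (sliceRight A φ y)) := by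
    intro y
    induction y with
    | zero => simp
    | add x y hx hy => simp only [map_add, hx, hy]
    | tmul p q =>
      rw [C.L_T₁, hψ.T₁]
      simp [mul_comm]
  have h₃ : ∀ y, φ (sliceLeft ψ A (C.L a (C.T₃ y))) = φ (C.mul a (sliceRight A ψ y)) := by
    intro y
    induction y with
    | zero => simp
    | add x y hx hy => simp only [map_add, hx, hy]
    | tmul p q =>
      rw [C.L_T₃, ← apply_sliceRight, hφ.T₃]
      simp [mul_comm]
  rw [← h₁, ← h₃, LinearEquiv.apply_symm_apply, LinearEquiv.apply_symm_apply]

/-- `φ(· A) = ψ(· A)` -/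
theorem exists_left_eq_right {C : CanonicalMaps A} {φ ψ : A →ₗ[ℂ] ℂ} (hφ : C.IsLeftInvariant φ)
    (hψ : C.IsRightInvariant ψ) (h0 : ψ ≠ 0) (c : A) :
    ∃ d, ∀ a, φ (C.mul a c) = ψ (C.mul a d) := by
  obtain ⟨x, rfl⟩ := ((sliceRight_surjective h0).comp C.T₃.symm.surjective) c
  exact ⟨_, fun a => (exists_apply_mul_eq hφ hψ x a).symm⟩

theorem exists_right_eq_left {C : CanonicalMaps A} {φ ψ : A →ₗ[ℂ] ℂ} (hφ : C.IsLeftInvariant φ)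
    (hψ : C.IsRightInvariant ψ) (h0 : φ ≠ 0) (c : A) :
    ∃ d, ∀ a, ψ (C.mul a c) = φ (C.mul a d) := by
  obtain ⟨x, rfl⟩ := ((sliceRight_surjective h0).comp C.T₁.symm.surjective) c
  exact ⟨_, fun a => exists_apply_mul_eq hφ hψ x a⟩

/-- Both sides are `(ψ ⊗ φ)((1 ⊗ S(q))Δ(x)(S(p) ⊗ 1))` for `w = p ⊗ q`. -/
theorem apply_mul_slice_eq {C : CanonicalMaps A} {φ ψ : A →ₗ[ℂ] ℂ} (hφ : C.IsLeftInvariant φ)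
    (hψ : C.IsRightInvariant ψ) (hφ0 : φ ≠ 0) (hψ0 : ψ ≠ 0) {ε : A →ₗ[ℂ] ℂ} (hε : C.IsCounit ε)
    {S : A →ₗ[ℂ] A} (hS : C.IsAntipode ε S) (w : A ⊗[ℂ] A) (x : A) :
    φ (C.mul (sliceLeft (ψ ∘ₗ S) A (C.T₂ (S.lTensor A w))) x) =
      ψ (C.mul x (sliceRight A (φ ∘ₗ S) (C.T₁ (S.rTensor A w)))) := by
  induction w with
  | zero => simp
  | add x y hx hy => simp only [map_add, LinearMap.add_apply, hx, hy]
  | tmul p q =>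
    -- Moving `x` inside the slice and then applying `S`, which is antimultiplicative, converts the
    -- coproducts of `S(p)` and `S(q)` into the coproduct of `x` on either side.
    rw [LinearMap.lTensor_tmul, LinearMap.rTensor_tmul, ← sliceRight_rTensor, C.T₁_T₂,
      apply_sliceRight, sliceLeft_lTensor, LinearMap.comp_apply, LinearMap.flip_apply,
      hS.map_mul hε, hψ.antipode_sliceLeft_T₂ hψ0 hε hS, ← C.mul.flip_apply,
      ← sliceLeft_lTensor, ← C.T₁_T₂, ← apply_sliceRight, sliceRight_rTensor, LinearMap.comp_apply,
      hS.map_mul hε, hφ.antipode_sliceRight_T₁ hφ0 hε hS, ← C.mul.flip_apply, ← sliceRight_rTensor,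
      ← C.T₃_T₄, apply_sliceRight, sliceLeft_lTensor]

/-- Since `T₂` and `S` are surjective and `ψ ∘ S ≠ 0`, every `c` occurs as the slice on the left of
`apply_mul_slice_eq`. -/
theorem exists_apply_mul_left_eq {C : CanonicalMaps A} {φ ψ : A →ₗ[ℂ] ℂ} (hφ : C.IsLeftInvariant φ)
    (hψ : C.IsRightInvariant ψ) (hφ0 : φ ≠ 0) (hψ0 : ψ ≠ 0) {ε : A →ₗ[ℂ] ℂ} (hε : C.IsCounit ε)
    {S : A →ₗ[ℂ] A} (hS : C.IsAntipode ε S) (hS' : Function.Surjective S) (c : A) :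
    ∃ d, ∀ x, φ (C.mul c x) = ψ (C.mul x d) := by
  have h0 : ψ ∘ₗ S ≠ 0 := fun h => hψ0 (LinearMap.ext fun a => by
    obtain ⟨b, rfl⟩ := hS' a
    exact LinearMap.congr_fun h b)
  obtain ⟨w, rfl⟩ := (((sliceLeft_surjective h0).comp C.T₂.surjective).comp
    (LinearMap.lTensor_surjective A hS')) c
  exact ⟨_, fun x => apply_mul_slice_eq hφ hψ hφ0 hψ0 hε hS w x⟩

theorem exists_apply_mul_right_eq {C : CanonicalMaps A} {φ ψ : A →ₗ[ℂ] ℂ} (hφ : C.IsLeftInvariant φ)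
    (hψ : C.IsRightInvariant ψ) (hφ0 : φ ≠ 0) (hψ0 : ψ ≠ 0) {ε : A →ₗ[ℂ] ℂ} (hε : C.IsCounit ε)
    {S : A →ₗ[ℂ] A} (hS : C.IsAntipode ε S) (hS' : Function.Surjective S) (d : A) :
    ∃ c, ∀ x, ψ (C.mul x d) = φ (C.mul c x) := by
  have h0 : φ ∘ₗ S ≠ 0 := fun h => hφ0 (LinearMap.ext fun a => by
    obtain ⟨b, rfl⟩ := hS' a
    exact LinearMap.congr_fun h b)
  obtain ⟨w, rfl⟩ := (((sliceRight_surjective h0).comp C.T₁.surjective).comp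
    (LinearMap.rTensor_surjective A hS')) d
  exact ⟨_, fun x => (apply_mul_slice_eq hφ hψ hφ0 hψ0 hε hS w x).symm⟩

end CanonicalMaps

/-! ### Multipliers and threefold tensors. -/

section MultiplierLemmas

variable {A : Type*} [NonUnitalRing A] [Module ℂ A] [SMulCommClass ℂ A A] [IsScalarTower ℂ A A]

theorem multiplier_ext {m n : MultiplierAlgebra A} (hL : ∀ x, mulL m x = mulL n x)
    (hR : ∀ x, mulR m x = mulR n x) : m = n :=
  Subtype.ext (Prod.ext (LinearMap.ext hL) (MulOpposite.unop_injective (LinearMap.ext hR)))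

theorem toMultiplier_mulL_apply (m : MultiplierAlgebra A) (x : A) :
    toMultiplier A (mulL m x) = m * toMultiplier A x :=
  multiplier_ext (fun y => by simp [mulL_map_mul]) (fun y => by simp [mulR_mul_eq])

theorem toMultiplier_mulR_apply (m : MultiplierAlgebra A) (x : A) :
    toMultiplier A (mulR m x) = toMultiplier A x * m :=
  multiplier_ext (fun y => by simp [mulR_mul_eq]) (fun y => by simp [mulR_map_mul])

theorem tmulOne_mul_oneTmul (a b : A) :
    tmulOne a * oneTmul b = toMultiplier (A ⊗[ℂ] A) (a ⊗ₜ b) := by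
  refine multiplier_ext (fun x => ?_) (fun x => ?_) <;>
  · induction x with
    | zero => simp
    | add x y hx hy => simp only [map_add, hx, hy]
    | tmul u v => simp

theorem oneTmul_mul_tmulOne (a b : A) :
    oneTmul b * tmulOne a = toMultiplier (A ⊗[ℂ] A) (a ⊗ₜ b) := by
  refine multiplier_ext (fun x => ?_) (fun x => ?_) <;>
  · induction x with
    | zero => simp
    | add x y hx hy => simp only [map_add, hx, hy]
    | tmul u v => simp

theorem mulL_tmulOne_eq (a : A) : mulL (tmulOne a) = (LinearMap.mul ℂ A a).rTensor A :=
  TensorProduct.ext' fun _ _ => rfl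

theorem mulL_oneTmul_eq (a : A) : mulL (oneTmul a) = (LinearMap.mul ℂ A a).lTensor A :=
  TensorProduct.ext' fun _ _ => rfl

theorem mulR_tmulOne_eq (a : A) : mulR (tmulOne a) = ((LinearMap.mul ℂ A).flip a).rTensor A :=
  TensorProduct.ext' fun _ _ => rfl

theorem mulR_oneTmul_eq (a : A) : mulR (oneTmul a) = ((LinearMap.mul ℂ A).flip a).lTensor A :=
  TensorProduct.ext' fun _ _ => rfl

end MultiplierLemmas

section Assoc

variable {U V W X : Type*} [AddCommGroup U] [Module ℂ U] [AddCommGroup V] [Module ℂ V]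
  [AddCommGroup W] [Module ℂ W] [AddCommGroup X] [Module ℂ X]

theorem sliceLeft_assoc_tmul (g : U →ₗ[ℂ] ℂ) (w : U ⊗[ℂ] V) (x : W) :
    sliceLeft g (V ⊗[ℂ] W) (TensorProduct.assoc ℂ U V W (w ⊗ₜ x)) = sliceLeft g V w ⊗ₜ x := by
  induction w with
  | zero => simp
  | add x y hx hy => simp only [map_add, TensorProduct.add_tmul, hx, hy]
  | tmul u v => simp [TensorProduct.smul_tmul']

theorem sliceRight_assoc_symm_tmul (g : W →ₗ[ℂ] ℂ) (u : U) (w : V ⊗[ℂ] W) :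
    sliceRight (U ⊗[ℂ] V) g ((TensorProduct.assoc ℂ U V W).symm (u ⊗ₜ w)) =
      u ⊗ₜ sliceRight V g w := by
  induction w with
  | zero => simp
  | add x y hx hy => simp only [map_add, TensorProduct.tmul_add, hx, hy]
  | tmul u v => simp

theorem sliceLeft_assoc_rTensor (g : U →ₗ[ℂ] ℂ) (f : X →ₗ[ℂ] U ⊗[ℂ] V) (y : X ⊗[ℂ] W) :
    sliceLeft g (V ⊗[ℂ] W) (TensorProduct.assoc ℂ U V W (f.rTensor W y)) =
      (sliceLeft g V ∘ₗ f).rTensor W y := by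
  induction y with
  | zero => simp
  | add x y hx hy => simp only [map_add, hx, hy]
  | tmul u v => simp [sliceLeft_assoc_tmul]

theorem sliceRight_assoc_symm_lTensor (g : W →ₗ[ℂ] ℂ) (f : X →ₗ[ℂ] V ⊗[ℂ] W) (y : U ⊗[ℂ] X) :
    sliceRight (U ⊗[ℂ] V) g ((TensorProduct.assoc ℂ U V W).symm (f.lTensor U y)) =
      (sliceRight V g ∘ₗ f).lTensor U y := by
  induction y with
  | zero => simp
  | add x y hx hy => simp only [map_add, hx, hy]
  | tmul u v => simp [sliceRight_assoc_symm_tmul]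

theorem eq_of_sliceLeft {x y : U ⊗[ℂ] V} (h : ∀ g, sliceLeft g V x = sliceLeft g V y) : x = y := by
  rw [← sub_eq_zero]
  exact eq_zero_of_sliceLeft _ fun g => by rw [map_sub, h, sub_self]

theorem eq_of_sliceRight {x y : U ⊗[ℂ] V} (h : ∀ g, sliceRight U g x = sliceRight U g y) :
    x = y := by
  rw [← sub_eq_zero]
  exact eq_zero_of_sliceRight _ fun g => by rw [map_sub, h, sub_self]

end Assoc

/-! ### The canonical maps of a regular multiplier Hopf algebra. -/

namespace RegularMultiplierHopfAlgebra

variable {A : Type*} [NonUnitalRing A] [Module ℂ A] [SMulCommClass ℂ A A] [IsScalarTower ℂ A A]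
  (H : RegularMultiplierHopfAlgebra A)

theorem mul_rTensor_T₁ (a c p : A) : (LinearMap.mul ℂ A p).rTensor A (H.T₁ (a ⊗ₜ c)) =
    ((LinearMap.mul ℂ A).flip c).lTensor A (H.T₂ (p ⊗ₜ a)) := by
  rw [← mulL_tmulOne_eq, ← mulR_oneTmul_eq]
  exact H.T₁_T₂ p a c

theorem mul_lTensor_T₁ (a c p : A) : (LinearMap.mul ℂ A p).lTensor A (H.T₁ (a ⊗ₜ c)) =
    ((LinearMap.mul ℂ A).flip c).lTensor A (H.T₄ (p ⊗ₜ a)) := by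
  rw [← mulL_oneTmul_eq, ← mulR_oneTmul_eq]
  apply H.toMultiplier_injective
  rw [toMultiplier_mulL_apply, toMultiplier_mulR_apply, H.T₁_spec, H.T₄_spec, mul_assoc]

theorem mul_rTensor_T₃ (a c p : A) : (LinearMap.mul ℂ A p).rTensor A (H.T₃ (a ⊗ₜ c)) =
    ((LinearMap.mul ℂ A).flip c).rTensor A (H.T₂ (p ⊗ₜ a)) := by
  rw [← mulL_tmulOne_eq, ← mulR_tmulOne_eq]
  apply H.toMultiplier_injective
  rw [toMultiplier_mulL_apply, toMultiplier_mulR_apply, H.T₃_spec, H.T₂_spec, mul_assoc]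

theorem mul_lTensor_T₃ (a c p : A) : (LinearMap.mul ℂ A p).lTensor A (H.T₃ (a ⊗ₜ c)) =
    ((LinearMap.mul ℂ A).flip c).rTensor A (H.T₄ (p ⊗ₜ a)) := by
  rw [← mulL_oneTmul_eq, ← mulR_tmulOne_eq]
  apply H.toMultiplier_injective
  rw [toMultiplier_mulL_apply, toMultiplier_mulR_apply, H.T₃_spec, H.T₄_spec, mul_assoc]

theorem T₁_slice (g : A →ₗ[ℂ] ℂ) (a b c : A) : H.T₁ (sliceLeft g A (H.T₂ (a ⊗ₜ b)) ⊗ₜ c) =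
    (sliceLeft g A ∘ₗ H.T₂.toLinearMap ∘ₗ TensorProduct.mk ℂ A A a).rTensor A
      (H.T₁ (b ⊗ₜ c)) := by
  have h := congrArg (fun z => sliceLeft g (A ⊗[ℂ] A) (TensorProduct.assoc ℂ A A A z))
    (H.coassoc a b c)
  simp only [LinearEquiv.apply_symm_apply, sliceLeft_lTensor, sliceLeft_assoc_tmul] at h
  refine h.symm.trans ?_
  generalize H.T₁ (b ⊗ₜ[ℂ] c) = y
  induction y with
  | zero => simp
  | add x y hx hy => simp only [map_add, TensorProduct.tmul_add, hx, hy]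
  | tmul p q => simp [sliceLeft_assoc_tmul]

theorem T₂_slice (g : A →ₗ[ℂ] ℂ) (a b c : A) : H.T₂ (c ⊗ₜ sliceRight A g (H.T₁ (b ⊗ₜ a))) =
    (sliceRight A g ∘ₗ H.T₁.toLinearMap ∘ₗ (TensorProduct.mk ℂ A A).flip a).lTensor A
      (H.T₂ (c ⊗ₜ b)) := by
  have h := congrArg (sliceRight (A ⊗[ℂ] A) g) (H.coassoc c b a)
  rw [sliceRight_rTensor, sliceRight_assoc_symm_tmul] at h
  refine h.trans ?_
  generalize H.T₂ (c ⊗ₜ[ℂ] b) = y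
  induction y with
  | zero => simp
  | add x y hx hy => simp only [map_add, TensorProduct.add_tmul, hx, hy]
  | tmul p q => simp [sliceRight_assoc_symm_tmul]

/-- Coassociativity is postulated for `T₁` and `T₂` only. For a functional `g(d ·)`, the slice of
`Δ(b)(a ⊗ 1)` is the slice of `(d ⊗ 1)Δ(b)` by `g(· a)`, and a factor `e` on the right of the second
leg turns `T₄` into `T₁`, so that `T₁_slice` applies. -/
theorem T₄_slice (g : A →ₗ[ℂ] ℂ) (a b c : A) : H.T₄ (c ⊗ₜ sliceLeft g A (H.T₃ (b ⊗ₜ a))) =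
    (sliceLeft g A ∘ₗ H.T₃.toLinearMap ∘ₗ (TensorProduct.mk ℂ A A).flip a).rTensor A
      (H.T₄ (c ⊗ₜ b)) := by
  have key : ∀ (g : A →ₗ[ℂ] ℂ) (d : A),
      H.T₄ (c ⊗ₜ sliceLeft (g ∘ₗ LinearMap.mul ℂ A d) A (H.T₃ (b ⊗ₜ a))) =
      (sliceLeft (g ∘ₗ LinearMap.mul ℂ A d) A ∘ₗ H.T₃.toLinearMap ∘ₗ
        (TensorProduct.mk ℂ A A).flip a).rTensor A (H.T₄ (c ⊗ₜ b)) := by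
    intro g d
    have h₁ : sliceLeft (g ∘ₗ LinearMap.mul ℂ A d) A ∘ₗ H.T₃.toLinearMap ∘ₗ
        (TensorProduct.mk ℂ A A).flip a = sliceLeft (g ∘ₗ (LinearMap.mul ℂ A).flip a) A ∘ₗ
        H.T₂.toLinearMap ∘ₗ TensorProduct.mk ℂ A A d := by
      ext x
      simp only [LinearMap.comp_apply, LinearEquiv.coe_coe, LinearMap.flip_apply,
        TensorProduct.mk_apply]
      rw [← sliceLeft_rTensor, H.mul_rTensor_T₃, sliceLeft_rTensor]
    have h₂ : sliceLeft (g ∘ₗ LinearMap.mul ℂ A d) A (H.T₃ (b ⊗ₜ a)) =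
        sliceLeft (g ∘ₗ (LinearMap.mul ℂ A).flip a) A (H.T₂ (d ⊗ₜ b)) :=
      LinearMap.congr_fun h₁ b
    rw [h₁, h₂]
    refine eq_of_lTensor (LinearMap.mul ℂ A).flip H.nondegenerate_left fun e => ?_
    rw [← H.mul_lTensor_T₁, H.T₁_slice, ← rTensor_lTensor_comm, ← rTensor_lTensor_comm,
      H.mul_lTensor_T₁]
  -- The unsliced identity for `(1 ⊗ 1 ⊗ c)Δ⁽²⁾(b)(a ⊗ 1 ⊗ 1)`: by non-degeneracy the functionals
  -- `g(d ·)` suffice to prove it, and it then allows arbitrary `g`.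
  have hZ : (H.T₄.toLinearMap ∘ₗ TensorProduct.mk ℂ A A c).lTensor A (H.T₃ (b ⊗ₜ a)) =
      TensorProduct.assoc ℂ A A A ((H.T₃.toLinearMap ∘ₗ
        (TensorProduct.mk ℂ A A).flip a).rTensor A (H.T₄ (c ⊗ₜ b))) := by
    refine eq_of_rTensor (LinearMap.mul ℂ A) H.nondegenerate_right fun d => ?_
    refine eq_of_sliceLeft fun g => ?_
    rw [sliceLeft_rTensor, sliceLeft_rTensor, sliceLeft_lTensor, sliceLeft_assoc_rTensor]
    exact key g d
  rw [← sliceLeft_assoc_rTensor, ← hZ, sliceLeft_lTensor]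
  rfl

theorem T₃_slice (g : A →ₗ[ℂ] ℂ) (a b c : A) : H.T₃ (sliceRight A g (H.T₄ (a ⊗ₜ b)) ⊗ₜ c) =
    (sliceRight A g ∘ₗ H.T₄.toLinearMap ∘ₗ TensorProduct.mk ℂ A A a).lTensor A
      (H.T₃ (b ⊗ₜ c)) := by
  have key : ∀ (g : A →ₗ[ℂ] ℂ) (d : A),
      H.T₃ (sliceRight A (g ∘ₗ (LinearMap.mul ℂ A).flip d) (H.T₄ (a ⊗ₜ b)) ⊗ₜ c) =
      (sliceRight A (g ∘ₗ (LinearMap.mul ℂ A).flip d) ∘ₗ H.T₄.toLinearMap ∘ₗ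
        TensorProduct.mk ℂ A A a).lTensor A (H.T₃ (b ⊗ₜ c)) := by
    intro g d
    have h₁ : sliceRight A (g ∘ₗ (LinearMap.mul ℂ A).flip d) ∘ₗ H.T₄.toLinearMap ∘ₗ
        TensorProduct.mk ℂ A A a = sliceRight A (g ∘ₗ LinearMap.mul ℂ A a) ∘ₗ
        H.T₁.toLinearMap ∘ₗ (TensorProduct.mk ℂ A A).flip d := by
      ext x
      simp only [LinearMap.comp_apply, LinearEquiv.coe_coe, LinearMap.flip_apply,
        TensorProduct.mk_apply]
      rw [← sliceRight_lTensor, ← H.mul_lTensor_T₁, sliceRight_lTensor]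
    have h₂ : sliceRight A (g ∘ₗ (LinearMap.mul ℂ A).flip d) (H.T₄ (a ⊗ₜ b)) =
        sliceRight A (g ∘ₗ LinearMap.mul ℂ A a) (H.T₁ (b ⊗ₜ d)) :=
      LinearMap.congr_fun h₁ b
    rw [h₁, h₂]
    refine eq_of_rTensor (LinearMap.mul ℂ A) H.nondegenerate_right fun e => ?_
    rw [H.mul_rTensor_T₃, H.T₂_slice, rTensor_lTensor_comm, rTensor_lTensor_comm,
      H.mul_rTensor_T₃]
  have hZ : (H.T₃.toLinearMap ∘ₗ (TensorProduct.mk ℂ A A).flip c).rTensor A (H.T₄ (a ⊗ₜ b)) =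
      (TensorProduct.assoc ℂ A A A).symm ((H.T₄.toLinearMap ∘ₗ
        TensorProduct.mk ℂ A A a).lTensor A (H.T₃ (b ⊗ₜ c))) := by
    refine eq_of_lTensor (LinearMap.mul ℂ A).flip H.nondegenerate_left fun d => ?_
    refine eq_of_sliceRight fun g => ?_
    rw [sliceRight_lTensor, sliceRight_lTensor, sliceRight_rTensor, sliceRight_assoc_symm_lTensor]
    exact key g d
  rw [← sliceRight_assoc_symm_lTensor, ← hZ, sliceRight_rTensor]
  rfl

theorem T₂_mulL (a p q : A) :
    mulL (oneTmul q) (H.T₂ (p ⊗ₜ a)) = mulR (H.comul a) (p ⊗ₜ q) := by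
  apply H.toMultiplier_injective
  rw [toMultiplier_mulL_apply, toMultiplier_mulR_apply, H.T₂_spec, ← mul_assoc,
    oneTmul_mul_tmulOne]

theorem T₃_mulR (a c d : A) :
    mulR (oneTmul c) (H.T₃ (a ⊗ₜ d)) = mulL (H.comul a) (d ⊗ₜ c) := by
  apply H.toMultiplier_injective
  rw [toMultiplier_mulR_apply, toMultiplier_mulL_apply, H.T₃_spec, mul_assoc,
    tmulOne_mul_oneTmul]

theorem T₄_mulL (a p q : A) :
    mulL (tmulOne p) (H.T₄ (q ⊗ₜ a)) = mulR (H.comul a) (p ⊗ₜ q) := by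
  apply H.toMultiplier_injective
  rw [toMultiplier_mulL_apply, toMultiplier_mulR_apply, H.T₄_spec, ← mul_assoc,
    tmulOne_mul_oneTmul]

theorem comul_mulL_T₁ (a p q : A) :
    mulL (H.comul a) (H.T₁ (p ⊗ₜ q)) = H.T₁ ((a * p) ⊗ₜ q) := by
  apply H.toMultiplier_injective
  rw [toMultiplier_mulL_apply, H.T₁_spec, H.T₁_spec, ← mul_assoc, map_mul]

theorem comul_mulR_T₂ (a p q : A) :
    mulR (H.comul a) (H.T₂ (q ⊗ₜ p)) = H.T₂ (q ⊗ₜ (p * a)) := by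
  apply H.toMultiplier_injective
  rw [toMultiplier_mulR_apply, H.T₂_spec, H.T₂_spec, mul_assoc, map_mul]

theorem comul_mulR_T₄ (a p q : A) :
    mulR (H.comul a) (H.T₄ (q ⊗ₜ p)) = H.T₄ (q ⊗ₜ (p * a)) := by
  apply H.toMultiplier_injective
  rw [toMultiplier_mulR_apply, H.T₄_spec, H.T₄_spec, mul_assoc, map_mul]

/-- The canonical maps of `A`. -/
def canonicalMaps : CanonicalMaps A where
  mul := LinearMap.mul ℂ A
  mul_assoc := mul_assoc
  left_nondegenerate := H.nondegenerate_left
  right_nondegenerate := H.nondegenerate_right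
  T₁ := H.T₁
  T₂ := H.T₂
  T₃ := H.T₃
  T₄ := H.T₄
  L := mulLHom ∘ₗ (H.comul : A →ₗ[ℂ] MultiplierAlgebra (A ⊗[ℂ] A))
  R :=
    { toFun := fun a => mulR (H.comul a)
      map_add' := fun a b => by rw [map_add]; rfl
      map_smul' := fun r a => by rw [map_smul]; rfl }
  T₁_L a c d := by
    rw [← mulR_tmulOne_eq]
    exact H.T₁_mulR a c d
  T₂_R a p q := by
    rw [← mulL_oneTmul_eq]
    exact H.T₂_mulL a p q
  T₃_L a c d := by
    rw [← mulR_oneTmul_eq]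
    exact H.T₃_mulR a c d
  T₄_R a p q := by
    rw [← mulL_tmulOne_eq]
    exact H.T₄_mulL a p q
  T₁_T₂ := H.mul_rTensor_T₁
  T₁_T₄ := H.mul_lTensor_T₁
  T₃_T₂ := H.mul_rTensor_T₃
  T₃_T₄ := H.mul_lTensor_T₃
  L_T₁ := H.comul_mulL_T₁
  R_T₂ a b c := H.comul_mulR_T₂ a b c
  L_T₃ a b c := H.comul_mulL_T₃ a b c
  R_T₄ a b c := H.comul_mulR_T₄ a b c
  T₁_coassoc := H.T₁_slice
  T₂_coassoc := H.T₂_slice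
  T₃_coassoc := H.T₃_slice
  T₄_coassoc := H.T₄_slice

end RegularMultiplierHopfAlgebra

/-! ### Counit, antipode, modular automorphism and the three descriptions of the dual. -/

variable {A : Type*} [NonUnitalRing A] [Module ℂ A] [SMulCommClass ℂ A A] [IsScalarTower ℂ A A]
  {H : RegularMultiplierHopfAlgebra A}

theorem RightIntegral.isRightInvariant (ψ : RightIntegral H) :
    H.canonicalMaps.IsRightInvariant ψ.toFun :=
  ⟨ψ.invariant_left, ψ.invariant_right⟩

theorem RegularMultiplierHopfAlgebra.cancel_right (H : RegularMultiplierHopfAlgebra A) {x y : A}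
    (h : ∀ p, x * p = y * p) : x = y :=
  H.canonicalMaps.right_cancel h

namespace LeftIntegral

variable (φ : LeftIntegral H)

theorem isLeftInvariant : H.canonicalMaps.IsLeftInvariant φ.toFun :=
  ⟨φ.invariant_right, φ.invariant_left⟩

theorem nontrivial_of_leftIntegral (φ : LeftIntegral H) : Nontrivial A := by
  obtain ⟨u, hu⟩ := DFunLike.ne_iff.mp φ.ne_zero
  exact ⟨u, 0, fun h => hu (by rw [h, map_zero, map_zero])⟩

theorem exists_counit (φ : LeftIntegral H) : ∃ ε, H.canonicalMaps.IsCounit ε :=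
  have := φ.nontrivial_of_leftIntegral
  H.canonicalMaps.exists_isCounit

/-- The counit of `A`. -/
noncomputable def counit : A →ₗ[ℂ] ℂ := φ.exists_counit.choose

theorem isCounit : H.canonicalMaps.IsCounit φ.counit := φ.exists_counit.choose_spec

theorem exists_antipode : ∃ S : A ≃ₗ[ℂ] A, H.canonicalMaps.IsAntipode φ.counit S.toLinearMap := by
  have := φ.nontrivial_of_leftIntegral
  obtain ⟨S, hS, -⟩ := φ.isLeftInvariant.exists_isAntipode φ.ne_zero φ.isCounit
  exact ⟨LinearEquiv.ofBijective S
    (φ.isLeftInvariant.antipode_bijective φ.ne_zero φ.isCounit hS), hS⟩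

/-- The antipode of `A`. -/
noncomputable def antipode : A ≃ₗ[ℂ] A := φ.exists_antipode.choose

theorem isAntipode : H.canonicalMaps.IsAntipode φ.counit φ.antipode.toLinearMap :=
  φ.exists_antipode.choose_spec

theorem antipode_mul (a b : A) : φ.antipode (a * b) = φ.antipode b * φ.antipode a :=
  φ.isAntipode.map_mul φ.isCounit a b

theorem antipode_sliceRight_T₁ (x : A ⊗[ℂ] A) :
    φ.antipode (sliceRight A φ.toFun (H.T₁ x)) = sliceRight A φ.toFun (H.T₄ x) :=
  φ.isLeftInvariant.antipode_sliceRight_T₁ φ.ne_zero φ.isCounit φ.isAntipode x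

theorem antipode_sliceLeft_T₂ (ψ : RightIntegral H) (x : A ⊗[ℂ] A) :
    φ.antipode (sliceLeft ψ.toFun A (H.T₂ x)) = sliceLeft ψ.toFun A (H.T₃ x) :=
  ψ.isRightInvariant.antipode_sliceLeft_T₂ ψ.ne_zero φ.isCounit φ.isAntipode x

/-- The right integral `φ ∘ S`. -/
noncomputable def rightIntegral : RightIntegral H where
  toFun := φ.toFun ∘ₗ φ.antipode.toLinearMap
  ne_zero h := φ.ne_zero (LinearMap.ext fun a => by
    simpa using LinearMap.congr_fun h (φ.antipode.symm a))
  invariant_left :=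
    (φ.isLeftInvariant.comp_antipode φ.ne_zero φ.isCounit φ.isAntipode).T₁
  invariant_right :=
    (φ.isLeftInvariant.comp_antipode φ.ne_zero φ.isCounit φ.isAntipode).T₄

theorem eq_zero_of_apply_mul_right (φ : LeftIntegral H) {a : A} (h : ∀ b, φ.toFun (b * a) = 0) : a = 0 :=
  have := φ.nontrivial_of_leftIntegral
  φ.isLeftInvariant.eq_zero_of_apply_mul_right φ.ne_zero h

theorem eq_zero_of_apply_mul_left (φ : LeftIntegral H) {a : A} (h : ∀ b, φ.toFun (a * b) = 0) : a = 0 :=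
  have := φ.nontrivial_of_leftIntegral
  φ.isLeftInvariant.eq_zero_of_apply_mul_left φ.ne_zero h

/-- The linear isomorphism `c ↦ φ(· c)` from `A` to its dual. -/
noncomputable def elemEquiv : A ≃ₗ[ℂ] φ.dual :=
  LinearEquiv.ofBijective φ.functional.rangeRestrict
    ⟨(injective_iff_map_eq_zero _).mpr fun _ hc =>
      φ.eq_zero_of_apply_mul_right fun b => LinearMap.congr_fun (congrArg Subtype.val hc) b,
      LinearMap.surjective_rangeRestrict _⟩

@[simp] theorem elemEquiv_apply (c : A) : φ.elemEquiv c = φ.elem c := rfl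

@[simp] theorem elemEquiv_symm_elem (c : A) : φ.elemEquiv.symm (φ.elem c) = c :=
  φ.elemEquiv.symm_apply_apply c

theorem elemEquiv_symm_spec (b : φ.dual) (x : A) : φ.toFun (x * φ.elemEquiv.symm b) = b.1 x := by
  rw [← coe_elem, ← elemEquiv_apply, LinearEquiv.apply_symm_apply]

theorem exists_eq_rightIntegral (ψ : RightIntegral H) (b : φ.dual) :
    ∃ d, ∀ x, b.1 x = ψ.toFun (x * d) := by
  obtain ⟨c, rfl⟩ := φ.elemEquiv.surjective b
  exact CanonicalMaps.exists_left_eq_right φ.isLeftInvariant ψ.isRightInvariant ψ.ne_zero c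

theorem exists_dual_eq_rightIntegral (ψ : RightIntegral H) (c : A) :
    ∃ b : φ.dual, ∀ x, b.1 x = ψ.toFun (x * c) := by
  obtain ⟨d, hd⟩ := CanonicalMaps.exists_right_eq_left φ.isLeftInvariant ψ.isRightInvariant
    φ.ne_zero c
  exact ⟨φ.elem d, fun x => (hd x).symm⟩

theorem exists_dual_eq_left (c : A) : ∃ b : φ.dual, ∀ x, b.1 x = φ.toFun (c * x) := by
  obtain ⟨d, hd⟩ := CanonicalMaps.exists_apply_mul_left_eq φ.isLeftInvariant
    φ.rightIntegral.isRightInvariant φ.ne_zero φ.rightIntegral.ne_zero φ.isCounit φ.isAntipode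
    φ.antipode.surjective c
  obtain ⟨b, hb⟩ := φ.exists_dual_eq_rightIntegral φ.rightIntegral d
  exact ⟨b, fun x => (hb x).trans (hd x).symm⟩

theorem exists_eq_left (b : φ.dual) : ∃ c, ∀ x, b.1 x = φ.toFun (c * x) := by
  obtain ⟨d, hd⟩ := φ.exists_eq_rightIntegral φ.rightIntegral b
  obtain ⟨c, hc⟩ := CanonicalMaps.exists_apply_mul_right_eq φ.isLeftInvariant
    φ.rightIntegral.isRightInvariant φ.ne_zero φ.rightIntegral.ne_zero φ.isCounit φ.isAntipode
    φ.antipode.surjective d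
  exact ⟨c, fun x => (hd x).trans (hc x)⟩

/-- The linear isomorphism `c ↦ φ(c ·)` from `A` to its dual. -/
noncomputable def leftEquiv : A ≃ₗ[ℂ] φ.dual :=
  LinearEquiv.ofBijective
    (((LinearMap.mul ℂ A).compr₂ φ.toFun).codRestrict φ.dual fun c => by
      obtain ⟨b, hb⟩ := φ.exists_dual_eq_left c
      have : (LinearMap.mul ℂ A).compr₂ φ.toFun c = b.1 := LinearMap.ext fun x => (hb x).symm
      rw [this]
      exact b.2)
    ⟨(injective_iff_map_eq_zero _).mpr fun _ hc =>
      φ.eq_zero_of_apply_mul_left fun b => LinearMap.congr_fun (congrArg Subtype.val hc) b,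
      fun b => by
        obtain ⟨c, hc⟩ := φ.exists_eq_left b
        exact ⟨c, Subtype.ext (LinearMap.ext fun x => (hc x).symm)⟩⟩

@[simp] theorem leftEquiv_apply (c x : A) : (φ.leftEquiv c).1 x = φ.toFun (c * x) := rfl

/-- The linear isomorphism `c ↦ ψ(· c)` from `A` to its dual, where `ψ = φ ∘ S`. -/
noncomputable def rightEquiv : A ≃ₗ[ℂ] φ.dual :=
  LinearEquiv.ofBijective
    (((LinearMap.mul ℂ A).flip.compr₂ φ.rightIntegral.toFun).codRestrict φ.dual fun c => by
      obtain ⟨b, hb⟩ := φ.exists_dual_eq_rightIntegral φ.rightIntegral c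
      have : (LinearMap.mul ℂ A).flip.compr₂ φ.rightIntegral.toFun c = b.1 :=
        LinearMap.ext fun x => (hb x).symm
      rw [this]
      exact b.2)
    ⟨(injective_iff_map_eq_zero _).mpr fun c hc => by
      rw [← φ.antipode.map_eq_zero_iff]
      refine φ.eq_zero_of_apply_mul_left fun b => ?_
      obtain ⟨b, rfl⟩ := φ.antipode.surjective b
      rw [← antipode_mul]
      exact LinearMap.congr_fun (congrArg Subtype.val hc) b,
      fun b => by
        obtain ⟨c, hc⟩ := φ.exists_eq_rightIntegral φ.rightIntegral b
        exact ⟨c, Subtype.ext (LinearMap.ext fun x => (hc x).symm)⟩⟩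

@[simp] theorem rightEquiv_apply (c x : A) :
    (φ.rightEquiv c).1 x = φ.rightIntegral.toFun (x * c) := rfl

/-- The modular automorphism of `φ`. -/
noncomputable def modular : A →ₙₐ[ℂ] A where
  -- `σ(a)` is the element `e` with `φ(a ·) = φ(· e)`.
  toFun a := φ.elemEquiv.symm (φ.leftEquiv a)
  map_smul' r a := by simp
  map_zero' := by simp
  map_add' a b := by simp
  map_mul' a b := by
    rw [LinearEquiv.symm_apply_eq, elemEquiv_apply]
    refine Subtype.ext (LinearMap.ext fun x => ?_)
    rw [coe_elem, ← mul_assoc, elemEquiv_symm_spec, leftEquiv_apply, leftEquiv_apply, ← mul_assoc,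
      elemEquiv_symm_spec, leftEquiv_apply, mul_assoc]

theorem apply_mul_modular (a b : A) : φ.toFun (b * φ.modular a) = φ.toFun (a * b) :=
  φ.elemEquiv_symm_spec _ _

theorem modular_bijective : Function.Bijective φ.modular :=
  φ.elemEquiv.symm.bijective.comp φ.leftEquiv.bijective

/-! ### The actions of the dual on `A`. -/

/-- The left action `b ▹ a = (ι ⊗ b)Δ(a)` of the dual on `A`. -/
noncomputable def leftAction : φ.dual →ₗ[ℂ] A →ₗ[ℂ] A :=
  ((TensorProduct.mk ℂ A A).compr₂ (sliceRight A φ.toFun ∘ₗ H.T₁.toLinearMap)).flip ∘ₗ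
    φ.elemEquiv.symm.toLinearMap

/-- The right action `a ◃ b = (b ⊗ ι)Δ(a)` of the dual on `A`. -/
noncomputable def rightAction : A →ₗ[ℂ] φ.dual →ₗ[ℂ] A :=
  ((TensorProduct.mk ℂ A A).compr₂ (sliceLeft φ.toFun A ∘ₗ H.T₃.toLinearMap)).compl₂
    φ.elemEquiv.symm.toLinearMap

theorem leftAction_elem (c a : A) :
    φ.leftAction (φ.elem c) a = sliceRight A φ.toFun (H.T₁ (a ⊗ₜ c)) := by
  simp [leftAction]

theorem rightAction_elem (c a : A) :
    φ.rightAction a (φ.elem c) = sliceLeft φ.toFun A (H.T₃ (a ⊗ₜ c)) := by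
  simp [rightAction]

theorem mul_leftAction (p a : A) (b : φ.dual) :
    p * φ.leftAction b a = sliceRight A b.1 (H.T₂ (p ⊗ₜ a)) := by
  obtain ⟨c, rfl⟩ := φ.elemEquiv.surjective b
  rw [elemEquiv_apply, leftAction_elem, mul_slice]
  rfl

theorem rightAction_mul (p a : A) (b : φ.dual) :
    φ.rightAction a b * p = sliceLeft b.1 A (H.T₁ (a ⊗ₜ p)) := by
  obtain ⟨c, rfl⟩ := φ.elemEquiv.surjective b
  rw [elemEquiv_apply, rightAction_elem]
  change (LinearMap.mul ℂ A).flip p _ = _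
  rw [← sliceLeft_lTensor, ← mulR_oneTmul_eq, H.T₃_mulR, ← H.T₁_mulR, mulR_tmulOne_eq,
    sliceLeft_rTensor]
  rfl

/-- The action depends on `b` only as a functional, so each factorization of `b`, as `f(· e)` or
`f(e ·)`, gives a formula through the matching canonical map. This is the source of the explicit
formulas for the actions. -/
theorem leftAction_eq_of_right {b : φ.dual} {f : A →ₗ[ℂ] ℂ} {e : A} (h : ∀ x, b.1 x = f (x * e))
    (a : A) : φ.leftAction b a = sliceRight A f (H.T₁ (a ⊗ₜ e)) := by
  refine H.cancel_left fun p => ?_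
  have hb : b.1 = f ∘ₗ (LinearMap.mul ℂ A).flip e := LinearMap.ext h
  rw [mul_leftAction, hb, ← sliceRight_lTensor, ← H.mul_rTensor_T₁, sliceRight_rTensor]
  rfl

theorem leftAction_eq_of_left {b : φ.dual} {f : A →ₗ[ℂ] ℂ} {e : A} (h : ∀ x, b.1 x = f (e * x))
    (a : A) : φ.leftAction b a = sliceRight A f (H.T₄ (e ⊗ₜ a)) := by
  refine H.cancel_left fun p => ?_
  have hb : b.1 = f ∘ₗ LinearMap.mul ℂ A e := LinearMap.ext h
  rw [mul_leftAction, hb, ← sliceRight_lTensor, ← mulL_oneTmul_eq, H.T₂_mulL, ← H.T₄_mulL,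
    mulL_tmulOne_eq, sliceRight_rTensor]
  rfl

theorem rightAction_eq_of_right {b : φ.dual} {f : A →ₗ[ℂ] ℂ} {e : A}
    (h : ∀ x, b.1 x = f (x * e)) (a : A) :
    φ.rightAction a b = sliceLeft f A (H.T₃ (a ⊗ₜ e)) := by
  refine H.cancel_right fun p => ?_
  have hb : b.1 = f ∘ₗ (LinearMap.mul ℂ A).flip e := LinearMap.ext h
  change _ = (LinearMap.mul ℂ A).flip p _
  rw [rightAction_mul, hb, ← sliceLeft_rTensor, ← mulR_tmulOne_eq, H.T₁_mulR, ← H.T₃_mulR,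
    mulR_oneTmul_eq, sliceLeft_lTensor]

theorem dual_ext {b b' : φ.dual} (h : ∀ x, b.1 x = b'.1 x) : b = b' :=
  Subtype.ext (LinearMap.ext h)

theorem eq_of_dual_apply {x y : A} (h : ∀ b : φ.dual, b.1 x = b.1 y) : x = y := by
  rw [← sub_eq_zero]
  refine φ.eq_zero_of_apply_mul_left fun c => ?_
  have := h (φ.elem c)
  rw [coe_elem, coe_elem] at this
  rw [sub_mul, map_sub, this, sub_self]

/-- The action is adjoint to right multiplication in the dual. Hence its module law is the
associativity of the dual. -/
theorem apply_leftAction (a : A) (b b' : φ.dual) : b'.1 (φ.leftAction b a) = (b' * b).1 a := by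
  rw [dual_mul_apply, φ.leftAction_eq_of_right (f := φ.toFun) (e := φ.repr b)]
  intro x
  rw [← functional_apply, functional_repr]

theorem apply_rightAction (a : A) (b b' : φ.dual) : b'.1 (φ.rightAction a b) = (b * b').1 a := by
  obtain ⟨c, rfl⟩ := φ.elemEquiv.surjective b
  obtain ⟨d, rfl⟩ := φ.elemEquiv.surjective b'
  rw [elemEquiv_apply, elemEquiv_apply, elem_mul_elem_apply, ← H.T₃_mulR, apply_sliceRight,
    mulR_oneTmul_eq, sliceLeft_lTensor, rightAction_elem]
  rfl

theorem leftAction_dual_mul (b b' : φ.dual) (a : A) :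
    φ.leftAction (b * b') a = φ.leftAction b (φ.leftAction b' a) :=
  φ.eq_of_dual_apply fun x => by simp only [apply_leftAction, mul_assoc]

theorem rightAction_dual_mul (b b' : φ.dual) (a : A) :
    φ.rightAction a (b * b') = φ.rightAction (φ.rightAction a b) b' :=
  φ.eq_of_dual_apply fun x => by simp only [apply_rightAction, mul_assoc]

theorem span_leftAction :
    Submodule.span ℂ {x : A | ∃ (b : φ.dual) (a : A), φ.leftAction b a = x} = ⊤ := by
  refine (Submodule.eq_top_iff').mpr fun x => ?_
  obtain ⟨w, rfl⟩ := ((sliceRight_surjective φ.ne_zero).comp H.T₁.surjective) x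
  induction w with
  | zero => simp
  | add x y hx hy =>
    rw [Function.comp_apply, map_add, map_add]
    exact add_mem hx hy
  | tmul a c => exact Submodule.subset_span ⟨φ.elem c, a, φ.leftAction_elem c a⟩

theorem span_rightAction :
    Submodule.span ℂ {x : A | ∃ (b : φ.dual) (a : A), φ.rightAction a b = x} = ⊤ := by
  refine (Submodule.eq_top_iff').mpr fun x => ?_
  obtain ⟨w, rfl⟩ := ((sliceLeft_surjective φ.ne_zero).comp H.T₃.surjective) x
  induction w with
  | zero => simp
  | add x y hx hy =>
    rw [Function.comp_apply, map_add, map_add]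
    exact add_mem hx hy
  | tmul a c => exact Submodule.subset_span ⟨φ.elem c, a, φ.rightAction_elem c a⟩

end LeftIntegral

/-! ### Pairings of tensor products. -/

section

variable {V V' W W' : Type*} [AddCommGroup V] [Module ℂ V] [AddCommGroup V'] [Module ℂ V']
  [AddCommGroup W] [Module ℂ W] [AddCommGroup W'] [Module ℂ W']

theorem tensorPairing_tmul_left (P : V →ₗ[ℂ] W →ₗ[ℂ] ℂ) (Q : V' →ₗ[ℂ] W' →ₗ[ℂ] ℂ) (v : V) (v' : V')
    (y : W ⊗[ℂ] W') :
    tensorPairing P Q (v ⊗ₜ v') y = Q v' (sliceLeft (P v) W' y) := by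
  induction y with
  | zero => simp
  | add x y hx hy => simp only [map_add, hx, hy]
  | tmul w w' => simp

theorem tensorPairing_tmul_right (P : V →ₗ[ℂ] W →ₗ[ℂ] ℂ) (Q : V' →ₗ[ℂ] W' →ₗ[ℂ] ℂ) (x : V ⊗[ℂ] V')
    (w : W) (w' : W') :
    tensorPairing P Q x (w ⊗ₜ w') = Q.flip w' (sliceLeft (P.flip w) V' x) := by
  induction x with
  | zero => simp
  | add x y hx hy => simp only [map_add, LinearMap.add_apply, hx, hy]
  | tmul v v' => simp

theorem tensorPairing_ext_right {P : V →ₗ[ℂ] W →ₗ[ℂ] ℂ} {Q : V' →ₗ[ℂ] W' →ₗ[ℂ] ℂ}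
    (hP : ∀ w, (∀ v, P v w = 0) → w = 0) (hQ : ∀ w, (∀ v, Q v w = 0) → w = 0) {y z : W ⊗[ℂ] W'}
    (h : ∀ v v', tensorPairing P Q (v ⊗ₜ v') y = tensorPairing P Q (v ⊗ₜ v') z) : y = z := by
  rw [← sub_eq_zero]
  refine eq_zero_of_sliceRight _ fun f => hP _ fun v => ?_
  rw [apply_sliceRight]
  convert map_zero f
  refine hQ _ fun v' => ?_
  rw [← tensorPairing_tmul_left, map_sub, h, sub_self]

theorem tensorPairing_ext_left {P : V →ₗ[ℂ] W →ₗ[ℂ] ℂ} {Q : V' →ₗ[ℂ] W' →ₗ[ℂ] ℂ}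
    (hP : ∀ v, (∀ w, P v w = 0) → v = 0) (hQ : ∀ v, (∀ w, Q v w = 0) → v = 0) {y z : V ⊗[ℂ] V'}
    (h : ∀ w w', tensorPairing P Q y (w ⊗ₜ w') = tensorPairing P Q z (w ⊗ₜ w')) : y = z := by
  rw [← sub_eq_zero]
  refine eq_zero_of_sliceRight _ fun f => hP _ fun w => ?_
  rw [← P.flip_apply, apply_sliceRight]
  convert map_zero f
  refine hQ _ fun w' => ?_
  rw [← Q.flip_apply, ← tensorPairing_tmul_right, map_sub, LinearMap.sub_apply, h, sub_self]

end

namespace LeftIntegral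

variable (φ : LeftIntegral H)

/-- The pairing of `A ⊗ A` with the tensor square of the dual. -/
noncomputable def pairing₂ : A ⊗[ℂ] A →ₗ[ℂ] φ.dual ⊗[ℂ] φ.dual →ₗ[ℂ] ℂ :=
  tensorPairing φ.pairing φ.pairing

@[simp] theorem pairing₂_tmul (a a' : A) (b b' : φ.dual) :
    φ.pairing₂ (a ⊗ₜ a') (b ⊗ₜ b') = b.1 a * b'.1 a' := by
  simp [pairing₂]

theorem pairing_left_nondegenerate (a : A) (h : ∀ b, φ.pairing a b = 0) : a = 0 :=
  φ.eq_of_dual_apply fun b => (h b).trans (map_zero _).symm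

theorem pairing_right_nondegenerate (b : φ.dual) (h : ∀ a, φ.pairing a b = 0) : b = 0 :=
  φ.dual_ext h

theorem pairing₂_ext_right {y z : φ.dual ⊗[ℂ] φ.dual}
    (h : ∀ a a', φ.pairing₂ (a ⊗ₜ a') y = φ.pairing₂ (a ⊗ₜ a') z) : y = z :=
  tensorPairing_ext_right φ.pairing_right_nondegenerate φ.pairing_right_nondegenerate h

theorem pairing₂_ext_left {y z : A ⊗[ℂ] A}
    (h : ∀ b b', φ.pairing₂ y (b ⊗ₜ b') = φ.pairing₂ z (b ⊗ₜ b')) : y = z :=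
  tensorPairing_ext_left φ.pairing_left_nondegenerate φ.pairing_left_nondegenerate h

/-- The functional `b` on products: `x ↦ b(m(x))`. -/
noncomputable def evalMul (b : φ.dual) : A ⊗[ℂ] A →ₗ[ℂ] ℂ := b.1 ∘ₗ LinearMap.mul' ℂ A

@[simp] theorem evalMul_tmul (b : φ.dual) (a a' : A) : φ.evalMul b (a ⊗ₜ a') = b.1 (a * a') := rfl

theorem evalMul_apply (b : φ.dual) (x : A ⊗[ℂ] A) :
    φ.evalMul b x = b.1 (LinearMap.mul' ℂ A x) := rfl

/-- The map `c ↦ φ(S(c) ·)`. -/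
noncomputable def leftEquivS : A ≃ₗ[ℂ] φ.dual := φ.antipode.trans φ.leftEquiv

/-- The map `c ↦ ψ(· S(c))`, where `ψ = φ ∘ S`. -/
noncomputable def rightEquivS : A ≃ₗ[ℂ] φ.dual := φ.antipode.trans φ.rightEquiv

@[simp] theorem leftEquivS_apply (c x : A) :
    (φ.leftEquivS c).1 x = φ.toFun (φ.antipode c * x) := rfl

@[simp] theorem rightEquivS_apply (c x : A) :
    (φ.rightEquivS c).1 x = φ.rightIntegral.toFun (x * φ.antipode c) := rfl

theorem leftAction_leftEquiv (c a : A) :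
    φ.leftAction (φ.leftEquiv c) a = sliceRight A φ.toFun (H.T₄ (c ⊗ₜ a)) :=
  φ.leftAction_eq_of_left (fun _ => rfl) a

theorem rightAction_rightEquiv (c a : A) :
    φ.rightAction a (φ.rightEquiv c) = sliceLeft φ.rightIntegral.toFun A (H.T₃ (a ⊗ₜ c)) :=
  φ.rightAction_eq_of_right (fun _ => rfl) a

/-- The canonical map `b ⊗ b' ↦ Δ(b)(1 ⊗ b')` of the dual. -/
noncomputable def dualT₁ : φ.dual ⊗[ℂ] φ.dual ≃ₗ[ℂ] φ.dual ⊗[ℂ] φ.dual :=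
  -- Being a conjugate of a canonical map of `A`, it is bijective by construction. The
  -- identifications `ψ(· S(e))` and `φ(c ·)` are those for which `pairing₂_dualT₁` holds.
  (TensorProduct.congr φ.rightEquivS φ.leftEquiv).symm.trans
    (H.T₂.trans (TensorProduct.congr φ.rightEquivS φ.leftEquiv))

/-- The canonical map `b ⊗ b' ↦ (b ⊗ 1)Δ(b')` of the dual. -/
noncomputable def dualT₂ : φ.dual ⊗[ℂ] φ.dual ≃ₗ[ℂ] φ.dual ⊗[ℂ] φ.dual :=
  (TensorProduct.congr φ.rightEquiv φ.leftEquivS).symm.trans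
    (H.T₁.trans (TensorProduct.congr φ.rightEquiv φ.leftEquivS))

/-- The canonical map `b ⊗ b' ↦ Δ(b)(b' ⊗ 1)` of the dual. -/
noncomputable def dualT₃ : φ.dual ⊗[ℂ] φ.dual ≃ₗ[ℂ] φ.dual ⊗[ℂ] φ.dual :=
  (TensorProduct.congr φ.leftEquivS φ.leftEquiv).symm.trans
    ((TensorProduct.comm ℂ A A).trans (H.T₃.trans ((TensorProduct.comm ℂ A A).trans
      (TensorProduct.congr φ.leftEquiv φ.leftEquivS))))

/-- The canonical map `b ⊗ b' ↦ (1 ⊗ b)Δ(b')` of the dual. -/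
noncomputable def dualT₄ : φ.dual ⊗[ℂ] φ.dual ≃ₗ[ℂ] φ.dual ⊗[ℂ] φ.dual :=
  (TensorProduct.congr φ.rightEquiv φ.rightEquivS).symm.trans
    ((TensorProduct.comm ℂ A A).trans (H.T₄.trans ((TensorProduct.comm ℂ A A).trans
      (TensorProduct.congr φ.rightEquivS φ.rightEquiv))))

theorem dualT₁_tmul (e c : A) : φ.dualT₁ (φ.rightEquivS e ⊗ₜ φ.leftEquiv c) =
    TensorProduct.congr φ.rightEquivS φ.leftEquiv (H.T₂ (e ⊗ₜ c)) := by
  simp only [dualT₁, LinearEquiv.trans_apply, ← TensorProduct.congr_tmul,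
    LinearEquiv.symm_apply_apply]

theorem dualT₂_tmul (c e : A) : φ.dualT₂ (φ.rightEquiv c ⊗ₜ φ.leftEquivS e) =
    TensorProduct.congr φ.rightEquiv φ.leftEquivS (H.T₁ (c ⊗ₜ e)) := by
  simp only [dualT₂, LinearEquiv.trans_apply, ← TensorProduct.congr_tmul,
    LinearEquiv.symm_apply_apply]

theorem dualT₃_tmul (f c : A) : φ.dualT₃ (φ.leftEquivS f ⊗ₜ φ.leftEquiv c) =
    TensorProduct.congr φ.leftEquiv φ.leftEquivS (TensorProduct.comm ℂ A A (H.T₃ (c ⊗ₜ f))) := by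
  simp only [dualT₃, LinearEquiv.trans_apply, ← TensorProduct.congr_tmul,
    LinearEquiv.symm_apply_apply, TensorProduct.comm_tmul]

theorem dualT₄_tmul (c f : A) : φ.dualT₄ (φ.rightEquiv c ⊗ₜ φ.rightEquivS f) =
    TensorProduct.congr φ.rightEquivS φ.rightEquiv (TensorProduct.comm ℂ A A (H.T₄ (f ⊗ₜ c))) := by
  simp only [dualT₄, LinearEquiv.trans_apply, ← TensorProduct.congr_tmul,
    LinearEquiv.symm_apply_apply, TensorProduct.comm_tmul]

/-- `S((ι ⊗ φ)((e ⊗ 1)Δ(c)(1 ⊗ x))) = (ι ⊗ φ)((1 ⊗ c)Δ(x))S(e)` -/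
theorem antipode_sliceRight_mul_T₂ (e c x : A) :
    φ.antipode (sliceRight A (φ.toFun ∘ₗ (LinearMap.mul ℂ A).flip x) (H.T₂ (e ⊗ₜ c))) =
      φ.leftAction (φ.leftEquiv c) x * φ.antipode e := by
  rw [← sliceRight_lTensor, ← H.mul_rTensor_T₁, sliceRight_rTensor, LinearMap.mul_apply',
    antipode_mul, antipode_sliceRight_T₁, leftAction_leftEquiv]

/-- This is `⟨a ⊗ a', Δ(b)(1 ⊗ b')⟩ = ⟨a(b' ▹ a'), b⟩`, which characterizes the map by
non-degeneracy. For `b = ψ(· S(e))` with `ψ = φ ∘ S`, it comes down to a formula for `S` on slices;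
the other three maps are treated alike. -/
theorem pairing₂_dualT₁ (a a' : A) (b b' : φ.dual) :
    φ.pairing₂ (a ⊗ₜ a') (φ.dualT₁ (b ⊗ₜ b')) = b.1 (a * φ.leftAction b' a') := by
  obtain ⟨e, rfl⟩ := φ.rightEquivS.surjective b
  obtain ⟨c, rfl⟩ := φ.leftEquiv.surjective b'
  rw [dualT₁_tmul, rightEquivS_apply, mul_assoc, ← antipode_sliceRight_mul_T₂]
  generalize H.T₂ (e ⊗ₜ c) = w
  induction w with
  | zero => simp
  | add x y hx hy => simp only [map_add, mul_add, hx, hy]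
  | tmul r s => simp [mul_comm, mul_smul_comm]

theorem pairing₂_dualT₂ (a a' : A) (b b' : φ.dual) :
    φ.pairing₂ (a ⊗ₜ a') (φ.dualT₂ (b ⊗ₜ b')) = b'.1 (φ.rightAction a b * a') := by
  obtain ⟨c, rfl⟩ := φ.rightEquiv.surjective b
  obtain ⟨e, rfl⟩ := φ.leftEquivS.surjective b'
  have h : φ.antipode (sliceLeft (φ.rightIntegral.toFun ∘ₗ LinearMap.mul ℂ A a) A
      (H.T₁ (c ⊗ₜ e))) = φ.antipode e * φ.rightAction a (φ.rightEquiv c) := by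
    rw [← sliceLeft_rTensor, H.mul_rTensor_T₁, sliceLeft_lTensor, LinearMap.flip_apply,
      LinearMap.mul_apply', antipode_mul, antipode_sliceLeft_T₂, rightAction_rightEquiv]
  rw [dualT₂_tmul, leftEquivS_apply, ← mul_assoc, ← h]
  clear h
  generalize H.T₁ (c ⊗ₜ e) = w
  induction w with
  | zero => simp
  | add x y hx hy => simp only [map_add, add_mul, hx, hy]
  | tmul r s => simp [smul_mul_assoc]

theorem pairing₂_dualT₃ (a a' : A) (b b' : φ.dual) :
    φ.pairing₂ (a ⊗ₜ a') (φ.dualT₃ (b ⊗ₜ b')) = b.1 (φ.leftAction b' a * a') := by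
  obtain ⟨f, rfl⟩ := φ.leftEquivS.surjective b
  obtain ⟨c, rfl⟩ := φ.leftEquiv.surjective b'
  have h : φ.antipode (sliceRight A (φ.toFun ∘ₗ (LinearMap.mul ℂ A).flip a) (H.T₃ (c ⊗ₜ f))) =
      φ.antipode f * φ.leftAction (φ.leftEquiv c) a := by
    rw [← sliceRight_lTensor, ← mulR_oneTmul_eq, H.T₃_mulR, ← H.T₁_mulR, mulR_tmulOne_eq,
      sliceRight_rTensor, LinearMap.flip_apply, LinearMap.mul_apply', antipode_mul,
      antipode_sliceRight_T₁, leftAction_leftEquiv]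
  rw [dualT₃_tmul, leftEquivS_apply, ← mul_assoc, ← h]
  clear h
  generalize H.T₃ (c ⊗ₜ f) = w
  induction w with
  | zero => simp
  | add x y hx hy => simp only [map_add, add_mul, hx, hy]
  | tmul r s => simp [smul_mul_assoc]

theorem pairing₂_dualT₄ (a a' : A) (b b' : φ.dual) :
    φ.pairing₂ (a ⊗ₜ a') (φ.dualT₄ (b ⊗ₜ b')) = b'.1 (a * φ.rightAction a' b) := by
  obtain ⟨c, rfl⟩ := φ.rightEquiv.surjective b
  obtain ⟨f, rfl⟩ := φ.rightEquivS.surjective b'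
  have h : φ.antipode (sliceLeft (φ.rightIntegral.toFun ∘ₗ LinearMap.mul ℂ A a') A
      (H.T₄ (f ⊗ₜ c))) = φ.rightAction a' (φ.rightEquiv c) * φ.antipode f := by
    rw [← sliceLeft_rTensor, ← mulL_tmulOne_eq, H.T₄_mulL, ← H.T₂_mulL, mulL_oneTmul_eq,
      sliceLeft_lTensor, LinearMap.mul_apply', antipode_mul, antipode_sliceLeft_T₂,
      rightAction_rightEquiv]
  rw [dualT₄_tmul, rightEquivS_apply, mul_assoc, ← h]
  clear h
  generalize H.T₄ (f ⊗ₜ c) = w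
  induction w with
  | zero => simp
  | add x y hx hy => simp only [map_add, mul_add, hx, hy]
  | tmul r s => simp [mul_comm, mul_smul_comm]

/-! ### The coproduct of the dual as a multiplier. -/

/-- The left action of the tensor square of the dual on `A ⊗ A`. -/
noncomputable def leftAction₂ : φ.dual ⊗[ℂ] φ.dual →ₗ[ℂ] A ⊗[ℂ] A →ₗ[ℂ] A ⊗[ℂ] A :=
  TensorProduct.homTensorHomMap (RingHom.id ℂ) A A A A ∘ₗ TensorProduct.map φ.leftAction φ.leftAction

/-- The right action of the tensor square of the dual on `A ⊗ A`. -/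
noncomputable def rightAction₂ : φ.dual ⊗[ℂ] φ.dual →ₗ[ℂ] A ⊗[ℂ] A →ₗ[ℂ] A ⊗[ℂ] A :=
  TensorProduct.homTensorHomMap (RingHom.id ℂ) A A A A ∘ₗ
    TensorProduct.map φ.rightAction.flip φ.rightAction.flip

@[simp] theorem leftAction₂_tmul (b b' : φ.dual) (a a' : A) :
    φ.leftAction₂ (b ⊗ₜ b') (a ⊗ₜ a') = φ.leftAction b a ⊗ₜ φ.leftAction b' a' := by
  simp [leftAction₂]

@[simp] theorem rightAction₂_tmul (b b' : φ.dual) (a a' : A) :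
    φ.rightAction₂ (b ⊗ₜ b') (a ⊗ₜ a') = φ.rightAction a b ⊗ₜ φ.rightAction a' b' := by
  simp [rightAction₂]

end LeftIntegral

namespace LeftIntegral

variable (φ : LeftIntegral H)

theorem pairing₂_mul_right (x : A ⊗[ℂ] A) (Y Z : φ.dual ⊗[ℂ] φ.dual) :
    φ.pairing₂ x (Y * Z) = φ.pairing₂ (φ.leftAction₂ Z x) Y := by
  induction x with
  | zero => simp
  | add x y hx hy => simp only [map_add, LinearMap.add_apply, hx, hy]
  | tmul a a' =>
    induction Y with
    | zero => simp
    | add x y hx hy => simp only [map_add, add_mul, hx, hy]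
    | tmul b b' =>
      induction Z with
      | zero => simp
      | add x y hx hy => simp only [map_add, LinearMap.add_apply, mul_add, hx, hy]
      | tmul c c' => simp [apply_leftAction]

theorem pairing₂_mul_left (x : A ⊗[ℂ] A) (Y Z : φ.dual ⊗[ℂ] φ.dual) :
    φ.pairing₂ x (Y * Z) = φ.pairing₂ (φ.rightAction₂ Y x) Z := by
  induction x with
  | zero => simp
  | add x y hx hy => simp only [map_add, LinearMap.add_apply, hx, hy]
  | tmul a a' =>
    induction Y with
    | zero => simp
    | add x y hx hy => simp only [map_add, LinearMap.add_apply, add_mul, hx, hy]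
    | tmul b b' =>
      induction Z with
      | zero => simp
      | add x y hx hy => simp only [map_add, mul_add, hx, hy]
      | tmul c c' => simp [apply_rightAction]

/-- The two actions are adjoint to right and left multiplication, so they commute by associativity.
This becomes the multiplier identity `(XΔ(b))Y = X(Δ(b)Y)`. -/
theorem leftAction₂_rightAction₂ (x : A ⊗[ℂ] A) (Y Z : φ.dual ⊗[ℂ] φ.dual) :
    φ.leftAction₂ Y (φ.rightAction₂ Z x) = φ.rightAction₂ Z (φ.leftAction₂ Y x) :=
  φ.pairing₂_ext_left fun b b' => by
    rw [← pairing₂_mul_right, ← pairing₂_mul_left, ← pairing₂_mul_left, ← pairing₂_mul_right,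
      mul_assoc]

theorem leftAction₂_mul (x : A ⊗[ℂ] A) (Y Z : φ.dual ⊗[ℂ] φ.dual) :
    φ.leftAction₂ (Y * Z) x = φ.leftAction₂ Y (φ.leftAction₂ Z x) :=
  φ.pairing₂_ext_left fun b b' => by
    rw [← pairing₂_mul_right, ← pairing₂_mul_right, ← pairing₂_mul_right, mul_assoc]

theorem rightAction₂_mul (x : A ⊗[ℂ] A) (Y Z : φ.dual ⊗[ℂ] φ.dual) :
    φ.rightAction₂ (Y * Z) x = φ.rightAction₂ Z (φ.rightAction₂ Y x) :=
  φ.pairing₂_ext_left fun b b' => by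
    rw [← pairing₂_mul_left, ← pairing₂_mul_left, ← pairing₂_mul_left, mul_assoc]

theorem pairing₂_dualT₁_apply (x : A ⊗[ℂ] A) (b b' : φ.dual) :
    φ.pairing₂ x (φ.dualT₁ (b ⊗ₜ b')) = φ.evalMul b ((φ.leftAction b').lTensor A x) := by
  induction x with
  | zero => simp
  | add x y hx hy => simp only [map_add, LinearMap.add_apply, hx, hy]
  | tmul a a' => rw [pairing₂_dualT₁]; rfl

theorem pairing₂_dualT₂_apply (x : A ⊗[ℂ] A) (b b' : φ.dual) :
    φ.pairing₂ x (φ.dualT₂ (b ⊗ₜ b')) = φ.evalMul b' ((φ.rightAction.flip b).rTensor A x) := by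
  induction x with
  | zero => simp
  | add x y hx hy => simp only [map_add, LinearMap.add_apply, hx, hy]
  | tmul a a' => rw [pairing₂_dualT₂]; rfl

theorem pairing₂_dualT₃_apply (x : A ⊗[ℂ] A) (b b' : φ.dual) :
    φ.pairing₂ x (φ.dualT₃ (b ⊗ₜ b')) = φ.evalMul b ((φ.leftAction b').rTensor A x) := by
  induction x with
  | zero => simp
  | add x y hx hy => simp only [map_add, LinearMap.add_apply, hx, hy]
  | tmul a a' => rw [pairing₂_dualT₃]; rfl

theorem pairing₂_dualT₄_apply (x : A ⊗[ℂ] A) (b b' : φ.dual) :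
    φ.pairing₂ x (φ.dualT₄ (b ⊗ₜ b')) = φ.evalMul b' ((φ.rightAction.flip b).lTensor A x) := by
  induction x with
  | zero => simp
  | add x y hx hy => simp only [map_add, LinearMap.add_apply, hx, hy]
  | tmul a a' => rw [pairing₂_dualT₄]; rfl

/-- Left multiplication by `Δ(b)`: the map `b' ⊗ b'' ↦ (Δ(b)(1 ⊗ b''))(b' ⊗ 1)`. -/
noncomputable def dualComulL (b : φ.dual) :
    φ.dual ⊗[ℂ] φ.dual →ₗ[ℂ] φ.dual ⊗[ℂ] φ.dual :=
  TensorProduct.lift (((LinearMap.rTensorHom φ.dual) ∘ₗ (LinearMap.mul ℂ φ.dual).flip).compl₂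
    (φ.dualT₁.toLinearMap ∘ₗ TensorProduct.mk ℂ φ.dual φ.dual b))

/-- Right multiplication by `Δ(b)`: the map `b' ⊗ b'' ↦ (1 ⊗ b'')((b' ⊗ 1)Δ(b))`. -/
noncomputable def dualComulR (b : φ.dual) :
    φ.dual ⊗[ℂ] φ.dual →ₗ[ℂ] φ.dual ⊗[ℂ] φ.dual :=
  TensorProduct.lift (((LinearMap.lTensorHom φ.dual) ∘ₗ (LinearMap.mul ℂ φ.dual)).compl₂
    (φ.dualT₂.toLinearMap ∘ₗ (TensorProduct.mk ℂ φ.dual φ.dual).flip b)).flip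

theorem dualComulL_tmul (b b' b'' : φ.dual) : φ.dualComulL b (b' ⊗ₜ b'') =
    ((LinearMap.mul ℂ φ.dual).flip b').rTensor φ.dual (φ.dualT₁ (b ⊗ₜ b'')) := by
  simp [dualComulL]

theorem dualComulR_tmul (b b' b'' : φ.dual) : φ.dualComulR b (b' ⊗ₜ b'') =
    (LinearMap.mul ℂ φ.dual b'').lTensor φ.dual (φ.dualT₂ (b' ⊗ₜ b)) := by
  simp [dualComulR]

theorem pairing₂_rTensor_mul_flip (b : φ.dual) (x : A ⊗[ℂ] A) (Z : φ.dual ⊗[ℂ] φ.dual) :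
    φ.pairing₂ x (((LinearMap.mul ℂ φ.dual).flip b).rTensor φ.dual Z) =
      φ.pairing₂ ((φ.leftAction b).rTensor A x) Z := by
  induction x with
  | zero => simp
  | add x y hx hy => simp only [map_add, LinearMap.add_apply, hx, hy]
  | tmul a a' =>
    induction Z with
    | zero => simp
    | add x y hx hy => simp only [map_add, hx, hy]
    | tmul c c' => simp [apply_leftAction]

theorem pairing₂_lTensor_mul (b : φ.dual) (x : A ⊗[ℂ] A) (Z : φ.dual ⊗[ℂ] φ.dual) :
    φ.pairing₂ x ((LinearMap.mul ℂ φ.dual b).lTensor φ.dual Z) =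
      φ.pairing₂ ((φ.rightAction.flip b).lTensor A x) Z := by
  induction x with
  | zero => simp
  | add x y hx hy => simp only [map_add, LinearMap.add_apply, hx, hy]
  | tmul a a' =>
    induction Z with
    | zero => simp
    | add x y hx hy => simp only [map_add, hx, hy]
    | tmul c c' => simp [apply_rightAction]

/-- Multiplication by `Δ(b)` is adjoint to acting on `A ⊗ A` and then multiplying in `A`. All
identities about `Δ(b)` are checked through this formula. -/
theorem pairing₂_dualComulL (b : φ.dual) (Y : φ.dual ⊗[ℂ] φ.dual) (x : A ⊗[ℂ] A) :
    φ.pairing₂ x (φ.dualComulL b Y) = φ.evalMul b (φ.leftAction₂ Y x) := by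
  induction Y with
  | zero => simp
  | add x y hx hy => simp only [map_add, LinearMap.add_apply, hx, hy]
  | tmul c c' =>
    rw [dualComulL_tmul, pairing₂_rTensor_mul_flip, pairing₂_dualT₁_apply]
    congr 1
    induction x with
    | zero => simp
    | add x y hx hy => simp only [map_add, hx, hy]
    | tmul a a' => simp

theorem pairing₂_dualComulR (b : φ.dual) (Y : φ.dual ⊗[ℂ] φ.dual) (x : A ⊗[ℂ] A) :
    φ.pairing₂ x (φ.dualComulR b Y) = φ.evalMul b (φ.rightAction₂ Y x) := by
  induction Y with
  | zero => simp
  | add x y hx hy => simp only [map_add, LinearMap.add_apply, hx, hy]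
  | tmul c c' =>
    rw [dualComulR_tmul, pairing₂_lTensor_mul, pairing₂_dualT₂_apply]
    congr 1
    induction x with
    | zero => simp
    | add x y hx hy => simp only [map_add, hx, hy]
    | tmul a a' => simp

/-- `Δ(b)`, as a multiplier. -/
noncomputable def dualComulMultiplier (b : φ.dual) : MultiplierAlgebra (φ.dual ⊗[ℂ] φ.dual) :=
  ⟨(φ.dualComulL b, MulOpposite.op (φ.dualComulR b)), by
    refine ⟨fun X Y => φ.pairing₂_ext_right fun a a' => ?_,
      fun X Y => φ.pairing₂_ext_right fun a a' => ?_,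
      fun X Y => φ.pairing₂_ext_right fun a a' => ?_⟩
    · simp only [MulOpposite.unop_op]
      rw [pairing₂_mul_right, pairing₂_dualComulR, pairing₂_mul_left, pairing₂_dualComulL,
        leftAction₂_rightAction₂]
    · rw [pairing₂_dualComulL, pairing₂_mul_right, pairing₂_dualComulL, leftAction₂_mul]
    · simp only [MulOpposite.unop_op]
      rw [pairing₂_dualComulR, pairing₂_mul_left, pairing₂_dualComulR, rightAction₂_mul]⟩

theorem mulL_dualComulMultiplier (b : φ.dual) :
    mulL (φ.dualComulMultiplier b) = φ.dualComulL b := rfl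

/-- If `b` annihilates the dual from the left, it vanishes on all `b' ▹ a`, and these span `A`. -/
theorem dual_nondegenerate_left (b : φ.dual) (h : ∀ b', b * b' = 0) : b = 0 := by
  refine φ.dual_ext fun x => ?_
  have hx : x ∈ Submodule.span ℂ {x : A | ∃ (b : φ.dual) (a : A), φ.leftAction b a = x} := by
    rw [span_leftAction]; trivial
  induction hx using Submodule.span_induction with
  | mem x hx =>
    obtain ⟨b', a, rfl⟩ := hx
    rw [apply_leftAction, h]
    rfl
  | zero => simp
  | add x y _ _ hx hy => rw [map_add, map_add, hx, hy]
  | smul r x _ hx => rw [map_smul, map_smul, hx]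

theorem dual_nondegenerate_right (b : φ.dual) (h : ∀ b', b' * b = 0) : b = 0 := by
  refine φ.dual_ext fun x => ?_
  have hx : x ∈ Submodule.span ℂ {x : A | ∃ (b : φ.dual) (a : A), φ.rightAction a b = x} := by
    rw [span_rightAction]; trivial
  induction hx using Submodule.span_induction with
  | mem x hx =>
    obtain ⟨b', a, rfl⟩ := hx
    rw [apply_rightAction, h]
    rfl
  | zero => simp
  | add x y _ _ hx hy => rw [map_add, map_add, hx, hy]
  | smul r x _ hx => rw [map_smul, map_smul, hx]

end LeftIntegral

/-! ### Multipliers over a non-degenerate algebra. -/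

section Nondegenerate

variable {B : Type*} [NonUnitalRing B] [Module ℂ B] [SMulCommClass ℂ B B] [IsScalarTower ℂ B B]

theorem tensor_eq_of_mul_right (hl : ∀ b : B, (∀ b', b * b' = 0) → b = 0) {x y : B ⊗[ℂ] B}
    (h : ∀ z, x * z = y * z) : x = y := by
  refine eq_of_lTensor (LinearMap.mul ℂ B).flip hl fun b => ?_
  refine eq_of_rTensor (LinearMap.mul ℂ B).flip hl fun a => ?_
  have key : ∀ w : B ⊗[ℂ] B, ((LinearMap.mul ℂ B).flip a).rTensor B
      (((LinearMap.mul ℂ B).flip b).lTensor B w) = w * (a ⊗ₜ b) := by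
    intro w
    induction w with
    | zero => simp
    | add x y hx hy => simp only [map_add, add_mul, hx, hy]
    | tmul u v => simp
  rw [key, key, h]

theorem tensor_eq_of_mul_left (hr : ∀ b : B, (∀ b', b' * b = 0) → b = 0) {x y : B ⊗[ℂ] B}
    (h : ∀ z, z * x = z * y) : x = y := by
  refine eq_of_lTensor (LinearMap.mul ℂ B) hr fun b => ?_
  refine eq_of_rTensor (LinearMap.mul ℂ B) hr fun a => ?_
  have key : ∀ w : B ⊗[ℂ] B, (LinearMap.mul ℂ B a).rTensor B
      ((LinearMap.mul ℂ B b).lTensor B w) = (a ⊗ₜ b) * w := by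
    intro w
    induction w with
    | zero => simp
    | add x y hx hy => simp only [map_add, mul_add, hx, hy]
    | tmul u v => simp
  rw [key, key, h]

/-- One half of a multiplier determines the other, because `(xm)z = x(mz)` and `z` can be cancelled.
-/
theorem multiplier_ext_mulL (hl : ∀ b : B, (∀ b', b * b' = 0) → b = 0)
    {m n : MultiplierAlgebra (B ⊗[ℂ] B)} (h : ∀ x, mulL m x = mulL n x) : m = n :=
  multiplier_ext h fun x => tensor_eq_of_mul_right hl fun z => by
    rw [mulR_mul_eq, mulR_mul_eq, h]

theorem multiplier_ext_mulR (hr : ∀ b : B, (∀ b', b' * b = 0) → b = 0)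
    {m n : MultiplierAlgebra (B ⊗[ℂ] B)} (h : ∀ x, mulR m x = mulR n x) : m = n :=
  multiplier_ext (fun x => tensor_eq_of_mul_left hr fun z => by
    rw [← mulR_mul_eq, ← mulR_mul_eq, h]) h

end Nondegenerate

/-! ### Multiplicativity and coassociativity of the coproduct of the dual. -/

namespace LeftIntegral

variable (φ : LeftIntegral H)

theorem T₁_tmul_mul (H : RegularMultiplierHopfAlgebra A) (a b c : A) :
    H.T₁ (a ⊗ₜ (b * c)) = ((LinearMap.mul ℂ A).flip c).lTensor A (H.T₁ (a ⊗ₜ b)) := by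
  have h : oneTmul (b * c) = oneTmul b * oneTmul c := by
    refine multiplier_ext (fun x => ?_) (fun x => ?_) <;>
    · induction x with
      | zero => simp
      | add x y hx hy => simp only [map_add, hx, hy]
      | tmul u v => simp [mul_assoc]
  apply H.toMultiplier_injective
  rw [← mulR_oneTmul_eq, toMultiplier_mulR_apply, H.T₁_spec, H.T₁_spec, h, mul_assoc]

/-- For `b = φ(· c)` both sides are `(φ ⊗ φ)(Δ(a)(c ⊗ a'd))`. This is the duality between the
product of the dual and the coproduct of `A`. -/
theorem pairing₂_T₁ (a a' d : A) (b : φ.dual) :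
    φ.pairing₂ (H.T₁ (a ⊗ₜ a')) (b ⊗ₜ φ.elem d) = (b * φ.elem (a' * d)).1 a := by
  obtain ⟨c, rfl⟩ := φ.elemEquiv.surjective b
  rw [elemEquiv_apply, elem_mul_elem_apply, ← H.T₁_mulR, mulR_tmulOne_eq, T₁_tmul_mul]
  generalize H.T₁ (a ⊗ₜ a') = w
  induction w with
  | zero => simp
  | add x y hx hy => simp only [map_add, LinearMap.add_apply, hx, hy]
  | tmul r s => simp [mul_comm]

/-- If `x = ∑ rᵢ ⊗ sᵢ` is `(e ⊗ 1)Δ(c)`, then `Δ(φ(c ·) ▹ a)(1 ⊗ S(e)) = ∑ (φ(sᵢ ·) ▹ a) ⊗ S(rᵢ)`. -/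
theorem T₁_leftAction (e c a : A) :
    H.T₁ (φ.leftAction (φ.leftEquiv c) a ⊗ₜ φ.antipode e) =
      TensorProduct.map (φ.leftAction.flip a ∘ₗ φ.leftEquiv.toLinearMap) φ.antipode.toLinearMap
        (TensorProduct.comm ℂ A A (H.T₂ (e ⊗ₜ c))) := by
  refine φ.pairing₂_ext_left fun g h => ?_
  obtain ⟨d, rfl⟩ := φ.elemEquiv.surjective h
  -- The left and right actions of the dual commute, so pairing the first leg with `g` only replaces
  -- `a` by `a ◃ g`.
  have h₁ : φ.pairing₂ (H.T₁ (φ.leftAction (φ.leftEquiv c) a ⊗ₜ φ.antipode e))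
      (g ⊗ₜ φ.elemEquiv d) =
      (φ.elemEquiv d).1 (φ.leftAction (φ.leftEquiv c) (φ.rightAction a g) * φ.antipode e) := by
    rw [elemEquiv_apply, pairing₂_T₁, apply_leftAction, mul_assoc, ← apply_rightAction, ← apply_leftAction, coe_elem,
      coe_elem, mul_assoc]
  rw [h₁, ← antipode_sliceRight_mul_T₂]
  generalize H.T₂ (e ⊗ₜ c) = w
  induction w with
  | zero => simp
  | add x y hx hy => simp only [map_add, LinearMap.add_apply, hx, hy]
  | tmul r s =>
    simp [apply_leftAction, ← apply_rightAction]

/-- `b ▹ (a a') = m(Δ(b) ▹ (a ⊗ a'))` -/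
theorem leftAction_mul'_eq (b : φ.dual) (Y : φ.dual ⊗[ℂ] φ.dual) (x : A ⊗[ℂ] A) :
    LinearMap.mul' ℂ A (φ.leftAction₂ (φ.dualComulL b Y) x) =
      φ.leftAction b (LinearMap.mul' ℂ A (φ.leftAction₂ Y x)) := by
  -- The case of `Δ(b)(1 ⊗ b₂)`, where `b ▹ (uy)` with `y = b₂ ▹ a` is a slice of `Δ(u)Δ(y)(1 ⊗
  -- S(e))`. This is where the multiplicativity of the coproduct of `A` enters, and `T₁_leftAction`
  -- expands the rest.
  have key : ∀ (b b₂ : φ.dual) (u a : A),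
      LinearMap.mul' ℂ A (φ.leftAction₂ (φ.dualT₁ (b ⊗ₜ b₂)) (u ⊗ₜ a)) =
        φ.leftAction b (u * φ.leftAction b₂ a) := by
    intro b b₂ u a
    obtain ⟨e, rfl⟩ := φ.rightEquivS.surjective b
    obtain ⟨c, rfl⟩ := φ.leftEquiv.surjective b₂
    rw [φ.leftAction_eq_of_right (f := φ.rightIntegral.toFun) (e := φ.antipode e) fun x => rfl,
      ← H.comul_mulL_T₁, T₁_leftAction, dualT₁_tmul]
    generalize H.T₂ (e ⊗ₜ c) = w
    induction w with
    | zero => simp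
    | add x y hx hy => simp only [map_add, LinearMap.add_apply, hx, hy]
    | tmul r s =>
      simp only [TensorProduct.congr_tmul, leftAction₂_tmul, LinearMap.mul'_apply,
        TensorProduct.comm_tmul, TensorProduct.map_tmul, ← H.T₁_mulR, mulR_tmulOne_eq,
        sliceRight_rTensor, LinearEquiv.coe_coe]
      rw [φ.leftAction_eq_of_right (b := φ.rightEquivS r) (f := φ.rightIntegral.toFun)
        (e := φ.antipode r) fun x => rfl]
      rfl
  induction x with
  | zero => simp
  | add x y hx hy => simp only [map_add, hx, hy]
  | tmul a a' =>
    induction Y with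
    | zero => simp
    | add x y hx hy => simp only [map_add, LinearMap.add_apply, hx, hy]
    | tmul b₁ b₂ =>
      rw [leftAction₂_tmul, LinearMap.mul'_apply, ← key, dualComulL_tmul]
      congr 1
      generalize φ.dualT₁ (b ⊗ₜ b₂) = Z
      induction Z with
      | zero => simp
      | add x y hx hy => simp only [map_add, LinearMap.add_apply, hx, hy]
      | tmul c c' => simp [leftAction_dual_mul]

/-- The coproduct of the dual. -/
noncomputable def dualComul : φ.dual →ₙₐ[ℂ] MultiplierAlgebra (φ.dual ⊗[ℂ] φ.dual) where
  toFun := φ.dualComulMultiplier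
  map_smul' r b := multiplier_ext_mulL φ.dual_nondegenerate_left fun Y =>
    φ.pairing₂_ext_right fun a a' => by
      change _ = φ.pairing₂ _ (r • φ.dualComulL b Y)
      rw [mulL_dualComulMultiplier, map_smul, pairing₂_dualComulL, pairing₂_dualComulL]
      rfl
  map_zero' := multiplier_ext_mulL φ.dual_nondegenerate_left fun Y =>
    φ.pairing₂_ext_right fun a a' => by
      change _ = φ.pairing₂ _ 0
      rw [mulL_dualComulMultiplier, map_zero, pairing₂_dualComulL]
      rfl
  map_add' b b' := multiplier_ext_mulL φ.dual_nondegenerate_left fun Y =>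
    φ.pairing₂_ext_right fun a a' => by
      change _ = φ.pairing₂ _ (φ.dualComulL b Y + φ.dualComulL b' Y)
      rw [mulL_dualComulMultiplier, map_add, pairing₂_dualComulL, pairing₂_dualComulL,
        pairing₂_dualComulL]
      rfl
  map_mul' b b' := multiplier_ext_mulL φ.dual_nondegenerate_left fun Y =>
    φ.pairing₂_ext_right fun a a' => by
      rw [mulL_mul_apply]
      simp only [mulL_dualComulMultiplier]
      rw [pairing₂_dualComulL, pairing₂_dualComulL, evalMul_apply, evalMul_apply,
        leftAction_mul'_eq, apply_leftAction]

theorem dualT₁_spec (b b' : φ.dual) : toMultiplier (φ.dual ⊗[ℂ] φ.dual) (φ.dualT₁ (b ⊗ₜ b')) =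
    φ.dualComul b * oneTmul b' :=
  multiplier_ext_mulL φ.dual_nondegenerate_left fun Y => φ.pairing₂_ext_right fun a a' => by
    change φ.pairing₂ _ (φ.dualT₁ (b ⊗ₜ b') * Y) =
      φ.pairing₂ _ (φ.dualComulL b (mulL (oneTmul b') Y))
    rw [pairing₂_mul_right, pairing₂_dualT₁_apply, pairing₂_dualComulL]
    congr 1
    induction Y with
    | zero => simp
    | add x y hx hy => simp only [map_add, LinearMap.add_apply, hx, hy]
    | tmul c c' => simp [leftAction_dual_mul]

theorem dualT₂_spec (b b' : φ.dual) : toMultiplier (φ.dual ⊗[ℂ] φ.dual) (φ.dualT₂ (b ⊗ₜ b')) =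
    tmulOne b * φ.dualComul b' :=
  multiplier_ext_mulR φ.dual_nondegenerate_right fun Y => φ.pairing₂_ext_right fun a a' => by
    change φ.pairing₂ _ (Y * φ.dualT₂ (b ⊗ₜ b')) =
      φ.pairing₂ _ (φ.dualComulR b' (mulR (tmulOne b) Y))
    rw [pairing₂_mul_left, pairing₂_dualT₂_apply, pairing₂_dualComulR]
    congr 1
    induction Y with
    | zero => simp
    | add x y hx hy => simp only [map_add, LinearMap.add_apply, hx, hy]
    | tmul c c' => simp [rightAction_dual_mul]

theorem dualT₃_spec (b b' : φ.dual) : toMultiplier (φ.dual ⊗[ℂ] φ.dual) (φ.dualT₃ (b ⊗ₜ b')) =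
    φ.dualComul b * tmulOne b' :=
  multiplier_ext_mulL φ.dual_nondegenerate_left fun Y => φ.pairing₂_ext_right fun a a' => by
    change φ.pairing₂ _ (φ.dualT₃ (b ⊗ₜ b') * Y) =
      φ.pairing₂ _ (φ.dualComulL b (mulL (tmulOne b') Y))
    rw [pairing₂_mul_right, pairing₂_dualT₃_apply, pairing₂_dualComulL]
    congr 1
    induction Y with
    | zero => simp
    | add x y hx hy => simp only [map_add, LinearMap.add_apply, hx, hy]
    | tmul c c' => simp [leftAction_dual_mul]

theorem dualT₄_spec (b b' : φ.dual) : toMultiplier (φ.dual ⊗[ℂ] φ.dual) (φ.dualT₄ (b ⊗ₜ b')) =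
    oneTmul b * φ.dualComul b' :=
  multiplier_ext_mulR φ.dual_nondegenerate_right fun Y => φ.pairing₂_ext_right fun a a' => by
    change φ.pairing₂ _ (Y * φ.dualT₄ (b ⊗ₜ b')) =
      φ.pairing₂ _ (φ.dualComulR b' (mulR (oneTmul b) Y))
    rw [pairing₂_mul_left, pairing₂_dualT₄_apply, pairing₂_dualComulR]
    congr 1
    induction Y with
    | zero => simp
    | add x y hx hy => simp only [map_add, LinearMap.add_apply, hx, hy]
    | tmul c c' => simp [rightAction_dual_mul]

/-- Paired with `a ⊗ a' ⊗ a''`, both sides are `b₂((a ◃ b₁)a'(b₃ ▹ a''))`, up to the position of the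
parentheses in `A`. -/
theorem dual_coassoc (b₁ b₂ b₃ : φ.dual) :
    φ.dualT₂.toLinearMap.rTensor φ.dual
      ((TensorProduct.assoc ℂ φ.dual φ.dual φ.dual).symm (b₁ ⊗ₜ φ.dualT₁ (b₂ ⊗ₜ b₃))) =
    (TensorProduct.assoc ℂ φ.dual φ.dual φ.dual).symm (φ.dualT₁.toLinearMap.lTensor φ.dual
      (TensorProduct.assoc ℂ φ.dual φ.dual φ.dual (φ.dualT₂ (b₁ ⊗ₜ b₂) ⊗ₜ b₃))) := by
  have h₁ : ∀ (a a' a'' : A) (Y : φ.dual ⊗[ℂ] φ.dual),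
      tensorPairing φ.pairing₂ φ.pairing ((a ⊗ₜ a') ⊗ₜ a'')
        (φ.dualT₂.toLinearMap.rTensor φ.dual
          ((TensorProduct.assoc ℂ φ.dual φ.dual φ.dual).symm (b₁ ⊗ₜ Y))) =
      φ.pairing₂ ((φ.rightAction a b₁ * a') ⊗ₜ a'') Y := by
    intro a a' a'' Y
    induction Y with
    | zero => simp
    | add x y hx hy => simp only [map_add, TensorProduct.tmul_add, hx, hy]
    | tmul p q => simp [pairing₂_dualT₂]
  have h₂ : ∀ (a a' a'' : A) (Y : φ.dual ⊗[ℂ] φ.dual),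
      tensorPairing φ.pairing₂ φ.pairing ((a ⊗ₜ a') ⊗ₜ a'')
        ((TensorProduct.assoc ℂ φ.dual φ.dual φ.dual).symm (φ.dualT₁.toLinearMap.lTensor φ.dual
          (TensorProduct.assoc ℂ φ.dual φ.dual φ.dual (Y ⊗ₜ b₃)))) =
      φ.pairing₂ (a ⊗ₜ (a' * φ.leftAction b₃ a'')) Y := by
    have h₃ : ∀ (a a' a'' : A) (p : φ.dual) (Z : φ.dual ⊗[ℂ] φ.dual),
        tensorPairing φ.pairing₂ φ.pairing ((a ⊗ₜ a') ⊗ₜ a'')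
          ((TensorProduct.assoc ℂ φ.dual φ.dual φ.dual).symm (p ⊗ₜ Z)) =
        p.1 a * φ.pairing₂ (a' ⊗ₜ a'') Z := by
      intro a a' a'' p Z
      induction Z with
      | zero => simp
      | add x y hx hy => simp only [map_add, TensorProduct.tmul_add, hx, hy, mul_add]
      | tmul q r => simp [mul_assoc]
    intro a a' a'' Y
    induction Y with
    | zero => simp
    | add x y hx hy => simp only [map_add, TensorProduct.add_tmul, hx, hy]
    | tmul p q =>
      rw [TensorProduct.assoc_tmul, LinearMap.lTensor_tmul, h₃, LinearEquiv.coe_coe,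
        pairing₂_dualT₁, pairing₂_tmul]
  refine tensorPairing_ext_right (P := φ.pairing₂) (Q := φ.pairing) (fun Y hY => ?_)
    φ.pairing_right_nondegenerate fun x a'' => ?_
  · exact φ.pairing₂_ext_right fun a a' => by rw [hY, map_zero]
  · induction x with
    | zero => simp
    | add x y hx hy => simp only [TensorProduct.add_tmul, map_add, LinearMap.add_apply, hx, hy]
    | tmul a a' => rw [h₁, h₂, pairing₂_dualT₁, pairing₂_dualT₂, mul_assoc]

/-- The dual, as a regular multiplier Hopf algebra. -/
noncomputable def dualHopf : RegularMultiplierHopfAlgebra φ.dual where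
  nondegenerate_left := φ.dual_nondegenerate_left
  nondegenerate_right := φ.dual_nondegenerate_right
  comul := φ.dualComul
  T₁ := φ.dualT₁
  T₂ := φ.dualT₂
  T₃ := φ.dualT₃
  T₄ := φ.dualT₄
  T₁_spec := φ.dualT₁_spec
  T₂_spec := φ.dualT₂_spec
  T₃_spec := φ.dualT₃_spec
  T₄_spec := φ.dualT₄_spec
  coassoc := φ.dual_coassoc

end LeftIntegral

/-! ### Uniqueness of a structure with given `T₂`. -/

namespace RegularMultiplierHopfAlgebra

theorem mul'_surjective [Nontrivial A] (H : RegularMultiplierHopfAlgebra A) :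
    Function.Surjective (LinearMap.mul' ℂ A) :=
  H.canonicalMaps.mulMap_surjective

/-- The structure is determined by the canonical map `T₂`. -/
theorem ext_T₂ {H K : RegularMultiplierHopfAlgebra A} (h : H.T₂ = K.T₂) : H = K := by
  -- Since `(p ⊗ r)Δ(a) = (1 ⊗ r)T₂(p ⊗ a)`, the map `T₂` determines right multiplication by `Δ(a)`,
  -- hence `Δ`, hence the other canonical maps.
  have hR : ∀ (a : A) (x : A ⊗[ℂ] A), mulR (H.comul a) x = mulR (K.comul a) x := by
    intro a x
    refine eq_of_lTensor (LinearMap.mul ℂ A) H.nondegenerate_right fun q => ?_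
    have key : ∀ (G : RegularMultiplierHopfAlgebra A) (y : A ⊗[ℂ] A),
        (LinearMap.mul ℂ A q).lTensor A (mulR (G.comul a) y) =
          mulR (G.comul a) ((LinearMap.mul ℂ A q).lTensor A y) := by
      intro G y
      apply G.toMultiplier_injective
      rw [← mulL_oneTmul_eq, toMultiplier_mulL_apply, toMultiplier_mulR_apply,
        toMultiplier_mulR_apply, toMultiplier_mulL_apply, mul_assoc]
    rw [key, key]
    induction x with
    | zero => simp
    | add x y hx hy => simp only [map_add, hx, hy]
    | tmul p r =>
      rw [LinearMap.lTensor_tmul, ← H.T₂_mulL, ← K.T₂_mulL, h]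
  have hcomul : H.comul = K.comul := by
    ext a : 1
    exact multiplier_ext_mulR H.nondegenerate_right (hR a)
  have h₁ : H.T₁ = K.T₁ := LinearEquiv.toLinearMap_injective (TensorProduct.ext' fun a b =>
    H.toMultiplier_injective ((H.T₁_spec a b).trans (hcomul ▸ (K.T₁_spec a b).symm)))
  have h₃ : H.T₃ = K.T₃ := LinearEquiv.toLinearMap_injective (TensorProduct.ext' fun a b =>
    H.toMultiplier_injective ((H.T₃_spec a b).trans (hcomul ▸ (K.T₃_spec a b).symm)))
  have h₄ : H.T₄ = K.T₄ := LinearEquiv.toLinearMap_injective (TensorProduct.ext' fun a b =>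
    H.toMultiplier_injective ((H.T₄_spec a b).trans (hcomul ▸ (K.T₄_spec a b).symm)))
  cases H
  cases K
  simp only at h h₁ h₃ h₄ hcomul
  subst h h₁ h₃ h₄ hcomul
  rfl

end RegularMultiplierHopfAlgebra

/-! ### The pairing of `A` with its dual. -/

namespace LeftIntegral

variable (φ : LeftIntegral H)

/-- The counit of `A`, as a homomorphism. -/
noncomputable def counitHom : A →ₙₐ[ℂ] ℂ where
  toFun := φ.counit
  map_smul' r a := by simp
  map_zero' := map_zero _
  map_add' := map_add _
  map_mul' := φ.isCounit.map_mul

theorem isCounit_counitHom : H.IsCounit φ.counitHom where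
  left a b := φ.isCounit.T₁ (a ⊗ₜ b)
  right a b := φ.isCounit.T₂ (a ⊗ₜ b)

theorem isAntipode_antipode : H.IsAntipode φ.counitHom φ.antipode.toLinearMap where
  left a b := (φ.isAntipode.T₁ (a ⊗ₜ b)).trans (sliceLeft_tmul _ _ _)
  right a b := (φ.isAntipode.T₂ (a ⊗ₜ b)).trans (sliceRight_tmul _ _ _)

/-- The left action `a ▹ φ(· c) = φ(· ac)` of `A` on the dual. -/
noncomputable def leftActionDual : A →ₗ[ℂ] φ.dual →ₗ[ℂ] φ.dual :=
  ((LinearMap.mul ℂ A).compl₂ φ.elemEquiv.symm.toLinearMap).compr₂ φ.elemEquiv.toLinearMap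

/-- The right action `φ(· c) ◃ a = φ(· cσ(a))` of `A` on the dual. -/
noncomputable def rightActionDual : φ.dual →ₗ[ℂ] A →ₗ[ℂ] φ.dual :=
  (((LinearMap.mul ℂ A) ∘ₗ φ.elemEquiv.symm.toLinearMap).compl₂
    (φ.modular : A →ₗ[ℂ] A)).compr₂ φ.elemEquiv.toLinearMap

theorem leftActionDual_elem (a c : A) : φ.leftActionDual a (φ.elem c) = φ.elem (a * c) := by
  simp [leftActionDual]

theorem rightActionDual_elem (a c : A) :
    φ.rightActionDual (φ.elem c) a = φ.elem (c * φ.modular a) := by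
  simp [rightActionDual]

theorem leftActionDual_apply (a x : A) (b : φ.dual) :
    (φ.leftActionDual a b).1 x = b.1 (x * a) := by
  obtain ⟨c, rfl⟩ := φ.elemEquiv.surjective b
  rw [elemEquiv_apply, leftActionDual_elem, coe_elem, coe_elem, mul_assoc]

theorem rightActionDual_apply (a x : A) (b : φ.dual) :
    (φ.rightActionDual b a).1 x = b.1 (a * x) := by
  obtain ⟨c, rfl⟩ := φ.elemEquiv.surjective b
  rw [elemEquiv_apply, rightActionDual_elem, coe_elem, coe_elem, ← mul_assoc, apply_mul_modular,
    mul_assoc]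

theorem span_leftActionDual :
    Submodule.span ℂ {y : φ.dual | ∃ (a : A) (b : φ.dual), φ.leftActionDual a b = y} = ⊤ := by
  have := φ.nontrivial_of_leftIntegral
  refine (Submodule.eq_top_iff').mpr fun y => ?_
  obtain ⟨c, rfl⟩ := φ.elemEquiv.surjective y
  obtain ⟨w, rfl⟩ := H.mul'_surjective c
  induction w with
  | zero =>
    rw [map_zero, map_zero]
    exact zero_mem _
  | add x y hx hy =>
    rw [map_add, map_add]
    exact add_mem hx hy
  | tmul a c => exact Submodule.subset_span ⟨a, φ.elem c, φ.leftActionDual_elem a c⟩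

/-- As `φ(· c) ◃ a = φ(· cσ(a))`, this combines the fact that products span `A` with the
surjectivity of `σ`. -/
theorem span_rightActionDual :
    Submodule.span ℂ {y : φ.dual | ∃ (a : A) (b : φ.dual), φ.rightActionDual b a = y} = ⊤ := by
  have := φ.nontrivial_of_leftIntegral
  refine (Submodule.eq_top_iff').mpr fun y => ?_
  obtain ⟨c, rfl⟩ := φ.elemEquiv.surjective y
  obtain ⟨w, rfl⟩ := H.mul'_surjective c
  induction w with
  | zero =>
    rw [map_zero, map_zero]
    exact zero_mem _
  | add x y hx hy =>
    rw [map_add, map_add]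
    exact add_mem hx hy
  | tmul c a =>
    obtain ⟨a, rfl⟩ := φ.modular_bijective.surjective a
    exact Submodule.subset_span ⟨a, φ.elem c, φ.rightActionDual_elem a c⟩

/-- The twist `a ⊗ b ↦ ∑ ⟨a₍₂₎, b₍₁₎⟩ a₍₁₎ ⊗ b₍₂₎`; it maps `a ⊗ φ(e ·)` to
`∑ a₍₁₎ ⊗ φ(e a₍₂₎ ·)`. -/
noncomputable def twist : A ⊗[ℂ] φ.dual ≃ₗ[ℂ] A ⊗[ℂ] φ.dual :=
  (TensorProduct.congr (LinearEquiv.refl ℂ A) φ.leftEquiv).symm.trans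
    ((TensorProduct.comm ℂ A A).trans (H.T₄.trans
      (TensorProduct.congr (LinearEquiv.refl ℂ A) φ.leftEquiv)))

theorem twist_tmul (a e : A) : φ.twist (a ⊗ₜ φ.leftEquiv e) =
    TensorProduct.congr (LinearEquiv.refl ℂ A) φ.leftEquiv (H.T₄ (e ⊗ₜ a)) := by
  have h : a ⊗ₜ[ℂ] φ.leftEquiv e =
      TensorProduct.congr (LinearEquiv.refl ℂ A) φ.leftEquiv (a ⊗ₜ e) := rfl
  rw [h, twist, LinearEquiv.trans_apply, LinearEquiv.symm_apply_apply]
  rfl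

/-- The value is the one that `pairing₂_dualT₂` gives for `⟨a ⊗ a', (b' ⊗ 1)Δ(b)⟩`, so the twist
satisfies the condition on `R`; it is bijective because it is a conjugate of `T₄`. -/
theorem pairing_twist (a a' : A) (b b' : φ.dual) :
    tensorPairing φ.pairing φ.pairing.flip (φ.twist (a ⊗ₜ b)) (b' ⊗ₜ a') =
      b.1 (φ.rightAction a b' * a') := by
  obtain ⟨e, rfl⟩ := φ.leftEquiv.surjective b
  obtain ⟨c, rfl⟩ := φ.elemEquiv.surjective b'
  have h : e * φ.rightAction a (φ.elemEquiv c) =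
      sliceLeft (φ.elemEquiv c).1 A (H.T₄ (e ⊗ₜ a)) := by
    rw [elemEquiv_apply, rightAction_elem, ← LinearMap.mul_apply' (R := ℂ), ← sliceLeft_lTensor,
      H.mul_lTensor_T₃, sliceLeft_rTensor]
    rfl
  rw [leftEquiv_apply, ← mul_assoc, h, twist_tmul]
  generalize H.T₄ (e ⊗ₜ a) = w
  induction w with
  | zero => simp
  | add x y hx hy => simp only [map_add, LinearMap.add_apply, add_mul, hx, hy]
  | tmul r s => simp [smul_mul_assoc]

/-- The pairing of `A` with its dual. -/
noncomputable def dualPairing : Pairing H φ.dualHopf where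
  form := φ.pairing
  nondegenerate_left := φ.pairing_left_nondegenerate
  nondegenerate_right := φ.pairing_right_nondegenerate
  leftAB := φ.leftActionDual
  rightAB := φ.rightActionDual
  leftBA := φ.leftAction
  rightBA := φ.rightAction
  leftAB_mul a a' b := φ.dual_ext fun x => by simp only [leftActionDual_apply, mul_assoc]
  rightAB_mul a a' b := φ.dual_ext fun x => by simp only [rightActionDual_apply, mul_assoc]
  leftBA_mul := φ.leftAction_dual_mul
  rightBA_mul := φ.rightAction_dual_mul
  form_leftAB a a' b := φ.leftActionDual_apply a a' b
  form_rightAB a a' b := φ.rightActionDual_apply a a' b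
  form_leftBA := φ.apply_leftAction
  form_rightBA := φ.apply_rightAction
  leftAB_unital := φ.span_leftActionDual
  rightAB_unital := φ.span_rightActionDual
  leftBA_unital := φ.span_leftAction
  rightBA_unital := φ.span_rightAction
  form_mul_right a a' b b' := by
    obtain ⟨d, rfl⟩ := φ.elemEquiv.surjective b'
    rw [elemEquiv_apply, leftActionDual_elem]
    exact φ.pairing₂_T₁ a a' d b
  form_mul_left a a' b b' := φ.pairing₂_dualT₂ a a' b b'
  R := φ.twist
  form_R a a' b b' := (φ.pairing_twist a a' b b').trans (φ.pairing₂_dualT₂ a a' b' b).symm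

/-- The Hopf structure of the dual is determined by the pairing. -/
theorem eq_dualHopf {K : RegularMultiplierHopfAlgebra φ.dual} (P : Pairing H K)
    (h : P.form = φ.pairing) : K = φ.dualHopf := by
  refine RegularMultiplierHopfAlgebra.ext_T₂ (LinearEquiv.toLinearMap_injective
    (TensorProduct.ext' fun b b' => φ.pairing₂_ext_right fun a a' => ?_))
  -- The dual separates the points of `A`, so the form fixes the right action; `form_mul_left` then
  -- fixes `T₂`.
  have hP : P.rightBA a b = φ.rightAction a b := φ.eq_of_dual_apply fun c => by
    have := P.form_rightBA a b c
    rw [h] at this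
    exact this.trans (φ.apply_rightAction a b c).symm
  have h₁ := P.form_mul_left a a' b b'
  rw [hP, h] at h₁
  exact h₁.trans (φ.pairing₂_dualT₂ a a' b b').symm

end LeftIntegral

end MultiplierHopf

/-- For a regular multiplier Hopf algebra `A` with a left integral `φ`, the canonical form
`⟨a, φ(· c)⟩ = φ(ac)` on `A × Â` is a pairing of regular multiplier Hopf algebras, with explicit
formulas for the four actions. -/
theorem mainTheorem11 {A : Type*} [NonUnitalRing A] [Module ℂ A] [SMulCommClass ℂ A A]
    [IsScalarTower ℂ A A] (H : MultiplierHopf.RegularMultiplierHopfAlgebra A)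
    (φ : MultiplierHopf.LeftIntegral H) :
    -- every element of the dual is `φ(· c)` for a unique `c`, so the form is well defined
    (∀ b : φ.dual, ∃! c : A, b = φ.elem c) ∧
    -- counit, antipode, modular automorphism of `φ`, and the right integral `φ ∘ S`
    ∃ (ε : A →ₙₐ[ℂ] ℂ) (S : A ≃ₗ[ℂ] A) (σ : A →ₙₐ[ℂ] A),
      H.IsCounit ε ∧ H.IsAntipode ε S.toLinearMap ∧
      (Function.Bijective σ ∧ ∀ a b : A, φ.toFun (a * b) = φ.toFun (b * σ a)) ∧
      (∃ ψ : MultiplierHopf.RightIntegral H, ∀ a : A, ψ.toFun a = φ.toFun (S a)) ∧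
      -- the dual is a regular multiplier Hopf algebra and the form is a pairing
      ∃! K : MultiplierHopf.RegularMultiplierHopfAlgebra φ.dual,
        ∃ P : MultiplierHopf.Pairing H K,
          P.form = φ.pairing ∧
          -- the actions of `A` on the dual
          (∀ a c : A, P.leftAB a (φ.elem c) = φ.elem (a * c)) ∧
          (∀ a c : A, P.rightAB (φ.elem c) a = φ.elem (c * σ a)) ∧
          -- the left action of the dual on `A`: its elements are the functionals `φ(c ·)`
          (∀ c : A, ∃ b : φ.dual, ∀ x : A, b.1 x = φ.toFun (c * x)) ∧
          (∀ b : φ.dual, ∃ c : A, ∀ x : A, b.1 x = φ.toFun (c * x)) ∧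
          (∀ (b : φ.dual) (c : A), (∀ x : A, b.1 x = φ.toFun (c * x)) → ∀ a : A,
            P.leftBA b a = S (MultiplierHopf.sliceRight A φ.toFun (H.T₁ (c ⊗ₜ a)))) ∧
          -- the right action of the dual on `A`: its elements are the functionals `ψ(· c)`
          ∀ ψ : MultiplierHopf.RightIntegral H,
            (∀ c : A, ∃ b : φ.dual, ∀ x : A, b.1 x = ψ.toFun (x * c)) ∧
            (∀ b : φ.dual, ∃ c : A, ∀ x : A, b.1 x = ψ.toFun (x * c)) ∧
            (∀ (b : φ.dual) (c : A), (∀ x : A, b.1 x = ψ.toFun (x * c)) → ∀ a : A,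
              P.rightBA a b = S (MultiplierHopf.sliceLeft ψ.toFun A (H.T₂ (a ⊗ₜ c)))) := by
  refine ⟨fun b => ⟨φ.elemEquiv.symm b, (φ.elemEquiv.apply_symm_apply b).symm, fun c hc => ?_⟩,
    φ.counitHom, φ.antipode, φ.modular, φ.isCounit_counitHom, φ.isAntipode_antipode,
    ⟨φ.modular_bijective, fun a b => (φ.apply_mul_modular a b).symm⟩,
    ⟨φ.rightIntegral, fun a => rfl⟩, φ.dualHopf, ⟨φ.dualPairing, rfl, φ.leftActionDual_elem,
      φ.rightActionDual_elem, φ.exists_dual_eq_left, φ.exists_eq_left, fun b c hb a => ?_,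
      fun ψ => ⟨φ.exists_dual_eq_rightIntegral ψ, φ.exists_eq_rightIntegral ψ,
        fun b c hb a => ?_⟩⟩, ?_⟩
  · rw [hc, φ.elemEquiv_symm_elem]
  -- `S` turns the slice of `Δ(c)(1 ⊗ a)` into that of `(1 ⊗ c)Δ(a)`, which is `(ι ⊗ φ(c ·))Δ(a)`.
  · rw [φ.antipode_sliceRight_T₁]
    exact φ.leftAction_eq_of_left hb a
  · rw [φ.antipode_sliceLeft_T₂]
    exact φ.rightAction_eq_of_right hb a
  · rintro K ⟨P, hP, -⟩
    exact φ.eq_dualHopf P hP
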